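/- **Setting.** Let $d\in\{2,3\}$, let $\Omega\subset\mathbb R^d$ be a polyhedral domain with a conforming triangulation $\mathcal T_0$ into closed simplices, and fix a polynomial degree $n$. A *conforming refinement* of $\mathcal T_0$ is a conforming triangulation of $\Omega$ whose elements arise from those of $\mathcal T_0$ by finitely many newest vertex bisections (for $d=3$: the standard bisection of tagged tetrahedra), for some initial labelling of $\mathcal T_0$ (vertex orderings and tags). For a triangulation $\mathcal T$ let $\mathbb V_{\mathcal T}$ be the space of functions in $H^1_0(\Omega)$ that are polynomials of degree $\le n$ on each $T\in\mathcal T$; let $h_T=|T|^{1/d}$, and let $\omega_T$ be the union of $T$ and all elements sharing a $(d-1)$-dimensional face with $T$. Put $h_0=\max_{T\in\mathcal T_0}h_T$. Let $A:\Omega\to\mathbb R^{d\times d}$ be Lipschitz, symmetric and uniformly positive definite and bounded; let $b:\Omega\times\mathbb R\to\mathbb R$ be measurable in the first and smooth in the second argument with $b'\ge 0$, where $b'$ is the derivative in the second argument and $b(u)$ means $b(\cdot,u(\cdot))$; let $f,g\in L_2(\Omega)$ and $a(u,v)=\int_\Omega A\nabla u\cdot\nabla v$. Let $u\in H^1_0(\Omega)$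 solve $a(u,v)+\langle b(u),v\rangle=\int_\Omega fv$ for all $v\in H_0^1(\Omega)$. A *Galerkin solution* on $\mathcal T$ is a function in $\mathbb V_{\mathcal T}$ that satisfies this equation for all $v\in\mathbb V_{\mathcal T}$. Let $u_-,u_+\in L_\infty(\Omega)$ be such that $u$ and all Galerkin solutions considered below lie in $[u_-,u_+]$ almost everywhere. Let $B,\Theta\ge 0$ be Lipschitz constants of $b(x,\cdot)$ and $b'(x,\cdot)$ respectively on $[u_-(x),u_+(x)]$ for a.e. $x\in\Omega$ (where $u_-(x)=u_+(x)$, the condition on $B$ is read as $|b'(x,u_-(x))|\le B$). Let $z_-,z_+\in L_\infty(\Omega)$ and $K_Z=\max(\|z_-\|_{L_\infty(\Omega)},\|z_+\|_{L_\infty(\Omega)})$. For $y=u$ or $y$ a Galerkin solution, $v\in\mathbb V_{\mathcal T}$ and $T\in\mathcal T$, define the dual indicator linearized about $y$ by $$\zeta_{\mathcal T}[y](v,T)^2=h_T^2\,\|g+\nabla\cdot(A\nabla v)-b'(y)v\|_{L_2(T)}^2+h_T\,\|J_T(v)\|_{L_2(\partial T\cap\Omega)}^2,$$ where $J_T(v)$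 is the jump of $A\nabla v\cdot n$ across $\partial T$ and $n$ is the outward unit normal of $T$. For $\mathcal M\subseteq\mathcal T$ put $\zeta_{\mathcal T}[y]^2(v,\mathcal M)=\sum_{T\in\mathcal M}\zeta_{\mathcal T}[y](v,T)^2$. Finally let $$\eta_{\mathcal T}(\mathbf D,T)^2=h_T^2\left(\|\operatorname{div}A\|_{L_\infty(T)}^2+h_T^{-2}\|A\|_{L_\infty(\omega_T)}^2+B^2\right),\qquad \eta_0=\max_{T\in\mathcal T_0}\eta_{\mathcal T_0}(\mathbf D,T).$$ **Claim.** There is a constant $\bar\Lambda_1>0$, depending only on $d$, the initial mesh $\mathcal T_0$ and the fixed degree $n$, such that for all data and solutions as above the following hold. 1. Let $\mathcal T$ be a conforming refinement of $\mathcal T_0$, and let $u_j,u_k$ be Galerkin solutions on conforming refinements $\mathcal T_j,\mathcal T_k$ of $\mathcal T_0$. For all $v,w\in\mathbb V_{\mathcal T}\cap[z_-,z_+]$ and all $T\in\mathcal T$, $$|\zeta_{\mathcal T}[u_j](v,T)-\zeta_{\mathcal T}[u_k](w,T)|\le\bar\Lambda_1\,\eta_{\mathcal T}(\mathbf D,T)\,\|v-w\|_{H^1(\omega_T)}+\Theta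 K_Z\,h_T\,\|u_j-u_k\|_{L_2(T)}.$$ 2. Let $\mathcal T_1$ be a conforming refinement of $\mathcal T_0$ with Galerkin solution $u_1$ on $\mathcal T_1$, and write $\zeta_{1,1}=\zeta_{\mathcal T_1}[u_1]$ (approximate indicator) and $\zeta_1=\zeta_{\mathcal T_1}[u]$ (limiting indicator). For all $v,w\in\mathbb V_{\mathcal T_1}\cap[z_-,z_+]$ and all $T\in\mathcal T_1$, $$|\zeta_{1,1}(v,T)-\zeta_1(w,T)|\le\bar\Lambda_1\,\eta_{\mathcal T_1}(\mathbf D,T)\,\|v-w\|_{H^1(\omega_T)}+\Theta K_Z\,h_T\,\|u-u_1\|_{L_2(T)}.$$ 3. In the situation of 2, for all $\mathcal M_1,\mathcal M_2\subseteq\mathcal T_1$ and all $\delta_1,\delta_2,\delta_A,\delta_B>0$, $$\zeta_1^2(v,\mathcal M_1)\ge\frac{\zeta_{1,1}^2(w,\mathcal M_1)}{(1+\delta_1)(1+\delta_A)}-\frac{\Theta^2K_Z^2h_0^2}{(1+\delta_1)\,\delta_A}\|u-u_1\|_{L_2(\Omega)}^2-\frac{(d+2)\bar\Lambda_1^2\eta_0^2}{\delta_1}\|v-w\|_{H^1(\Omega)}^2,$$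 $$\zeta_{1,1}^2(w,\mathcal M_2)\ge\frac{\zeta_1^2(v,\mathcal M_2)}{(1+\delta_2)(1+\delta_B)}-\frac{\Theta^2K_Z^2h_0^2}{(1+\delta_2)\,\delta_B}\|u-u_1\|_{L_2(\Omega)}^2-\frac{(d+2)\bar\Lambda_1^2\eta_0^2}{\delta_2}\|v-w\|_{H^1(\Omega)}^2.$$ -/

import Mathlib

open MeasureTheory
open scoped ContDiff

namespace GOAFEM

/-- The space `ℝ^d` with its Euclidean norm. -/
abbrev Sp (d : ℕ) : Type := EuclideanSpace ℝ (Fin d)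

noncomputable section

variable {d : ℕ}

/-! ### Lebesgue and Sobolev spaces on an open set -/

/-- The `L_p` norm over a set `D` as a real number. -/
def lpNorm {F : Type*} [NormedAddCommGroup F] (p : ENNReal) (D : Set (Sp d)) (v : Sp d → F) : ℝ :=
  (eLpNorm v p (volume.restrict D)).toReal

/-- The `L_2` norm over a set `D`. -/
def l2Norm {F : Type*} [NormedAddCommGroup F] (D : Set (Sp d)) (v : Sp d → F) : ℝ :=
  lpNorm 2 D v

/-- Test functions `φ ∈ C_c^∞(Ω)`. -/
def IsTestFunction (Ω : Set (Sp d)) (φ : Sp d → ℝ) : Prop :=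
  ContDiff ℝ ∞ φ ∧ HasCompactSupport φ ∧ tsupport φ ⊆ Ω

/-- `G ∈ L_2(Ω)^d` is the weak gradient of `v` in `Ω`:
`∫_Ω v ∇φ = - ∫_Ω φ G` for all test functions `φ`. -/
def IsWeakGradient (Ω : Set (Sp d)) (v : Sp d → ℝ) (G : Sp d → Sp d) : Prop :=
  MemLp G 2 (volume.restrict Ω) ∧
  ∀ φ : Sp d → ℝ, IsTestFunction Ω φ →
    ∫ x in Ω, v x • gradient φ x = - ∫ x in Ω, φ x • G x

/-- `v ∈ H^1(Ω)`. -/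
def MemH1 (Ω : Set (Sp d)) (v : Sp d → ℝ) : Prop :=
  MemLp v 2 (volume.restrict Ω) ∧ ∃ G, IsWeakGradient Ω v G

open Classical in
/-- The weak gradient in `Ω` of a function `v ∈ H^1(Ω)`; it is unique up to a null subset of `Ω`. -/
def weakGrad (Ω : Set (Sp d)) (v : Sp d → ℝ) : Sp d → Sp d :=
  if h : ∃ G, IsWeakGradient Ω v G then h.choose else 0

/-- `v ∈ H^1_0(Ω)`: `v` belongs to the closure of `C_c^∞(Ω)` in `H^1(Ω)`. -/
def MemH10 (Ω : Set (Sp d)) (v : Sp d → ℝ) : Prop :=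
  MemH1 Ω v ∧ ∃ φ : ℕ → Sp d → ℝ, (∀ m, IsTestFunction Ω (φ m)) ∧
    Filter.Tendsto (fun m => eLpNorm (φ m - v) 2 (volume.restrict Ω)) Filter.atTop (nhds 0) ∧
    Filter.Tendsto (fun m => eLpNorm (gradient (φ m) - weakGrad Ω v) 2 (volume.restrict Ω))
      Filter.atTop (nhds 0)

/-- The norm of `v ∈ H^1(Ω)` over a part `D` of `Ω`:
`‖v‖_{H^1(D)}^2 = ‖v‖_{L_2(D)}^2 + ‖∇v‖_{L_2(D)}^2`. -/
def h1Norm (Ω D : Set (Sp d)) (v : Sp d → ℝ) : ℝ :=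
  Real.sqrt (l2Norm D v ^ 2 + l2Norm D (weakGrad Ω v) ^ 2)

/-! ### The semilinear problem -/

/-- The assumptions on the data `(A, b, f)`. The value `A x` is a `d × d` matrix, as an operator on
`ℝ^d`; `b x ξ` is `b(x, ξ)` and `deriv (b x) ξ` is `b'(x, ξ)`. -/
structure ProblemData (Ω : Set (Sp d)) (A : Sp d → (Sp d →L[ℝ] Sp d)) (b : Sp d → ℝ → ℝ)
    (f : Sp d → ℝ) : Prop where
  lipschitz : ∃ K : NNReal, LipschitzOnWith K A Ω
  symmetric : ∀ x ∈ Ω, ∀ ξ ζ : Sp d, inner ℝ (A x ξ) ζ = inner ℝ ξ (A x ζ)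
  elliptic : ∃ μ₀ μ₁ : ℝ, 0 < μ₀ ∧ ∀ x ∈ Ω, ∀ ξ : Sp d,
    μ₀ * ‖ξ‖ ^ 2 ≤ inner ℝ (A x ξ) ξ ∧ inner ℝ (A x ξ) ξ ≤ μ₁ * ‖ξ‖ ^ 2
  measurable : ∀ ξ : ℝ, AEMeasurable (fun x => b x ξ) (volume.restrict Ω)
  smooth : ∀ x ∈ Ω, ContDiff ℝ ∞ (b x)
  monotone : ∀ x ∈ Ω, ∀ ξ : ℝ, 0 ≤ deriv (b x) ξ
  source : MemLp f 2 (volume.restrict Ω)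

/-- The bilinear form `a(u, v) = ∫_Ω A ∇u · ∇v`. -/
def aForm (Ω : Set (Sp d)) (A : Sp d → (Sp d →L[ℝ] Sp d)) (u v : Sp d → ℝ) : ℝ :=
  ∫ x in Ω, inner ℝ (A x (weakGrad Ω u x)) (weakGrad Ω v x)

/-- `u ∈ V` and `a(u, v) + ⟨b(u), v⟩ = f(v)` for all `v ∈ V`, the pairings being integrable. -/
def SolvesIn (V : Set (Sp d → ℝ)) (Ω : Set (Sp d)) (A : Sp d → (Sp d →L[ℝ] Sp d))
    (b : Sp d → ℝ → ℝ) (f : Sp d → ℝ) (u : Sp d → ℝ) : Prop :=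
  u ∈ V ∧ ∀ v ∈ V, IntegrableOn (fun x => b x (u x) * v x) Ω ∧
    aForm Ω A u v + ∫ x in Ω, b x (u x) * v x = ∫ x in Ω, f x * v x

/-- The weak solution `u ∈ H^1_0(Ω)` of the primal problem. -/
def IsPrimalSolution (Ω : Set (Sp d)) (A : Sp d → (Sp d →L[ℝ] Sp d))
    (b : Sp d → ℝ → ℝ) (f : Sp d → ℝ) (u : Sp d → ℝ) : Prop :=
  SolvesIn {v | MemH10 Ω v} Ω A b f u

/-- `v` lies in the order interval `[m, p]`, almost everywhere in `Ω`. -/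
def InInterval (Ω : Set (Sp d)) (m p v : Sp d → ℝ) : Prop :=
  ∀ᵐ x ∂(volume.restrict Ω), m x ≤ v x ∧ v x ≤ p x

/-- `B` is a Lipschitz constant of `b(x, ·)` on `[m(x), p(x)]` for almost every `x ∈ Ω`. Where the
interval is a single point, the condition on `B` is read as `|b'(x, m(x))| ≤ B`. -/
def IsLipConst (Ω : Set (Sp d)) (b : Sp d → ℝ → ℝ) (m p : Sp d → ℝ) (B : ℝ) : Prop :=
  0 ≤ B ∧ ∀ᵐ x ∂(volume.restrict Ω),
    (∀ s ∈ Set.Icc (m x) (p x), ∀ t ∈ Set.Icc (m x) (p x), |b x s - b x t| ≤ B * |s - t|) ∧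
    (m x = p x → |deriv (b x) (m x)| ≤ B)

/-- `Θ` is a Lipschitz constant of `b'(x, ·)` on `[m(x), p(x)]` for almost every `x ∈ Ω`. -/
def IsDerivLipConst (Ω : Set (Sp d)) (b : Sp d → ℝ → ℝ) (m p : Sp d → ℝ) (Θ : ℝ) : Prop :=
  0 ≤ Θ ∧ ∀ᵐ x ∂(volume.restrict Ω),
    ∀ s ∈ Set.Icc (m x) (p x), ∀ t ∈ Set.Icc (m x) (p x),
      |deriv (b x) s - deriv (b x) t| ≤ Θ * |s - t|

/-- The bound `max (‖m‖_∞, ‖p‖_∞)` for the functions in the order interval `[m, p]`. -/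
def intervalBound (Ω : Set (Sp d)) (m p : Sp d → ℝ) : ℝ :=
  max (lpNorm ⊤ Ω m) (lpNorm ⊤ Ω p)

/-! ### Triangulations and newest vertex bisection

A closed `d`-simplex is given by its set of `d + 1` vertices. -/

/-- The closed simplex with vertex set `s`. -/
def cell (s : Finset (Sp d)) : Set (Sp d) := convexHull ℝ (s : Set (Sp d))

/-- `𝒯` is a conforming triangulation of `Ω` into closed `d`-simplices: the simplices cover the
closure of `Ω`, their interiors lie in `Ω`, and any two of them meet in a common subsimplex
(possibly empty). -/
structure IsTriangulation (Ω : Set (Sp d)) (𝒯 : Finset (Finset (Sp d))) : Prop where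
  card_eq : ∀ s ∈ 𝒯, s.card = d + 1
  indep : ∀ s ∈ 𝒯, AffineIndependent ℝ (fun x : s => (x : Sp d))
  cover : ⋃ s ∈ 𝒯, cell s = closure Ω
  interior_subset : ∀ s ∈ 𝒯, interior (cell s) ⊆ Ω
  conforming : ∀ s ∈ 𝒯, ∀ t ∈ 𝒯, cell s ∩ cell t = convexHull ℝ ((s : Set (Sp d)) ∩ t)

/-- A simplex with ordered vertices `x_0, …, x_d` and a tag `k ∈ {1, …, d}`; its refinement edge is
the segment from `x_0` to `x_k`. -/
structure TaggedSimplex (d : ℕ) where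
  pts : Fin (d + 1) → Sp d
  tag : Fin (d + 1)

/-- The midpoint of the refinement edge. -/
def TaggedSimplex.mid (t : TaggedSimplex d) : Sp d := midpoint ℝ (t.pts 0) (t.pts t.tag)

/-- The tag of the children: `k - 1` if `k > 1`, and `d` if `k = 1`. -/
def TaggedSimplex.nextTag (t : TaggedSimplex d) : Fin (d + 1) :=
  if (t.tag : ℕ) ≤ 1 then Fin.last d else t.tag - 1

/-- The child `(x_0, …, x_{k-1}, z, x_{k+1}, …, x_d)`, with `z` the midpoint. -/
def TaggedSimplex.child₁ (t : TaggedSimplex d) : TaggedSimplex d where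
  pts := fun i => if i = t.tag then t.mid else t.pts i
  tag := t.nextTag

/-- The child `(x_1, …, x_k, z, x_{k+1}, …, x_d)`, with `z` the midpoint. -/
def TaggedSimplex.child₂ (t : TaggedSimplex d) : TaggedSimplex d where
  pts := fun i => if i < t.tag then t.pts (i + 1) else if i = t.tag then t.mid else t.pts i
  tag := t.nextTag

/-- `t'` arises from `t` by finitely many (possibly no) bisections. For `d = 2` this is newest
vertex bisection of triangles, for `d = 3` its standard extension to tetrahedra. -/
def TaggedSimplex.Descendant (t t' : TaggedSimplex d) : Prop :=
  Relation.ReflTransGen (fun p q => q = p.child₁ ∨ q = p.child₂) t t'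

/-- `𝒯` is a conforming refinement of `𝒯₀`: a conforming triangulation of the same domain all of
whose simplices arise by bisection from simplices of `𝒯₀`, for some labelling `τ` of `𝒯₀` by vertex
orderings and tags. -/
def IsRefinement (Ω : Set (Sp d)) (𝒯₀ 𝒯 : Finset (Finset (Sp d))) : Prop :=
  IsTriangulation Ω 𝒯 ∧
  ∃ τ : Finset (Sp d) → TaggedSimplex d,
    (∀ s ∈ 𝒯₀, Set.range (τ s).pts = (s : Set (Sp d)) ∧ (τ s).tag ≠ 0) ∧
    ∀ s ∈ 𝒯, ∃ s₀ ∈ 𝒯₀, ∃ t : TaggedSimplex d,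
      (τ s₀).Descendant t ∧ Set.range t.pts = (s : Set (Sp d))

/-- The element size `h_T = |T|^{1/d}`. -/
def meshSize (s : Finset (Sp d)) : ℝ := (volume (cell s)).toReal ^ (1 / (d : ℝ))

/-- The maximal element size of a triangulation. -/
def maxMeshSize (𝒯 : Finset (Finset (Sp d))) : ℝ := ⨆ s : 𝒯, meshSize (s : Finset (Sp d))

/-- The simplices `s` and `t` of a conforming triangulation share a true hyperface, that is, they
have exactly `d` common vertices. -/
def IsNeighbour (s t : Finset (Sp d)) : Prop := ((s : Set (Sp d)) ∩ t).ncard = d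

/-- The patch `ω_T` of `T` and the elements that share a true hyperface with it. -/
def patch (𝒯 : Finset (Finset (Sp d))) (s : Finset (Sp d)) : Set (Sp d) :=
  cell s ∪ ⋃ t ∈ 𝒯, ⋃ _ : IsNeighbour s t, cell t

/-! ### Finite element functions -/

/-- The polynomial `p` has degree at most `n` and represents `v` on the simplex `s`. -/
def IsPiece (n : ℕ) (s : Finset (Sp d)) (v : Sp d → ℝ) (p : MvPolynomial (Fin d) ℝ) : Prop :=
  p.totalDegree ≤ n ∧
    ∀ᵐ x ∂(volume.restrict (cell s)), v x = MvPolynomial.eval (fun i => x i) p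

/-- The finite element space: functions in `H^1_0(Ω)` that are polynomials of degree at most `n` on
every element. -/
def feSpace (Ω : Set (Sp d)) (n : ℕ) (𝒯 : Finset (Finset (Sp d))) : Set (Sp d → ℝ) :=
  {v | MemH10 Ω v ∧ ∀ s ∈ 𝒯, ∃ p, IsPiece n s v p}

open Classical in
/-- The polynomial that represents a finite element function on an element. -/
def piece (n : ℕ) (s : Finset (Sp d)) (v : Sp d → ℝ) : MvPolynomial (Fin d) ℝ :=
  if h : ∃ p, IsPiece n s v p then h.choose else 0

/-- The gradient of a finite element function on the (closed) element `s`. -/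
def pieceGrad (n : ℕ) (s : Finset (Sp d)) (v : Sp d → ℝ) : Sp d → Sp d :=
  gradient (fun x : Sp d => MvPolynomial.eval (fun i => x i) (piece n s v))

/-- The discrete primal solution in the finite element space over `𝒯`. -/
def IsGalerkinSolution (Ω : Set (Sp d)) (n : ℕ) (𝒯 : Finset (Finset (Sp d)))
    (A : Sp d → (Sp d →L[ℝ] Sp d)) (b : Sp d → ℝ → ℝ) (f : Sp d → ℝ) (u : Sp d → ℝ) : Prop :=
  SolvesIn (feSpace Ω n 𝒯) Ω A b f u

/-! ### Error indicators -/

/-- The divergence of a vector field. -/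
def divVec (F : Sp d → Sp d) (x : Sp d) : ℝ :=
  ∑ i : Fin d, (fderiv ℝ F x (EuclideanSpace.single i 1)) i

/-- The divergence of a matrix field, with components `∑_i ∂_i A_{ki}`. -/
def divMat (A : Sp d → (Sp d →L[ℝ] Sp d)) (x : Sp d) : Sp d :=
  ∑ i : Fin d, (fderiv ℝ A x (EuclideanSpace.single i 1)) (EuclideanSpace.single i 1)

/-- The dual residual `g - (-∇·(A∇v) + b'(y) v)` on the element `s`, linearized about `y`. -/
def dualResidual (n : ℕ) (A : Sp d → (Sp d →L[ℝ] Sp d)) (b : Sp d → ℝ → ℝ) (g y : Sp d → ℝ)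
    (s : Finset (Sp d)) (v : Sp d → ℝ) (x : Sp d) : ℝ :=
  g x - (- divVec (fun z => A z (pieceGrad n s v z)) x + deriv (b x) (y x) * v x)

/-- `ν` is the outward unit normal of the simplex `s` on the hyperface that it shares with `t`. -/
def IsOutwardNormal (s t : Finset (Sp d)) (ν : Sp d) : Prop :=
  ‖ν‖ = 1 ∧ ∀ x ∈ s, x ∈ t → ∀ y ∈ s, inner ℝ ν (y - x) ≤ 0

open Classical in
/-- The outward unit normal of `s` on the hyperface shared with `t`. -/
def outwardNormal (s t : Finset (Sp d)) : Sp d :=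
  if h : ∃ ν, IsOutwardNormal s t ν then h.choose else 0

/-- The jump of `A∇v · n` across the hyperface common to `s` and `t`: the limit from outside `s`
(that is, from `t`) minus the limit from inside `s`. -/
def jump (n : ℕ) (A : Sp d → (Sp d →L[ℝ] Sp d)) (s t : Finset (Sp d)) (v : Sp d → ℝ)
    (x : Sp d) : ℝ :=
  inner ℝ (A x (pieceGrad n t v x)) (outwardNormal s t)
    - inner ℝ (A x (pieceGrad n s v x)) (outwardNormal s t)

open Classical in
/-- `‖J_T(v)‖_{L_2(∂T)}^2` with respect to the surface measure. The part of `∂T` inside `Ω` consists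
of the hyperfaces shared with neighbours; no jump is taken on `∂Ω`. -/
def jumpNormSq (Ω : Set (Sp d)) (n : ℕ) (𝒯 : Finset (Finset (Sp d)))
    (A : Sp d → (Sp d →L[ℝ] Sp d)) (s : Finset (Sp d)) (v : Sp d → ℝ) : ℝ :=
  ∑ t ∈ 𝒯.filter (fun t => IsNeighbour s t),
    (eLpNorm (jump n A s t v) 2
      ((Measure.euclideanHausdorffMeasure (d - 1)).restrict (cell s ∩ cell t ∩ Ω))).toReal ^ 2

/-- The dual error indicator linearized about `y`,
`(h_T^2 ‖g + ∇·(A∇v) - b'(y)v‖_{L_2(T)}^2 + h_T ‖J_T(v)‖_{L_2(∂T)}^2)^{1/2}`.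
With `y = u_j` this is the approximate indicator, with `y = u` the limiting one. -/
def dualIndicator (Ω : Set (Sp d)) (n : ℕ) (𝒯 : Finset (Finset (Sp d)))
    (A : Sp d → (Sp d →L[ℝ] Sp d)) (b : Sp d → ℝ → ℝ) (g y : Sp d → ℝ)
    (v : Sp d → ℝ) (s : Finset (Sp d)) : ℝ :=
  Real.sqrt (meshSize s ^ 2 * l2Norm (cell s) (dualResidual n A b g y s v) ^ 2
    + meshSize s * jumpNormSq Ω n 𝒯 A s v)

/-- The squared dual estimator over a set `ℳ` of elements. -/
def dualEstimatorSq (Ω : Set (Sp d)) (n : ℕ) (𝒯 : Finset (Finset (Sp d)))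
    (A : Sp d → (Sp d →L[ℝ] Sp d)) (b : Sp d → ℝ → ℝ) (g y : Sp d → ℝ)
    (v : Sp d → ℝ) (ℳ : Finset (Finset (Sp d))) : ℝ :=
  ∑ s ∈ ℳ, dualIndicator Ω n 𝒯 A b g y v s ^ 2

/-- The data estimator on an element,
`(h_T^2 (‖div A‖_{L_∞(T)}^2 + h_T^{-2} ‖A‖_{L_∞(ω_T)}^2 + B^2))^{1/2}`. -/
def dataEstimator (𝒯 : Finset (Finset (Sp d))) (A : Sp d → (Sp d →L[ℝ] Sp d)) (B : ℝ)
    (s : Finset (Sp d)) : ℝ :=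
  Real.sqrt (meshSize s ^ 2 * (lpNorm ⊤ (cell s) (divMat A) ^ 2
    + (meshSize s ^ 2)⁻¹ * lpNorm ⊤ (patch 𝒯 s) A ^ 2 + B ^ 2))

/-- The maximal data estimator over all elements of a triangulation. -/
def maxDataEstimator (𝒯 : Finset (Finset (Sp d))) (A : Sp d → (Sp d →L[ℝ] Sp d)) (B : ℝ) : ℝ :=
  ⨆ s : 𝒯, dataEstimator 𝒯 A B (s : Finset (Sp d))

end

end GOAFEM

open GOAFEM

/-!
Every dual indicator is the Euclidean norm of the vector whose entries are `h_T` times the `L_2` norm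
of the element residual and `h_T^{1/2}` times the `L_2` norms of the jumps over the hyperfaces. By the
reverse triangle inequality, the difference of two indicators is at most the sum of the norms of the
differences of these entries (`exists_dualIndicator_stability`).

With `e = v - w`, the residuals linearized about `y₁` and `y₂` differ by
`∇·(A∇e) - b'(y₁) e - (b'(y₁) - b'(y₂)) w`. The last term is bounded by `Θ K_Z |y₁ - y₂|`. By the
product rule the first one is `div A · ∇e + A : D²e`, and an inverse estimate bounds `h_T D²e` by `∇e`.
The jumps of `A∇e · n` are bounded in the same way, by the inverse estimate for the maximum of `∇e`
and by the size of the hyperface. All bounds of the theorem on indicators are instances of this one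
estimate, with different choices of `y₁` and `y₂`.

The constants in the inverse and trace estimates depend on `𝒯₀`, `d` and `n` only, since bisection
creates finitely many similarity classes of simplices (`exists_simplex_shapes`). The reason is that a
tagged simplex is, up to translation and scaling, determined by its tag and a path of `d` steps: its
vertices up to the tag are the points of the path, and the later ones are half of them. Bisection
keeps this form; one child has the same path, and for the other one a step is reversed and moved. So
the steps always come from a finite set that depends on `𝒯₀` only. On each of the finitely many
shapes the inverse estimate is an equivalence of seminorms on a finite-dimensional space
(`exists_polyGrad_bound`), and it scales (`exists_polyGrad_bound_simImage`).

The estimator bounds follow by applying Young's inequality twice and summing (`dualEstimatorSq_ge`).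
Here each element lies in at most `d + 2` patches, because two elements with a common hyperface lie
on different sides of it (`coord_neg_of_inter`), so that an element has at most `d + 1` neighbours.
Furthermore `h_T` and the data estimator do not grow under refinement, because patches of refined
elements are contained in patches of initial elements (`IsRefinement.exists_patch_subset`).
-/

open scoped Pointwise

namespace GOAFEM

variable {d : ℕ}

/-! ### Polynomials on a simplex -/

/-- The function on `ℝ^d` given by a polynomial in the coordinates. -/
noncomputable def polyFun (p : MvPolynomial (Fin d) ℝ) : Sp d → ℝ :=
  fun x => MvPolynomial.eval (fun i => x i) p

/-- The gradient of a polynomial function. -/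
noncomputable def polyGrad (p : MvPolynomial (Fin d) ℝ) : Sp d → Sp d := gradient (polyFun p)

theorem contDiff_polyFun (p : MvPolynomial (Fin d) ℝ) : ContDiff ℝ ∞ (polyFun p) := by
  unfold polyFun
  induction p using MvPolynomial.induction_on with
  | C a => simpa using contDiff_const
  | add p q hp hq => simpa using hp.add hq
  | mul_X p i hp =>
    simp only [map_mul, MvPolynomial.eval_X]
    exact hp.mul (by fun_prop)

theorem polyFun_differentiable (p : MvPolynomial (Fin d) ℝ) : Differentiable ℝ (polyFun p) :=
  (contDiff_polyFun p).differentiable (by simp)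

theorem contDiff_polyGrad (p : MvPolynomial (Fin d) ℝ) : ContDiff ℝ ∞ (polyGrad p) := by
  unfold polyGrad gradient
  exact (InnerProductSpace.toDual ℝ (Sp d)).symm.contDiff.comp
    ((contDiff_polyFun p).fderiv_right (by simp))

theorem polyGrad_differentiable (p : MvPolynomial (Fin d) ℝ) : Differentiable ℝ (polyGrad p) :=
  (contDiff_polyGrad p).differentiable (by simp)

theorem continuous_polyGrad (p : MvPolynomial (Fin d) ℝ) : Continuous (polyGrad p) :=
  (contDiff_polyGrad p).continuous

theorem continuous_fderiv_polyGrad (p : MvPolynomial (Fin d) ℝ) :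
    Continuous (fderiv ℝ (polyGrad p)) :=
  (contDiff_polyGrad p).continuous_fderiv (by simp)

theorem polyGrad_add (p q : MvPolynomial (Fin d) ℝ) :
    polyGrad (p + q) = polyGrad p + polyGrad q := by
  funext x
  have h : polyFun (p + q) = fun x => polyFun p x + polyFun q x := by
    funext x; simp [polyFun]
  simp only [polyGrad, gradient, Pi.add_apply, h]
  rw [fderiv_fun_add (polyFun_differentiable p x) (polyFun_differentiable q x), map_add]

theorem polyGrad_smul (c : ℝ) (p : MvPolynomial (Fin d) ℝ) :
    polyGrad (c • p) = c • polyGrad p := by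
  funext x
  have h : polyFun (c • p) = fun x => c • polyFun p x := by
    funext x; simp [polyFun]
  simp only [polyGrad, gradient, Pi.smul_apply, h]
  rw [fderiv_fun_const_smul (polyFun_differentiable p x)]
  simp

theorem polyGrad_sub (p q : MvPolynomial (Fin d) ℝ) :
    polyGrad (p - q) = polyGrad p - polyGrad q := by
  rw [sub_eq_add_neg, polyGrad_add, ← neg_one_smul ℝ q, polyGrad_smul]
  simp [sub_eq_add_neg]

/-- The polynomials of bounded degree are invariant under similarities. -/
theorem exists_polyFun_comp {n : ℕ} (p : MvPolynomial (Fin d) ℝ) (hp : p.totalDegree ≤ n)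
    (c : Sp d) (h : ℝ) :
    ∃ q : MvPolynomial (Fin d) ℝ, q.totalDegree ≤ n ∧
      polyFun q = fun x => polyFun p (c + h • x) := by
  classical
  set φ : Fin d → MvPolynomial (Fin d) ℝ :=
    fun i => MvPolynomial.C (c i) + MvPolynomial.C h * MvPolynomial.X i
  have hφ : ∀ i, (φ i).totalDegree ≤ 1 := by
    intro i
    refine (MvPolynomial.totalDegree_add _ _).trans (max_le (by simp) ?_)
    exact (MvPolynomial.totalDegree_mul _ _).trans (by simp)
  refine ⟨MvPolynomial.bind₁ φ p, ?_, ?_⟩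
  · conv_lhs => rw [p.as_sum, map_sum]
    refine (MvPolynomial.totalDegree_finsetSum _ _).trans (Finset.sup_le fun m hm => ?_)
    rw [MvPolynomial.bind₁_monomial]
    refine (MvPolynomial.totalDegree_mul _ _).trans ?_
    rw [MvPolynomial.totalDegree_C, zero_add]
    refine (MvPolynomial.totalDegree_finsetProd _ _).trans ?_
    calc ∑ i ∈ m.support, (φ i ^ m i).totalDegree ≤ ∑ i ∈ m.support, m i :=
          Finset.sum_le_sum fun i _ => (MvPolynomial.totalDegree_pow _ _).trans
            (by simpa using Nat.mul_le_mul_left (m i) (hφ i))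
      _ ≤ n := (MvPolynomial.le_totalDegree hm).trans hp
  · funext x
    simp only [polyFun]
    rw [MvPolynomial.eval, MvPolynomial.eval₂Hom_bind₁]
    congr 2
    funext i
    simp [φ]

theorem polyGrad_comp (p q : MvPolynomial (Fin d) ℝ) (c : Sp d) (h : ℝ)
    (hq : polyFun q = fun x => polyFun p (c + h • x)) :
    polyGrad q = fun x => h • polyGrad p (c + h • x) := by
  funext x
  have h1 : HasFDerivAt (fun x : Sp d => c + h • x) (h • ContinuousLinearMap.id ℝ (Sp d)) x :=
    ((hasFDerivAt_id x).const_smul h).const_add c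
  have h2 := (polyFun_differentiable p (c + h • x)).hasFDerivAt.comp x h1
  simp only [polyGrad, gradient, hq]
  rw [show (fun x => polyFun p (c + h • x)) = polyFun p ∘ fun x => c + h • x from rfl, h2.fderiv]
  simp

theorem fderiv_polyGrad_comp (p q : MvPolynomial (Fin d) ℝ) (c : Sp d) (h : ℝ)
    (hq : polyFun q = fun x => polyFun p (c + h • x)) (x : Sp d) :
    fderiv ℝ (polyGrad q) x = h ^ 2 • fderiv ℝ (polyGrad p) (c + h • x) := by
  have h1 : HasFDerivAt (fun x : Sp d => c + h • x) (h • ContinuousLinearMap.id ℝ (Sp d)) x :=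
    ((hasFDerivAt_id x).const_smul h).const_add c
  have h2 := ((polyGrad_differentiable p (c + h • x)).hasFDerivAt.comp x h1).const_smul h
  rw [polyGrad_comp p q c h hq]
  refine (HasFDerivAt.fderiv h2).trans ?_
  ext1 y
  simp [pow_two, smul_smul]

/-- A linear map out of a finite-dimensional space is bounded by every linear map with a smaller
kernel. -/
theorem exists_norm_le_of_ker_le {V E F : Type*} [AddCommGroup V] [Module ℝ V]
    [FiniteDimensional ℝ V] [NormedAddCommGroup E] [NormedSpace ℝ E] [NormedAddCommGroup F]
    [NormedSpace ℝ F] (ι : V →ₗ[ℝ] E) (D : V →ₗ[ℝ] F)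
    (hker : ∀ v, ι v = 0 → D v = 0) : ∃ C : ℝ, 0 < C ∧ ∀ v, ‖D v‖ ≤ C * ‖ι v‖ := by
  obtain ⟨g, hg⟩ := ι.rangeRestrict.exists_rightInverse_of_surjective ι.range_rangeRestrict
  set L := LinearMap.toContinuousLinearMap (D ∘ₗ g)
  refine ⟨‖L‖ + 1, by positivity, fun v => ?_⟩
  have h1 : ι (g (ι.rangeRestrict v) - v) = 0 := by
    have := LinearMap.congr_fun hg (ι.rangeRestrict v)
    have h2 := congrArg Subtype.val this
    rw [map_sub, sub_eq_zero]
    exact h2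
  have h2 : D v = L (ι.rangeRestrict v) := by
    have := hker _ h1
    rw [map_sub, sub_eq_zero] at this
    exact this.symm
  rw [h2]
  refine (L.le_opNorm _).trans ?_
  have : ‖ι.rangeRestrict v‖ = ‖ι v‖ := rfl
  rw [this]
  gcongr
  linarith

theorem isCompact_cell (s : Finset (Sp d)) : IsCompact (cell s) :=
  s.finite_toSet.isCompact_convexHull ℝ

theorem isClosed_cell (s : Finset (Sp d)) : IsClosed (cell s) := (isCompact_cell s).isClosed

theorem measurableSet_cell (s : Finset (Sp d)) : MeasurableSet (cell s) :=
  (isClosed_cell s).measurableSet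

theorem convex_cell (s : Finset (Sp d)) : Convex ℝ (cell s) := convex_convexHull ℝ _

theorem volume_cell_lt_top (s : Finset (Sp d)) : volume (cell s) < ⊤ :=
  (isCompact_cell s).measure_lt_top

instance (s : Finset (Sp d)) : IsFiniteMeasure (volume.restrict (cell s)) :=
  ⟨by simpa using volume_cell_lt_top s⟩

theorem _root_.Continuous.memLp_cell {F : Type*} [NormedAddCommGroup F]
    [SecondCountableTopology F] {f : Sp d → F} (hf : Continuous f)
    (s : Finset (Sp d)) (p : ENNReal) : MemLp f p (volume.restrict (cell s)) := by
  obtain ⟨C, hC⟩ := (isCompact_cell s).exists_bound_of_continuousOn hf.continuousOn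
  exact MemLp.of_bound hf.aestronglyMeasurable C
    ((ae_restrict_iff' (measurableSet_cell s)).2 (Filter.Eventually.of_forall hC))

theorem cell_subset_closure_interior {s : Finset (Sp d)} (hs : (interior (cell s)).Nonempty) :
    cell s ⊆ closure (interior (cell s)) := by
  rw [(convex_cell s).closure_interior_eq_closure_of_nonempty_interior hs]
  exact subset_closure

/-- On a fixed simplex the gradient of a polynomial of bounded degree and the derivative of that
gradient are bounded by the `L_2` norm of the gradient: all seminorms on a finite-dimensional
space that vanish where the `L_2` norm does are dominated by it. -/
theorem exists_polyGrad_bound (n : ℕ) (s : Finset (Sp d)) (hs : (interior (cell s)).Nonempty) :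
    ∃ C : ℝ, 0 < C ∧ ∀ p : MvPolynomial (Fin d) ℝ, p.totalDegree ≤ n → ∀ x ∈ cell s,
      ‖polyGrad p x‖ ≤ C * l2Norm (cell s) (polyGrad p) ∧
      ‖fderiv ℝ (polyGrad p) x‖ ≤ C * l2Norm (cell s) (polyGrad p) := by
  have : CompactSpace (cell s) := isCompact_iff_compactSpace.1 (isCompact_cell s)
  have hfd : ∀ p q : MvPolynomial (Fin d) ℝ,
      fderiv ℝ (polyGrad (p + q)) = fderiv ℝ (polyGrad p) + fderiv ℝ (polyGrad q) := by
    intro p q; funext x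
    rw [polyGrad_add]
    exact fderiv_add (polyGrad_differentiable p x) (polyGrad_differentiable q x)
  have hfs : ∀ (c : ℝ) (p : MvPolynomial (Fin d) ℝ),
      fderiv ℝ (polyGrad (c • p)) = c • fderiv ℝ (polyGrad p) := by
    intro c p; funext x
    rw [polyGrad_smul]
    exact fderiv_const_smul (polyGrad_differentiable p x) c
  let V := MvPolynomial.restrictTotalDegree (Fin d) ℝ n
  let ι : V →ₗ[ℝ] Lp (Sp d) 2 (volume.restrict (cell s)) :=
    { toFun := fun p => ((continuous_polyGrad p.1).memLp_cell s 2).toLp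
      map_add' := fun p q => by
        rw [← MemLp.toLp_add]; exact MemLp.toLp_congr _ _ (by simp [polyGrad_add])
      map_smul' := fun c p => by
        simp only [RingHom.id_apply]
        rw [← MemLp.toLp_const_smul]; exact MemLp.toLp_congr _ _ (by simp [polyGrad_smul]) }
  let D : V →ₗ[ℝ] C(cell s, Sp d) × C(cell s, Sp d →L[ℝ] Sp d) :=
    { toFun := fun p => (⟨fun x => polyGrad p.1 x, by
          exact (continuous_polyGrad p.1).comp continuous_subtype_val⟩,
        ⟨fun x => fderiv ℝ (polyGrad p.1) x, by
          exact (continuous_fderiv_polyGrad p.1).comp continuous_subtype_val⟩)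
      map_add' := fun p q => by
        ext1 <;> ext1 x
        · exact congrFun (polyGrad_add p.1 q.1) x
        · exact congrFun (hfd p.1 q.1) x
      map_smul' := fun c p => by
        ext1 <;> ext1 x
        · exact congrFun (polyGrad_smul c p.1) x
        · exact congrFun (hfs c p.1) x }
  obtain ⟨C, hC, h⟩ := exists_norm_le_of_ker_le (F := C(cell s, Sp d) × C(cell s, Sp d →L[ℝ] Sp d)) ι D (by
    intro p hp
    have h1 : polyGrad p.1 =ᵐ[volume.restrict (cell s)] 0 := by
      have h2 : MemLp.toLp _ ((continuous_polyGrad p.1).memLp_cell s 2) = 0 := hp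
      exact (MemLp.coeFn_toLp ((continuous_polyGrad p.1).memLp_cell s 2)).symm.trans
        ((Lp.eq_zero_iff_ae_eq_zero).1 h2)
    have h2 : Set.EqOn (polyGrad p.1) 0 (interior (cell s)) :=
      Measure.eqOn_open_of_ae_eq (ae_restrict_of_ae_restrict_of_subset interior_subset h1)
        isOpen_interior (continuous_polyGrad p.1).continuousOn continuousOn_const
    have h3 : Set.EqOn (fderiv ℝ (polyGrad p.1)) 0 (interior (cell s)) := by
      intro x hx
      have : polyGrad p.1 =ᶠ[nhds x] fun _ => 0 :=
        Filter.eventuallyEq_of_mem (isOpen_interior.mem_nhds hx) h2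
      rw [this.fderiv_eq]; simp
    have h4 := h2.closure (continuous_polyGrad p.1) continuous_zero
    have h5 := h3.closure (continuous_fderiv_polyGrad p.1) continuous_zero
    ext1 <;> ext1 x
    · exact h4 (cell_subset_closure_interior hs x.2)
    · exact h5 (cell_subset_closure_interior hs x.2))
  refine ⟨C, hC, fun p hp x hx => ?_⟩
  have hp' : p ∈ V := (MvPolynomial.mem_restrictTotalDegree _ _ _).2 hp
  have h1 := h ⟨p, hp'⟩
  have h2 : ‖ι ⟨p, hp'⟩‖ = l2Norm (cell s) (polyGrad p) :=
    Lp.norm_toLp _ ((continuous_polyGrad p).memLp_cell s 2)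
  rw [h2] at h1
  exact ⟨((D ⟨p, hp'⟩).1.norm_coe_le_norm ⟨x, hx⟩).trans ((norm_fst_le _).trans h1),
    ((D ⟨p, hp'⟩).2.norm_coe_le_norm ⟨x, hx⟩).trans ((norm_snd_le _).trans h1)⟩

/-! ### Scaling -/

/-- The similarity `x ↦ c + h x`. -/
def sim (c : Sp d) (h : ℝ) : Sp d → Sp d := fun x => c + h • x

theorem measurableEmbedding_sim (c : Sp d) {h : ℝ} (hh : h ≠ 0) :
    MeasurableEmbedding (sim c h) :=
  (MeasurableEquiv.addLeft c).measurableEmbedding.comp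
    (Homeomorph.smulOfNeZero h hh).measurableEmbedding

theorem map_sim_volume (c : Sp d) {h : ℝ} (hh : 0 < h) :
    Measure.map (sim c h) (volume : Measure (Sp d)) = ENNReal.ofReal ((h ^ d)⁻¹) • volume := by
  have : sim c h = (fun x => c + x) ∘ fun x => h • x := rfl
  rw [this, ← Measure.map_map (measurable_const_add c) (measurable_const_smul h),
    Measure.map_addHaar_smul _ hh.ne', Measure.map_smul, map_add_left_eq_self]
  simp [abs_of_pos hh]

theorem l2Norm_comp_sim {F : Type*} [NormedAddCommGroup F] (c : Sp d) {h : ℝ} (hh : 0 < h)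
    (S : Set (Sp d)) (f : Sp d → F) :
    l2Norm S (f ∘ sim c h) = (h ^ d)⁻¹ ^ (1 / 2 : ℝ) * l2Norm (sim c h '' S) f := by
  have hinj := (measurableEmbedding_sim c hh.ne').injective
  have h1 : Measure.map (sim c h) (volume.restrict S)
      = ENNReal.ofReal ((h ^ d)⁻¹) • volume.restrict (sim c h '' S) := by
    conv_lhs => rw [← hinj.preimage_image S]
    rw [← (measurableEmbedding_sim c hh.ne').restrict_map, map_sim_volume c hh,
      Measure.restrict_smul]
  unfold l2Norm lpNorm
  rw [← (measurableEmbedding_sim c hh.ne').eLpNorm_map_measure, h1,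
    eLpNorm_smul_measure_of_ne_top (by simp), smul_eq_mul, ENNReal.toReal_mul,
    ← ENNReal.toReal_rpow, ENNReal.toReal_ofReal (by positivity)]
  simp

theorem volume_image_sim (c : Sp d) {h : ℝ} (hh : 0 < h) (S : Set (Sp d)) :
    volume (sim c h '' S) = ENNReal.ofReal (h ^ d) * volume S := by
  have : sim c h '' S = (fun x => c + x) '' ((fun x => h • x) '' S) := by
    rw [Set.image_image]; rfl
  rw [this, Set.image_add_left, measure_preimage_add, Set.image_smul, Measure.addHaar_smul]
  simp [abs_of_pos hh]

/-- The image of a vertex set under a similarity. -/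
noncomputable def simImage (c : Sp d) (h : ℝ) (S : Finset (Sp d)) : Finset (Sp d) := by
  classical exact S.image (sim c h)

theorem coe_simImage (c : Sp d) (h : ℝ) (S : Finset (Sp d)) :
    (simImage c h S : Set (Sp d)) = sim c h '' S := by
  simp [simImage]

theorem image_sim_convexHull (c : Sp d) (h : ℝ) (S : Set (Sp d)) :
    sim c h '' convexHull ℝ S = convexHull ℝ (sim c h '' S) := by
  have : sim c h = ⇑((h • LinearMap.id : Sp d →ₗ[ℝ] Sp d).toAffineMap + AffineMap.const ℝ (Sp d) c) := by
    funext x; simp [sim, add_comm]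
  rw [this, AffineMap.image_convexHull]

theorem cell_simImage (c : Sp d) (h : ℝ) (S : Finset (Sp d)) :
    cell (simImage c h S) = sim c h '' cell S := by
  rw [cell, cell, coe_simImage, image_sim_convexHull]

theorem volume_cell_simImage (c : Sp d) {h : ℝ} (hh : 0 < h) (S : Finset (Sp d)) :
    (volume (cell (simImage c h S))).toReal = h ^ d * (volume (cell S)).toReal := by
  rw [cell_simImage, volume_image_sim c hh, ENNReal.toReal_mul, ENNReal.toReal_ofReal (by positivity)]

theorem meshSize_simImage (hd : d ≠ 0) (c : Sp d) {h : ℝ} (hh : 0 < h) (S : Finset (Sp d)) :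
    meshSize (simImage c h S) = h * meshSize S := by
  unfold meshSize
  rw [volume_cell_simImage c hh, Real.mul_rpow (by positivity) (by positivity), one_div,
    Real.pow_rpow_inv_natCast hh.le hd]

/-- The inverse estimate on all simplices similar to `S`, with the scaling made explicit. -/
theorem exists_polyGrad_bound_simImage (hd : d ≠ 0) (n : ℕ) (S : Finset (Sp d))
    (hS : (interior (cell S)).Nonempty) :
    ∃ C : ℝ, 0 < C ∧ ∀ (c : Sp d) (h : ℝ), 0 < h → ∀ p : MvPolynomial (Fin d) ℝ,
      p.totalDegree ≤ n → ∀ x ∈ cell (simImage c h S),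
      √(volume (cell (simImage c h S))).toReal * ‖polyGrad p x‖
        ≤ C * l2Norm (cell (simImage c h S)) (polyGrad p) ∧
      √(volume (cell (simImage c h S))).toReal *
          (meshSize (simImage c h S) * ‖fderiv ℝ (polyGrad p) x‖)
        ≤ C * l2Norm (cell (simImage c h S)) (polyGrad p) := by
  obtain ⟨C, hC, hb⟩ := exists_polyGrad_bound n S hS
  set V := √(volume (cell S)).toReal with hV
  refine ⟨C * V * (1 + meshSize S) + 1, ?_, ?_⟩
  · have : 0 ≤ meshSize S := Real.rpow_nonneg ENNReal.toReal_nonneg _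
    positivity
  intro c h hh p hp x hx
  have hm : 0 ≤ meshSize S := Real.rpow_nonneg ENNReal.toReal_nonneg _
  obtain ⟨q, hq, hqp⟩ := exists_polyFun_comp p hp c h
  rw [cell_simImage] at hx
  obtain ⟨y, hy, rfl⟩ := hx
  obtain ⟨h1, h2⟩ := hb q hq y hy
  rw [fderiv_polyGrad_comp p q c h hqp, norm_smul] at h2
  have hg := polyGrad_comp p q c h hqp
  have hN : l2Norm (cell S) (polyGrad q)
      = h * ((h ^ d)⁻¹ ^ (1 / 2 : ℝ) * l2Norm (cell (simImage c h S)) (polyGrad p)) := by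
    rw [cell_simImage, ← l2Norm_comp_sim c hh]
    have : polyGrad q = h • (polyGrad p ∘ sim c h) := hg
    rw [this]
    unfold l2Norm lpNorm
    rw [eLpNorm_const_smul]
    simp [enorm_eq_nnnorm, abs_of_pos hh]
  rw [hN, congrFun hg y] at h1
  rw [hN] at h2
  simp only [norm_smul, Real.norm_eq_abs, abs_of_pos hh, abs_of_pos (pow_pos hh 2)] at h1 h2
  set N := l2Norm (cell (simImage c h S)) (polyGrad p)
  have hN0 : 0 ≤ N := ENNReal.toReal_nonneg
  rw [volume_cell_simImage c hh, meshSize_simImage hd c hh, Real.sqrt_mul (by positivity), ← hV]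
  rw [← Real.sqrt_eq_rpow, Real.sqrt_inv] at h1 h2
  set r := √(h ^ d)
  have hr : 0 < r := Real.sqrt_pos.2 (by positivity)
  have e1 : r * ‖polyGrad p (c + h • y)‖ ≤ C * N := by
    have : h * (r * ‖polyGrad p (c + h • y)‖) ≤ h * (C * N) := by
      calc _ = r * (h * ‖polyGrad p (c + h • y)‖) := by ring
        _ ≤ r * (C * (h * (r⁻¹ * N))) := by gcongr
        _ = _ := by field_simp
    exact le_of_mul_le_mul_left this hh
  have e2 : r * (h * ‖fderiv ℝ (polyGrad p) (c + h • y)‖) ≤ C * N := by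
    have : h * (r * (h * ‖fderiv ℝ (polyGrad p) (c + h • y)‖)) ≤ h * (C * N) := by
      calc _ = r * (h ^ 2 * ‖fderiv ℝ (polyGrad p) (c + h • y)‖) := by ring
        _ ≤ r * (C * (h * (r⁻¹ * N))) := by gcongr
        _ = _ := by field_simp
    exact le_of_mul_le_mul_left this hh
  have hV0 : 0 ≤ V := Real.sqrt_nonneg _
  have hCN : 0 ≤ C * N := by positivity
  constructor
  · calc r * V * ‖polyGrad p (c + h • y)‖ = V * (r * ‖polyGrad p (c + h • y)‖) := by ring
      _ ≤ V * (C * N) := by gcongr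
      _ ≤ (C * V * (1 + meshSize S) + 1) * N := by
        nlinarith [mul_nonneg (mul_nonneg hV0 hCN) hm]
  · calc r * V * (h * meshSize S * ‖fderiv ℝ (polyGrad p) (c + h • y)‖)
        = V * meshSize S * (r * (h * ‖fderiv ℝ (polyGrad p) (c + h • y)‖)) := by ring
      _ ≤ V * meshSize S * (C * N) := by gcongr
      _ ≤ (C * V * (1 + meshSize S) + 1) * N := by
        nlinarith [mul_nonneg hV0 hCN]

/-! ### Shapes of bisected simplices -/

/-- The `i`-th vertex of the tagged simplex of tag `k`, size `1` and first vertex `0` that is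
described by the steps `w`: the vertices up to the `k`-th one form the path with steps `w`, and each
later one is half of the corresponding point of the path. -/
noncomputable def shapePt (w : ℕ → Sp d) (k i : ℕ) : Sp d :=
  if i ≤ k then ∑ j ∈ Finset.range i, w j else (1 / 2 : ℝ) • ∑ j ∈ Finset.range i, w j

/-- Up to a similarity, `t` is described by a path with steps from `W`. -/
def HasShape (W : Set (Sp d)) (t : TaggedSimplex d) : Prop :=
  t.tag ≠ 0 ∧ ∃ h : ℝ, 0 < h ∧ ∃ w : ℕ → Sp d, (∀ j < d, w j ∈ W) ∧
    ∀ i, t.pts i = t.pts 0 + h • shapePt w t.tag i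

theorem TaggedSimplex.nextTag_ne_zero (hd : d ≠ 0) (t : TaggedSimplex d) : t.nextTag ≠ 0 := by
  unfold TaggedSimplex.nextTag
  split_ifs with h
  · intro h0
    have := congrArg Fin.val h0
    simp at this
    exact hd this
  · intro h0
    have h1 : t.tag = 1 := sub_eq_zero.1 h0
    apply h
    rw [h1]
    obtain _ | d := d
    · exact absurd rfl hd
    · simp

theorem TaggedSimplex.nextTag_val (t : TaggedSimplex d) :
    (t.nextTag : ℕ) = if (t.tag : ℕ) ≤ 1 then d else (t.tag : ℕ) - 1 := by
  unfold TaggedSimplex.nextTag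
  split_ifs with h
  · simp
  · obtain _ | d := d
    · have := t.tag.2; omega
    · rw [Fin.val_sub_one_of_ne_zero]
      intro h0; rw [h0] at h; simp at h

theorem TaggedSimplex.mid_eq {t : TaggedSimplex d} {h : ℝ} {w : ℕ → Sp d}
    (hw : ∀ i, t.pts i = t.pts 0 + h • shapePt w t.tag i) :
    t.mid = t.pts 0 + (h / 2) • ∑ j ∈ Finset.range t.tag, w j := by
  rw [TaggedSimplex.mid, hw t.tag, shapePt, if_pos le_rfl, midpoint_eq_smul_add, invOf_eq_inv]
  module

theorem HasShape.child₁ (hd : d ≠ 0) {W : Set (Sp d)} {t : TaggedSimplex d} (ht : HasShape W t) :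
    HasShape W t.child₁ := by
  obtain ⟨h0, h, hh, w, hW, hw⟩ := ht
  have hmid := TaggedSimplex.mid_eq hw
  have h0' : (t.tag : ℕ) ≠ 0 := fun h => h0 (Fin.ext h)
  have hp0 : t.child₁.pts 0 = t.pts 0 := by simp [TaggedSimplex.child₁, h0.symm]
  refine ⟨t.nextTag_ne_zero hd, if (t.tag : ℕ) ≤ 1 then h / 2 else h, ?_, w, hW, fun i => ?_⟩
  · split_ifs <;> positivity
  · rw [hp0]
    have hi : (i : ℕ) ≤ d := by have := i.2; omega
    show (if i = t.tag then t.mid else t.pts i) = _ + _ • shapePt w t.nextTag i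
    rw [TaggedSimplex.nextTag_val]
    split_ifs with h1 h2 h2
    · subst h1; rw [hmid, shapePt, if_pos hi]
    · subst h1
      rw [hmid, shapePt, if_neg (by omega), smul_smul]; congr 2; ring
    · rw [hw i]
      have h3 : (i : ℕ) ≠ t.tag := fun h => h1 (Fin.ext h)
      rcases Nat.eq_zero_or_pos (i : ℕ) with h4 | h4
      · simp [shapePt, h4]
      · rw [shapePt, shapePt, if_neg (by omega), if_pos hi, smul_smul]; congr 2; ring
    · rw [hw i]
      have h3 : (i : ℕ) ≠ t.tag := fun h => h1 (Fin.ext h)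
      simp only [shapePt]
      rcases lt_or_gt_of_ne h3 with h4 | h4
      · rw [if_pos h4.le, if_pos (by omega)]
      · rw [if_neg (by omega), if_neg (by omega)]

theorem HasShape.child₂ (hd : d ≠ 0) {W : Set (Sp d)} (hWn : ∀ x ∈ W, -x ∈ W)
    {t : TaggedSimplex d} (ht : HasShape W t) : HasShape W t.child₂ := by
  obtain ⟨h0, h, hh, w, hW, hw⟩ := ht
  have hmid := TaggedSimplex.mid_eq hw
  have h0' : 0 < (t.tag : ℕ) := Nat.pos_of_ne_zero fun h => h0 (Fin.ext h)
  have htd : (t.tag : ℕ) ≤ d := by have := t.tag.2; omega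
  -- The path loses its first step, which comes back reversed after the last step.
  set w' : ℕ → Sp d := fun j =>
    if j + 1 < t.tag then w (j + 1) else if j + 1 = t.tag then - w 0 else w j with hw'
  have hS1 : ∀ i : ℕ, i < t.tag →
      ∑ j ∈ Finset.range i, w' j = ∑ j ∈ Finset.range (i + 1), w j - w 0 := by
    intro i hi
    rw [Finset.sum_range_succ', add_sub_cancel_right]
    refine Finset.sum_congr rfl fun j hj => ?_
    rw [Finset.mem_range] at hj
    simp only [hw']; rw [if_pos (by omega)]
  have hS2 : ∀ i : ℕ, (t.tag : ℕ) ≤ i →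
      ∑ j ∈ Finset.range i, w' j = ∑ j ∈ Finset.range i, w j - (2 : ℝ) • w 0 := by
    intro i hi
    induction i, hi using Nat.le_induction with
    | base =>
      obtain ⟨k, hk⟩ : ∃ k, (t.tag : ℕ) = k + 1 := ⟨_, (Nat.succ_pred_eq_of_pos h0').symm⟩
      have hk' : w' k = - w 0 := by simp only [hw']; rw [if_neg (by omega), if_pos hk.symm]
      rw [hk, Finset.sum_range_succ, hS1 k (by omega), hk']
      module
    | succ i hi ih =>
      have hk' : w' i = w i := by simp only [hw']; rw [if_neg (by omega), if_neg (by omega)]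
      rw [Finset.sum_range_succ, Finset.sum_range_succ, ih, hk']
      module
  have hsucc : ∀ i : Fin (d + 1), i < t.tag → ((i + 1 : Fin (d + 1)) : ℕ) = i + 1 := by
    intro i hi
    have : (i : ℕ) < t.tag := hi
    exact Fin.val_add_one_of_lt (Fin.lt_def.2 (by simp; omega))
  have hp0 : t.child₂.pts 0 = t.pts 0 + h • w 0 := by
    have h1 : (0 : Fin (d + 1)) < t.tag := Fin.lt_def.2 h0'
    have h2 := hsucc 0 h1
    simp only [TaggedSimplex.child₂, h1, if_true]
    rw [hw, h2, shapePt, if_pos (by simp; omega)]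
    simp
  refine ⟨t.nextTag_ne_zero hd, if (t.tag : ℕ) ≤ 1 then h / 2 else h, ?_, w', ?_, fun i => ?_⟩
  · split_ifs <;> positivity
  · intro j hj
    simp only [hw']
    split_ifs
    · exact hW _ (by omega)
    · exact hWn _ (hW _ (by omega))
    · exact hW _ hj
  · rw [hp0]
    have hi : (i : ℕ) ≤ d := by have := i.2; omega
    show (if i < t.tag then t.pts (i + 1) else if i = t.tag then t.mid else t.pts i)
      = _ + _ • shapePt w' t.nextTag i
    rw [TaggedSimplex.nextTag_val]
    by_cases h1 : i < t.tag
    · have h1' : (i : ℕ) < t.tag := h1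
      rw [if_pos h1, hw, hsucc i h1]
      simp only [shapePt]
      rw [hS1 i h1', if_pos (by omega)]
      by_cases h2 : (t.tag : ℕ) ≤ 1
      · have h3 : (i : ℕ) = 0 := by omega
        rw [if_pos h2, if_pos h2, if_pos hi, h3]
        simp
      · rw [if_neg h2, if_neg h2, if_pos (by omega)]
        module
    · have h1' : (t.tag : ℕ) ≤ i := not_lt.1 h1
      have key : (if i = t.tag then t.mid else t.pts i)
          = t.pts 0 + (h / 2) • ∑ j ∈ Finset.range i, w j := by
        split_ifs with h3
        · rw [hmid, h3]
        · have : (i : ℕ) ≠ t.tag := fun h => h3 (Fin.ext h)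
          rw [hw, shapePt, if_neg (by omega)]
          module
      rw [if_neg h1, key]
      simp only [shapePt]
      rw [hS2 i h1']
      by_cases h2 : (t.tag : ℕ) ≤ 1
      · rw [if_pos h2, if_pos h2, if_pos hi]
        module
      · rw [if_neg h2, if_neg h2, if_neg (by omega)]
        module

theorem HasShape.descendant (hd : d ≠ 0) {W : Set (Sp d)} (hWn : ∀ x ∈ W, -x ∈ W)
    {t t' : TaggedSimplex d} (ht : HasShape W t) (h : t.Descendant t') : HasShape W t' := by
  induction h with
  | refl => exact ht
  | tail _ h ih =>
    rcases h with rfl | rfl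
    · exact ih.child₁ hd
    · exact ih.child₂ hd hWn

/-- The steps that occur in the description of the simplices with vertices in `P`. -/
def stepSet (P : Set (Sp d)) : Set (Sp d) :=
  (fun q : (ℝ × ℝ) × Sp d × Sp d × Sp d =>
    q.1.1 • (q.2.1 - q.2.2.2) - q.1.2 • (q.2.2.1 - q.2.2.2)) '' ((({1, 2} : Set ℝ) ×ˢ {1, 2}) ×ˢ P ×ˢ P ×ˢ P)

theorem finite_stepSet {P : Set (Sp d)} (hP : P.Finite) : (stepSet P).Finite :=
  Set.Finite.image _ (((Set.toFinite _).prod (Set.toFinite _)).prod (hP.prod (hP.prod hP)))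

theorem neg_mem_stepSet {P : Set (Sp d)} {x : Sp d} (hx : x ∈ stepSet P) : -x ∈ stepSet P := by
  obtain ⟨⟨⟨a, b⟩, p, q, r⟩, ⟨⟨ha, hb⟩, hp, hq, hr⟩, rfl⟩ := hx
  exact ⟨⟨⟨b, a⟩, q, p, r⟩, ⟨⟨hb, ha⟩, hq, hp, hr⟩, by simp⟩

/-- The steps are the differences of consecutive points of the path, whose points beyond the tag
are twice as far from the first vertex as the vertices are. -/
theorem hasShape_stepSet {P : Set (Sp d)} {t : TaggedSimplex d} (ht : t.tag ≠ 0)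
    (hP : ∀ i, t.pts i ∈ P) : HasShape (stepSet P) t := by
  set κ : ℕ → ℝ := fun i => if i ≤ t.tag then 1 else 2 with hκ
  set x : ℕ → Sp d := fun i => t.pts (Fin.ofNat (d + 1) i)
  set s : ℕ → Sp d := fun i => κ i • (x i - t.pts 0) with hs
  have hκ' : ∀ i, κ i ∈ ({1, 2} : Set ℝ) := by
    intro i; simp only [hκ]; split_ifs <;> simp
  have hs0 : s 0 = 0 := by simp [hs, x]
  refine ⟨ht, 1, one_pos, fun j => s (j + 1) - s j, fun j _ => ?_, fun i => ?_⟩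
  · exact ⟨⟨⟨κ (j + 1), κ j⟩, x (j + 1), x j, t.pts 0⟩,
      ⟨⟨hκ' _, hκ' _⟩, hP _, hP _, hP _⟩, rfl⟩
  · have hxi : x i = t.pts i := by simp [x]
    simp only [shapePt]
    rw [Finset.sum_range_sub, hs0, sub_zero]
    simp only [hs, hκ, hxi]
    split_ifs <;> module

open Classical in
/-- Bisection produces finitely many similarity classes, for all initial labellings together. -/
theorem exists_shapes (hd : d ≠ 0) (𝒯₀ : Finset (Finset (Sp d))) :
    ∃ 𝒮 : Finset (Finset (Sp d)), ∀ (Ω : Set (Sp d)) (𝒯 : Finset (Finset (Sp d))),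
      IsRefinement Ω 𝒯₀ 𝒯 → ∀ T ∈ 𝒯, ∃ S ∈ 𝒮, ∃ (c : Sp d) (h : ℝ), 0 < h ∧
        T = simImage c h S := by
  set P : Set (Sp d) := ⋃ s ∈ 𝒯₀, (s : Set (Sp d))
  have hP : P.Finite := 𝒯₀.finite_toSet.biUnion fun s _ => s.finite_toSet
  set ext : (Fin d → Sp d) → ℕ → Sp d := fun w j => if h : j < d then w ⟨j, h⟩ else 0 with hext
  set sh : (Fin d → Sp d) × Fin (d + 1) → Finset (Sp d) := fun q =>
    Finset.univ.image fun i : Fin (d + 1) => shapePt (ext q.1) q.2 i with hsh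
  have hfin : (sh '' ((Set.univ.pi fun _ => stepSet P) ×ˢ Set.univ)).Finite :=
    Set.Finite.image _ ((Set.Finite.pi fun _ => finite_stepSet hP).prod Set.finite_univ)
  refine ⟨hfin.toFinset, fun Ω 𝒯 h𝒯 T hT => ?_⟩
  obtain ⟨-, τ, hτ, hdesc⟩ := h𝒯
  obtain ⟨s₀, hs₀, t, ht, htT⟩ := hdesc T hT
  have hshape : HasShape (stepSet P) t := by
    refine (hasShape_stepSet (hτ s₀ hs₀).2 fun i => ?_).descendant hd
      (fun x hx => neg_mem_stepSet hx) ht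
    have : (τ s₀).pts i ∈ (s₀ : Set (Sp d)) := (hτ s₀ hs₀).1 ▸ Set.mem_range_self i
    exact Set.mem_biUnion hs₀ this
  obtain ⟨-, h, hh, w, hW, hw⟩ := hshape
  refine ⟨sh (fun j => w j, t.tag), ?_, t.pts 0, h, hh, ?_⟩
  · rw [Set.Finite.mem_toFinset]
    exact ⟨_, ⟨fun j _ => hW j j.2, Set.mem_univ _⟩, rfl⟩
  · apply Finset.coe_injective
    rw [coe_simImage, ← htT]
    simp only [hsh, Finset.coe_image, Finset.coe_univ, Set.image_univ]
    rw [← Set.range_comp]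
    congr 1
    funext i
    rw [hw i]
    simp only [Function.comp, sim]
    congr 2
    have : ∑ j ∈ Finset.range i, w j = ∑ j ∈ Finset.range i, ext (fun j => w j) j := by
      refine Finset.sum_congr rfl fun j hj => ?_
      have := Finset.mem_range.1 hj
      simp only [hext]; rw [dif_pos (by omega)]
    simp only [shapePt, this]

/-! ### Nestedness -/

theorem TaggedSimplex.mid_mem (t : TaggedSimplex d) :
    t.mid ∈ convexHull ℝ (Set.range t.pts) :=
  (convex_convexHull ℝ _).midpoint_mem (subset_convexHull ℝ _ (Set.mem_range_self _))
    (subset_convexHull ℝ _ (Set.mem_range_self _))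

theorem TaggedSimplex.Descendant.convexHull_subset {t t' : TaggedSimplex d}
    (h : t.Descendant t') :
    convexHull ℝ (Set.range t'.pts) ⊆ convexHull ℝ (Set.range t.pts) := by
  induction h with
  | refl => exact subset_rfl
  | tail _ h ih =>
    rename_i p q _
    have hp : ∀ i, p.pts i ∈ convexHull ℝ (Set.range p.pts) := fun i =>
      subset_convexHull ℝ _ (Set.mem_range_self i)
    refine Set.Subset.trans (convexHull_min ?_ (convex_convexHull ℝ _)) ih
    rintro _ ⟨i, rfl⟩
    rcases h with rfl | rfl
    · simp only [TaggedSimplex.child₁]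
      split_ifs
      exacts [p.mid_mem, hp _]
    · simp only [TaggedSimplex.child₂]
      split_ifs
      exacts [hp _, p.mid_mem, hp _]

theorem IsRefinement.exists_cell_subset {Ω : Set (Sp d)} {𝒯₀ 𝒯 : Finset (Finset (Sp d))}
    (h : IsRefinement Ω 𝒯₀ 𝒯) {s : Finset (Sp d)} (hs : s ∈ 𝒯) :
    ∃ s₀ ∈ 𝒯₀, cell s ⊆ cell s₀ := by
  obtain ⟨-, τ, hτ, hdesc⟩ := h
  obtain ⟨s₀, hs₀, t, ht, hts⟩ := hdesc s hs
  refine ⟨s₀, hs₀, ?_⟩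
  have := ht.convexHull_subset
  rwa [hts, (hτ s₀ hs₀).1] at this

/-! ### Uniform estimates on refinements -/

/-- A property that is monotone in a constant holds with one constant on a finite family. -/
theorem exists_uniform_const {ι : Type*} (I : Finset ι) (P : ι → ℝ → Prop)
    (hmono : ∀ i C C', C ≤ C' → P i C → P i C') (h : ∀ i ∈ I, ∃ C, 0 < C ∧ P i C) :
    ∃ C, 0 < C ∧ ∀ i ∈ I, P i C := by
  classical
  induction I using Finset.induction_on with
  | empty => exact ⟨1, one_pos, by simp⟩
  | insert a I _ ih =>
    obtain ⟨C, hC, h1⟩ := ih fun i hi => h i (Finset.mem_insert_of_mem hi)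
    obtain ⟨C', -, h2⟩ := h a (Finset.mem_insert_self a I)
    refine ⟨max C C', lt_max_of_lt_left hC, fun i hi => ?_⟩
    rcases Finset.mem_insert.1 hi with rfl | hi
    · exact hmono _ _ _ (le_max_right _ _) h2
    · exact hmono _ _ _ (le_max_left _ _) (h1 i hi)

/-- `s` is the vertex set of a nondegenerate `d`-simplex. -/
def IsSimplex (s : Finset (Sp d)) : Prop :=
  s.card = d + 1 ∧ AffineIndependent ℝ (fun x : s => (x : Sp d))

theorem IsTriangulation.isSimplex {Ω : Set (Sp d)} {𝒯 : Finset (Finset (Sp d))}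
    (h : IsTriangulation Ω 𝒯) {s : Finset (Sp d)} (hs : s ∈ 𝒯) : IsSimplex s :=
  ⟨h.card_eq s hs, h.indep s hs⟩

theorem IsSimplex.affineSpan_eq_top {s : Finset (Sp d)} (hs : IsSimplex s) :
    affineSpan ℝ (s : Set (Sp d)) = ⊤ := by
  have := hs.2.affineSpan_eq_top_iff_card_eq_finrank_add_one.2 (by simpa using hs.1)
  simpa using this

theorem IsSimplex.interior_nonempty {s : Finset (Sp d)} (hs : IsSimplex s) :
    (interior (cell s)).Nonempty :=
  interior_convexHull_nonempty_iff_affineSpan_eq_top.2 hs.affineSpan_eq_top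

theorem IsSimplex.volume_pos {s : Finset (Sp d)} (hs : IsSimplex s) :
    0 < (volume (cell s)).toReal :=
  ENNReal.toReal_pos (((isOpen_interior.measure_pos volume hs.interior_nonempty).trans_le
    (measure_mono interior_subset)).ne') (volume_cell_lt_top s).ne

theorem IsSimplex.meshSize_pos {s : Finset (Sp d)} (hs : IsSimplex s) : 0 < meshSize s :=
  Real.rpow_pos_of_pos hs.volume_pos _

theorem meshSize_nonneg (s : Finset (Sp d)) : 0 ≤ meshSize s :=
  Real.rpow_nonneg ENNReal.toReal_nonneg _

theorem isSimplex_of_simImage {c : Sp d} {h : ℝ} (hh : 0 < h) {S : Finset (Sp d)}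
    (hs : IsSimplex (simImage c h S)) : IsSimplex S := by
  classical
  have hinj := (measurableEmbedding_sim c hh.ne').injective
  have hm : ∀ x ∈ S, sim c h x ∈ simImage c h S := fun x hx => by
    rw [← Finset.mem_coe, coe_simImage]; exact ⟨x, hx, rfl⟩
  refine ⟨?_, ?_⟩
  · rw [← hs.1, ← Set.ncard_coe_finset, ← Set.ncard_coe_finset, coe_simImage,
      Set.ncard_image_of_injective _ hinj]
  · let e : S ↪ simImage c h S :=
      ⟨fun x => ⟨sim c h x, hm x x.2⟩, fun x y hxy => Subtype.ext (hinj (Subtype.mk.inj hxy))⟩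
    have h1 := hs.2.comp_embedding e
    refine AffineIndependent.of_comp
      ((h • LinearMap.id : Sp d →ₗ[ℝ] Sp d).toAffineMap + AffineMap.const ℝ (Sp d) c) ?_
    have h2 : ((h • LinearMap.id : Sp d →ₗ[ℝ] Sp d).toAffineMap + AffineMap.const ℝ (Sp d) c) ∘
        (fun x : S => (x : Sp d)) = (fun x : simImage c h S => (x : Sp d)) ∘ e := by
      funext x
      simp [e, sim, add_comm]
    rw [h2]
    exact h1

/-- Shape regularity: the elements of all refinements are similar to finitely many nondegenerate
simplices. -/
theorem exists_simplex_shapes (hd : d ≠ 0) (𝒯₀ : Finset (Finset (Sp d))) :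
    ∃ 𝒮 : Finset (Finset (Sp d)), (∀ S ∈ 𝒮, IsSimplex S) ∧
      ∀ (Ω : Set (Sp d)) (𝒯 : Finset (Finset (Sp d))),
      IsRefinement Ω 𝒯₀ 𝒯 → ∀ T ∈ 𝒯, ∃ S ∈ 𝒮, ∃ (c : Sp d) (h : ℝ), 0 < h ∧
        T = simImage c h S := by
  classical
  obtain ⟨𝒮, h𝒮⟩ := exists_shapes hd 𝒯₀
  refine ⟨𝒮.filter IsSimplex, by simp, fun Ω 𝒯 h𝒯 T hT => ?_⟩
  obtain ⟨S, hS, c, h, hh, rfl⟩ := h𝒮 Ω 𝒯 h𝒯 T hT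
  exact ⟨S, Finset.mem_filter.2 ⟨hS, isSimplex_of_simImage hh (h𝒯.1.isSimplex hT)⟩, c, h, hh, rfl⟩

/-- The inverse estimates for the gradients of polynomials of degree at most `n`, uniformly on all
refinements of `𝒯₀`. -/
theorem exists_inverse_estimate (hd : d ≠ 0) (n : ℕ) (𝒯₀ : Finset (Finset (Sp d))) :
    ∃ C : ℝ, 0 < C ∧ ∀ (Ω : Set (Sp d)) (𝒯 : Finset (Finset (Sp d))), IsRefinement Ω 𝒯₀ 𝒯 →
      ∀ T ∈ 𝒯, ∀ p : MvPolynomial (Fin d) ℝ, p.totalDegree ≤ n → ∀ x ∈ cell T,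
      √(volume (cell T)).toReal * ‖polyGrad p x‖ ≤ C * l2Norm (cell T) (polyGrad p) ∧
      √(volume (cell T)).toReal * (meshSize T * ‖fderiv ℝ (polyGrad p) x‖)
        ≤ C * l2Norm (cell T) (polyGrad p) := by
  obtain ⟨𝒮, h𝒮, hsim⟩ := exists_simplex_shapes hd 𝒯₀
  obtain ⟨C, hC, h⟩ := exists_uniform_const 𝒮 (fun S C => ∀ (c : Sp d) (h : ℝ), 0 < h →
      ∀ p : MvPolynomial (Fin d) ℝ, p.totalDegree ≤ n → ∀ x ∈ cell (simImage c h S),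
      √(volume (cell (simImage c h S))).toReal * ‖polyGrad p x‖
        ≤ C * l2Norm (cell (simImage c h S)) (polyGrad p) ∧
      √(volume (cell (simImage c h S))).toReal *
          (meshSize (simImage c h S) * ‖fderiv ℝ (polyGrad p) x‖)
        ≤ C * l2Norm (cell (simImage c h S)) (polyGrad p))
    (fun S C C' hCC h c r hr p hp x hx => by
      have hN : 0 ≤ l2Norm (cell (simImage c r S)) (polyGrad p) := ENNReal.toReal_nonneg
      exact ⟨(h c r hr p hp x hx).1.trans (by gcongr), (h c r hr p hp x hx).2.trans (by gcongr)⟩)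
    (fun S hS => exists_polyGrad_bound_simImage hd n S (h𝒮 S hS).interior_nonempty)
  refine ⟨C, hC, fun Ω 𝒯 h𝒯 T hT => ?_⟩
  obtain ⟨S, hS, c, r, hr, rfl⟩ := hsim Ω 𝒯 h𝒯 T hT
  exact h S hS c r hr

/-- The surface measure of a hyperface is finite. -/
theorem hausdorffMeasure_convexHull_lt_top (hd : d ≠ 0) {F : Finset (Sp d)} (hF : F.card = d)
    (hi : AffineIndependent ℝ (fun x : F => (x : Sp d))) :
    Measure.euclideanHausdorffMeasure (d - 1) (convexHull ℝ (F : Set (Sp d))) < ⊤ := by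
  obtain ⟨a, ha⟩ : F.Nonempty := Finset.card_pos.1 (by omega)
  set V := vectorSpan ℝ (F : Set (Sp d)) with hV
  have hfr : Module.finrank ℝ V = d - 1 := by
    have h1 := hi.finrank_vectorSpan (n := d - 1) (by simp; omega)
    rwa [Subtype.range_coe_subtype] at h1
  let f : V → Sp d := fun v => (v : Sp d) + a
  have hf : Isometry f := by
    refine Isometry.of_dist_eq fun x y => ?_
    simp only [f, dist_add_right]
    rfl
  have hK : IsCompact (f ⁻¹' convexHull ℝ (F : Set (Sp d))) :=
    hf.isClosedEmbedding.isCompact_preimage (F.finite_toSet.isCompact_convexHull ℝ)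
  have himg : f '' (f ⁻¹' convexHull ℝ (F : Set (Sp d))) = convexHull ℝ (F : Set (Sp d)) := by
    refine Set.image_preimage_eq_of_subset fun x hx => ?_
    have h1 : x ∈ affineSpan ℝ (F : Set (Sp d)) := convexHull_subset_affineSpan _ hx
    have h2 : x -ᵥ a ∈ V := vsub_mem_vectorSpan_of_mem_affineSpan_of_mem_affineSpan h1
      (subset_affineSpan ℝ _ ha)
    exact ⟨⟨_, h2⟩, by simp [f]⟩
  rw [← himg, hf.euclideanHausdorffMeasure_image, ← hfr]
  exact hK.measure_lt_top

theorem hausdorffMeasure_image_sim (c : Sp d) {h : ℝ} (hh : 0 < h) (k : ℕ) (S : Set (Sp d)) :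
    (Measure.euclideanHausdorffMeasure k (sim c h '' S)).toReal
      = h ^ k * (Measure.euclideanHausdorffMeasure k S).toReal := by
  have h1 : sim c h '' S = (fun x => c + x) '' (h • S) := by
    rw [← Set.image_smul, Set.image_image]; rfl
  have h2 : Isometry fun x : Sp d => c + x := (IsometryEquiv.addLeft c).isometry
  rw [h1, h2.euclideanHausdorffMeasure_image,
    Measure.euclideanHausdorffMeasure_smul₀ _ hh.ne', ENNReal.toReal_smul, NNReal.smul_def]
  simp [abs_of_pos hh]

open Classical in
theorem isNeighbour_iff {s t : Finset (Sp d)} : IsNeighbour s t ↔ (s ∩ t).card = d := by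
  rw [IsNeighbour, ← Finset.coe_inter, Set.ncard_coe_finset]

/-- Simplices of a refinement that share a hyperface have comparable sizes: the hyperface contains
an edge, whose length is comparable to both sizes. -/
theorem exists_neighbour_ratio (hd : 2 ≤ d) (𝒯₀ : Finset (Finset (Sp d))) :
    ∃ C : ℝ, 0 < C ∧ ∀ (Ω : Set (Sp d)) (𝒯 : Finset (Finset (Sp d))), IsRefinement Ω 𝒯₀ 𝒯 →
      ∀ s ∈ 𝒯, ∀ t ∈ 𝒯, IsNeighbour s t → (volume (cell s)).toReal ≤ C * (volume (cell t)).toReal := by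
  classical
  obtain ⟨𝒮, h𝒮, hsim⟩ := exists_simplex_shapes (by omega : d ≠ 0) 𝒯₀
  set P := 𝒮.biUnion id
  obtain ⟨R, hR, hr⟩ := exists_uniform_const ((P ×ˢ P) ×ˢ (P ×ˢ P))
    (fun q C => q.1.1 ≠ q.1.2 → ‖q.2.1 - q.2.2‖ ≤ C * ‖q.1.1 - q.1.2‖)
    (fun q C C' h h1 h2 => (h1 h2).trans (by gcongr)) (by
      rintro ⟨⟨a, b⟩, a', b'⟩ -
      refine ⟨‖a' - b'‖ / ‖a - b‖ + 1, by positivity, fun hab => ?_⟩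
      have : 0 < ‖a - b‖ := norm_pos_iff.2 (sub_ne_zero.2 hab)
      simp only
      rw [add_mul, div_mul_cancel₀ _ this.ne']
      linarith)
  obtain ⟨Q, hQ, hq⟩ := exists_uniform_const (𝒮 ×ˢ 𝒮)
    (fun q C => (volume (cell q.1)).toReal ≤ C * (volume (cell q.2)).toReal)
    (fun q C C' h h1 => h1.trans (by gcongr)) (by
      rintro ⟨S, S'⟩ hS
      have := (h𝒮 S' (Finset.mem_product.1 hS).2).volume_pos
      refine ⟨(volume (cell S)).toReal / (volume (cell S')).toReal + 1, by positivity, ?_⟩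
      simp only
      rw [add_mul, div_mul_cancel₀ _ this.ne']
      linarith)
  refine ⟨R ^ d * Q, by positivity, fun Ω 𝒯 h𝒯 s hs t ht hst => ?_⟩
  obtain ⟨S, hS, c, h, hh, rfl⟩ := hsim Ω 𝒯 h𝒯 s hs
  obtain ⟨S', hS', c', h', hh', rfl⟩ := hsim Ω 𝒯 h𝒯 t ht
  rw [isNeighbour_iff] at hst
  obtain ⟨x, hx, y, hy, hxy⟩ := Finset.one_lt_card.1 (by omega : 1 < (simImage c h S ∩ simImage c' h' S').card)
  rw [← Finset.mem_coe, Finset.coe_inter, coe_simImage, coe_simImage] at hx hy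
  obtain ⟨⟨a, ha, rfl⟩, a', ha', haa⟩ := hx
  obtain ⟨⟨b, hb, rfl⟩, b', hb', hbb⟩ := hy
  have hab : a ≠ b := fun h => hxy (by rw [h])
  have e1 : h • (a - b) = h' • (a' - b') := by
    have : sim c' h' a' - sim c' h' b' = sim c h a - sim c h b := by rw [haa, hbb]
    simp only [sim, add_sub_add_left_eq_sub] at this
    rw [smul_sub, smul_sub, this]
  have e2 : h * ‖a - b‖ = h' * ‖a' - b'‖ := by
    have := congrArg norm e1
    simpa [norm_smul, abs_of_pos hh, abs_of_pos hh'] using this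
  have hm : ∀ U ∈ 𝒮, ∀ z ∈ (U : Set (Sp d)), z ∈ P := fun U hU z hz =>
    Finset.mem_biUnion.2 ⟨U, hU, hz⟩
  have e3 := hr ((a, b), (a', b')) (by
    simp only [Finset.mem_product]
    exact ⟨⟨hm S hS a ha, hm S hS b hb⟩, hm S' hS' a' ha', hm S' hS' b' hb'⟩) hab
  simp only at e3
  have hpos : 0 < ‖a - b‖ := norm_pos_iff.2 (sub_ne_zero.2 hab)
  have e4 : h ≤ R * h' := by
    refine le_of_mul_le_mul_right ?_ hpos
    calc h * ‖a - b‖ = h' * ‖a' - b'‖ := e2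
      _ ≤ h' * (R * ‖a - b‖) := by gcongr
      _ = _ := by ring
  rw [volume_cell_simImage c hh, volume_cell_simImage c' hh']
  calc h ^ d * (volume (cell S)).toReal ≤ (R * h') ^ d * (Q * (volume (cell S')).toReal) := by
        gcongr; exact hq (S, S') (Finset.mem_product.2 ⟨hS, hS'⟩)
    _ = _ := by ring

theorem IsTriangulation.cell_inter_cell {Ω : Set (Sp d)} {𝒯 : Finset (Finset (Sp d))}
    (h : IsTriangulation Ω 𝒯) {s t : Finset (Sp d)} (hs : s ∈ 𝒯) (ht : t ∈ 𝒯) [DecidableEq (Sp d)] :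
    cell s ∩ cell t = convexHull ℝ ((s ∩ t : Finset (Sp d)) : Set (Sp d)) := by
  rw [h.conforming s hs t ht, Finset.coe_inter]

/-- The surface measure of a common hyperface is at most `C |s| / h_s`, and at most
`C |t| / h_s`. -/
theorem exists_face_estimate (hd : 2 ≤ d) (𝒯₀ : Finset (Finset (Sp d))) :
    ∃ C : ℝ, 0 < C ∧ ∀ (Ω : Set (Sp d)) (𝒯 : Finset (Finset (Sp d))), IsRefinement Ω 𝒯₀ 𝒯 →
      ∀ s ∈ 𝒯, ∀ t ∈ 𝒯, IsNeighbour s t →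
      Measure.euclideanHausdorffMeasure (d - 1) (cell s ∩ cell t) < ⊤ ∧
      meshSize s * (Measure.euclideanHausdorffMeasure (d - 1) (cell s ∩ cell t)).toReal
        ≤ C * (volume (cell s)).toReal ∧
      meshSize s * (Measure.euclideanHausdorffMeasure (d - 1) (cell s ∩ cell t)).toReal
        ≤ C * (volume (cell t)).toReal := by
  classical
  have hd0 : d ≠ 0 := by omega
  obtain ⟨𝒮, h𝒮, hsim⟩ := exists_simplex_shapes hd0 𝒯₀
  obtain ⟨R, hR, hratio⟩ := exists_neighbour_ratio hd 𝒯₀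
  set μ : Measure (Sp d) := Measure.euclideanHausdorffMeasure (d - 1)
  obtain ⟨Q, hQ, hq⟩ := exists_uniform_const (𝒮.sigma fun S => S.powerset)
    (fun q C => meshSize q.1 * (μ (convexHull ℝ (q.2 : Set (Sp d)))).toReal
      ≤ C * (volume (cell q.1)).toReal)
    (fun q C C' h h1 => h1.trans (by gcongr)) (by
      rintro ⟨S, F⟩ hS
      have := (h𝒮 S (Finset.mem_sigma.1 hS).1).volume_pos
      have := meshSize_nonneg S
      refine ⟨meshSize S * (μ (convexHull ℝ (F : Set (Sp d)))).toReal
        / (volume (cell S)).toReal + 1, by positivity, ?_⟩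
      simp only
      rw [add_mul, div_mul_cancel₀ _ (by positivity)]
      linarith)
  have key : ∀ (Ω : Set (Sp d)) (𝒯 : Finset (Finset (Sp d))), IsRefinement Ω 𝒯₀ 𝒯 →
      ∀ s ∈ 𝒯, ∀ t ∈ 𝒯, meshSize s * (μ (cell s ∩ cell t)).toReal
        ≤ Q * (volume (cell s)).toReal := by
    intro Ω 𝒯 h𝒯 s hs t ht
    rw [h𝒯.1.cell_inter_cell hs ht]
    obtain ⟨S, hS, c, h, hh, rfl⟩ := hsim Ω 𝒯 h𝒯 s hs
    have hF : (simImage c h S ∩ t) = simImage c h (S.filter fun x => sim c h x ∈ t) := by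
      ext x
      simp only [simImage, Finset.mem_inter, Finset.mem_image, Finset.mem_filter]
      constructor
      · rintro ⟨⟨y, hy, rfl⟩, hx⟩; exact ⟨y, ⟨hy, hx⟩, rfl⟩
      · rintro ⟨y, ⟨hy, hx⟩, rfl⟩; exact ⟨⟨y, hy, rfl⟩, hx⟩
    set F := S.filter fun x => sim c h x ∈ t
    have h1 := hq ⟨S, F⟩ (Finset.mem_sigma.2 ⟨hS, Finset.mem_powerset.2 (Finset.filter_subset _ _)⟩)
    simp only at h1
    rw [hF, coe_simImage, ← image_sim_convexHull, hausdorffMeasure_image_sim c hh,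
      meshSize_simImage hd0 c hh, volume_cell_simImage c hh]
    have h2 : h ^ d = h * h ^ (d - 1) := by
      rw [← pow_succ', Nat.sub_add_cancel (by omega)]
    rw [h2]
    calc _ = h * h ^ (d - 1) * (meshSize S * (μ (convexHull ℝ (F : Set (Sp d)))).toReal) := by ring
      _ ≤ h * h ^ (d - 1) * (Q * (volume (cell S)).toReal) := by gcongr
      _ = _ := by ring
  refine ⟨Q * (1 + R), by positivity, fun Ω 𝒯 h𝒯 s hs t ht hst => ⟨?_, ?_, ?_⟩⟩
  · rw [h𝒯.1.cell_inter_cell hs ht]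
    refine hausdorffMeasure_convexHull_lt_top hd0 (isNeighbour_iff.1 hst) ?_
    exact (h𝒯.1.isSimplex hs).2.mono (by simp)
  · refine (key Ω 𝒯 h𝒯 s hs t ht).trans ?_
    gcongr
    nlinarith
  · refine (key Ω 𝒯 h𝒯 s hs t ht).trans ?_
    have h1 := hratio Ω 𝒯 h𝒯 s hs t ht hst
    have h2 : 0 ≤ (volume (cell t)).toReal := ENNReal.toReal_nonneg
    calc Q * (volume (cell s)).toReal ≤ Q * (R * (volume (cell t)).toReal) := by gcongr
      _ ≤ _ := by nlinarith [mul_nonneg hQ.le h2]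

/-! ### Neighbours and patches -/

theorem IsSimplex.exists_coord {t : Finset (Sp d)} (ht : IsSimplex t) :
    ∃ l : Sp d → Sp d →ᵃ[ℝ] ℝ, (∀ b ∈ t, l b b = 1) ∧ (∀ b ∈ t, ∀ c ∈ t, c ≠ b → l b c = 0) ∧
      ∀ x, (∀ b ∈ t, 0 ≤ l b x) → x ∈ cell t := by
  classical
  let B : AffineBasis t ℝ (Sp d) := ⟨fun x => x, ht.2, by
    have := ht.affineSpan_eq_top
    simpa using this⟩
  refine ⟨fun b => if h : b ∈ t then B.coord ⟨b, h⟩ else AffineMap.const ℝ _ 0, ?_, ?_, ?_⟩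
  · intro b hb
    simp only [dif_pos hb]
    exact B.coord_apply_eq ⟨b, hb⟩
  · intro b hb c hc hcb
    simp only [dif_pos hb]
    exact B.coord_apply_ne (i := ⟨b, hb⟩) (j := ⟨c, hc⟩) (fun h => hcb (congrArg Subtype.val h).symm)
  · intro x hx
    have h1 := B.convexHull_eq_nonneg_coord
    have h2 : Set.range B = (t : Set (Sp d)) := Subtype.range_coe
    rw [h2] at h1
    rw [cell, h1]
    intro i
    have := hx i i.2
    simpa [dif_pos i.2] using this

open Classical in
/-- If the intersection of two simplices is spanned by a common hyperface, then these simplices lie on different sides of the hyperface: the affine function that vanishes on the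
hyperface and is `1` at the opposite vertex of one of them is negative at the opposite vertex of the
other one. -/
theorem coord_neg_of_inter {s t F : Finset (Sp d)} (hs : IsSimplex s) (ht : IsSimplex t)
    (hd : d ≠ 0) (hFc : F.card = d) {a b : Sp d} (hsa : s = insert a F)
    (htb : t = insert b F) (hst : cell s ∩ cell t = convexHull ℝ (F : Set (Sp d)))
    {l : Sp d →ᵃ[ℝ] ℝ} (hl0 : ∀ x ∈ F, l x = 0) (hlb : l b = 1) : l a < 0 := by
  by_contra! hla
  have hbF : b ∉ F := fun h => by rw [htb, Finset.insert_eq_of_mem h] at ht; have := ht.1; omega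
  -- The affine function does not vanish at all vertices of `s`.
  have hla0 : l a ≠ 0 := by
    intro h0
    have h1 : l = AffineMap.const ℝ _ 0 := AffineMap.ext_on hs.affineSpan_eq_top fun x hx => by
      rw [hsa, Finset.coe_insert] at hx
      rcases hx with rfl | hx
      · simpa using h0
      · simpa using hl0 x hx
    rw [h1] at hlb
    simp at hlb
  have hpos : 0 < l a := lt_of_le_of_ne hla hla0.symm
  obtain ⟨κ, hκ1, hκ0, hκ⟩ := ht.exists_coord
  set c : Sp d := F.centroid ℝ id with hc
  have hFne : F.Nonempty := Finset.card_pos.1 (by omega)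
  have hcF : c ∈ convexHull ℝ (F : Set (Sp d)) := Finset.centroid_mem_convexHull F hFne
  have hκl : κ b = l := AffineMap.ext_on ht.affineSpan_eq_top fun x hx => by
    rw [htb, Finset.coe_insert] at hx
    rcases hx with rfl | hx
    · rw [hlb, hκ1 x (by simp [htb])]
    · rw [hl0 x hx, hκ0 b (by simp [htb]) x (by rw [htb]; exact Finset.mem_insert_of_mem hx)
        (fun h => hbF (h ▸ hx))]
  have hFt : ∀ x ∈ F, x ∈ t := fun x hx => by rw [htb]; exact Finset.mem_insert_of_mem hx
  have hκc : ∀ x ∈ F, 0 < κ x c := by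
    intro x hx
    have h1 : κ x c = ∑ y ∈ F, (F.card : ℝ)⁻¹ * κ x y := by
      rw [hc, Finset.centroid_def, Finset.map_affineCombination _ _ _
        (F.sum_centroidWeights_eq_one_of_nonempty ℝ hFne), Finset.affineCombination_eq_linear_combination _ _ _
        (F.sum_centroidWeights_eq_one_of_nonempty ℝ hFne)]
      simp [Finset.centroidWeights]
    rw [h1, Finset.sum_eq_single x]
    · rw [hκ1 x (hFt x hx), hFc]; positivity
    · intro y hy hyx; rw [hκ0 x (hFt x hx) y (hFt y hy) hyx, mul_zero]
    · intro h; exact absurd hx h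
  -- Points close to the barycentre of the hyperface on the segment to `a` lie in both simplices.
  have hev : ∀ᶠ ε : ℝ in nhdsWithin 0 (Set.Ioi 0), ∀ x ∈ F, 0 < κ x (AffineMap.lineMap c a ε) := by
    rw [Filter.eventually_all_finset]
    intro x hx
    have hcont : Continuous fun ε : ℝ => κ x (AffineMap.lineMap c a ε) :=
      (AffineMap.continuous_of_finiteDimensional _).comp AffineMap.lineMap_continuous
    refine (hcont.tendsto 0).mono_left nhdsWithin_le_nhds |>.eventually_const_lt ?_
    simpa using hκc x hx
  have hlt : ∀ᶠ ε : ℝ in nhdsWithin 0 (Set.Ioi 0), ε < 1 :=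
    nhdsWithin_le_nhds (eventually_lt_nhds one_pos)
  obtain ⟨ε, ⟨hε, hε1⟩, hε0⟩ := ((hev.and hlt).and self_mem_nhdsWithin).exists
  have hε0 : 0 < ε := hε0
  set z := AffineMap.lineMap c a ε with hz
  have hlF : (F : Set (Sp d)) ⊆ l ⁻¹' {0} := fun x hx => hl0 x hx
  have hconv := convexHull_min hlF ((convex_singleton _).affine_preimage l)
  have hlc : l c = 0 := hconv hcF
  have hlz : l z = ε * l a := by
    rw [hz, AffineMap.apply_lineMap, hlc, AffineMap.lineMap_apply_module]; simp
  have hzs : z ∈ cell s := by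
    have h1 : c ∈ cell s := convexHull_mono (by rw [hsa]; simp) hcF
    have h2 : a ∈ cell s := subset_convexHull ℝ _ (by rw [hsa]; simp)
    exact (convex_cell s).lineMap_mem h1 h2 ⟨hε0.le, hε1.le⟩
  have hzt : z ∈ cell t := by
    refine hκ z fun x hx => ?_
    rw [htb] at hx
    rcases Finset.mem_insert.1 hx with rfl | hx
    · rw [hκl, hlz]; positivity
    · exact (hε x hx).le
  have hzF : z ∈ convexHull ℝ (F : Set (Sp d)) := hst ▸ ⟨hzs, hzt⟩
  have h3 : l z = 0 := hconv hzF
  rw [hlz] at h3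
  exact (mul_pos hε0 hpos).ne' h3

open Classical in
theorem exists_insert_of_inter {s F : Finset (Sp d)} (hs : s.card = d + 1) (hF : F ⊆ s)
    (hFc : F.card = d) : ∃ a, a ∉ F ∧ s = insert a F := by
  have h1 : (s \ F).card = 1 := by rw [Finset.card_sdiff_of_subset hF]; omega
  obtain ⟨a, ha⟩ := Finset.card_eq_one.1 h1
  have ha' : a ∈ s \ F := ha ▸ Finset.mem_singleton_self a
  refine ⟨a, (Finset.mem_sdiff.1 ha').2, ?_⟩
  rw [Finset.insert_eq, ← ha, Finset.sdiff_union_of_subset hF]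

open Classical in
/-- At most two elements of a triangulation share a given hyperface. -/
theorem IsTriangulation.eq_of_inter_eq {Ω : Set (Sp d)} {𝒯 : Finset (Finset (Sp d))}
    (h : IsTriangulation Ω 𝒯) (hd : d ≠ 0) {t s₁ s₂ : Finset (Sp d)} (ht : t ∈ 𝒯) (h₁ : s₁ ∈ 𝒯)
    (h₂ : s₂ ∈ 𝒯) (hn : (s₁ ∩ t).card = d) (he : s₁ ∩ t = s₂ ∩ t) : s₁ = s₂ := by
  by_contra hne
  set F := s₁ ∩ t with hF
  have T := h.isSimplex ht
  have S₁ := h.isSimplex h₁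
  have S₂ := h.isSimplex h₂
  have hF1 : F ⊆ s₁ := Finset.inter_subset_left
  have hFt : F ⊆ t := Finset.inter_subset_right
  have hF2 : F ⊆ s₂ := by rw [he]; exact Finset.inter_subset_left
  obtain ⟨a₁, ha₁, e₁⟩ := exists_insert_of_inter S₁.1 hF1 hn
  obtain ⟨a₂, ha₂, e₂⟩ := exists_insert_of_inter S₂.1 hF2 hn
  obtain ⟨b, hb, eb⟩ := exists_insert_of_inter T.1 hFt hn
  obtain ⟨κ, hκ1, hκ0, -⟩ := T.exists_coord
  obtain ⟨μ, hμ1, hμ0, -⟩ := S₁.exists_coord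
  have hbt : b ∈ t := by rw [eb]; simp
  have ha1 : a₁ ∈ s₁ := by rw [e₁]; simp
  have hl0 : ∀ x ∈ F, κ b x = 0 := fun x hx => hκ0 b hbt x (hFt hx) fun h => hb (h ▸ hx)
  have hm0 : ∀ x ∈ F, μ a₁ x = 0 := fun x hx => hμ0 a₁ ha1 x (hF1 hx) fun h => ha₁ (h ▸ hx)
  have n₁ : κ b a₁ < 0 := coord_neg_of_inter S₁ T hd hn e₁ eb (h.cell_inter_cell h₁ ht) hl0
    (hκ1 b hbt)
  have n₂ : κ b a₂ < 0 := coord_neg_of_inter S₂ T hd hn e₂ eb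
    (by rw [h.cell_inter_cell h₂ ht, ← he]) hl0 (hκ1 b hbt)
  have h12 : s₂ ∩ s₁ = F := by
    refine (Finset.eq_of_subset_of_card_le (Finset.subset_inter hF2 hF1) ?_).symm
    by_contra! hlt
    have c1 := S₁.1
    have c2 := S₂.1
    have i1 : s₂ ∩ s₁ = s₁ := Finset.eq_of_subset_of_card_le Finset.inter_subset_right (by omega)
    have i2 : s₂ ∩ s₁ = s₂ := Finset.eq_of_subset_of_card_le Finset.inter_subset_left (by omega)
    exact hne (i1.symm.trans i2)
  have n₃ : μ a₁ a₂ < 0 := coord_neg_of_inter S₂ S₁ hd hn e₂ e₁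
    (by rw [h.cell_inter_cell h₂ h₁, h12]) hm0 (hμ1 a₁ ha1)
  -- Both affine functions vanish on the hyperface, so they are proportional.
  have hprop : κ b = (κ b a₁) • μ a₁ := AffineMap.ext_on S₁.affineSpan_eq_top fun x hx => by
    rw [e₁, Finset.coe_insert] at hx
    rcases hx with rfl | hx
    · simp [hμ1 x ha1]
    · simp [hl0 x hx, hm0 x hx]
  have h4 : κ b a₂ = κ b a₁ * μ a₁ a₂ := by
    conv_lhs => rw [hprop]
    simp
  nlinarith [mul_pos_of_neg_of_neg n₁ n₃]

open Classical in
/-- The elements of `𝒯` that share a hyperface with `s`. -/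
noncomputable def neighbours (𝒯 : Finset (Finset (Sp d))) (s : Finset (Sp d)) : Finset (Finset (Sp d)) :=
  𝒯.filter fun t => IsNeighbour s t

theorem isNeighbour_comm {s t : Finset (Sp d)} : IsNeighbour s t ↔ IsNeighbour t s := by
  rw [IsNeighbour, IsNeighbour, Set.inter_comm]

open Classical in
theorem IsTriangulation.card_neighbours_le {Ω : Set (Sp d)} {𝒯 : Finset (Finset (Sp d))}
    (h : IsTriangulation Ω 𝒯) (hd : d ≠ 0) {t : Finset (Sp d)} (ht : t ∈ 𝒯) :
    (neighbours 𝒯 t).card ≤ d + 1 := by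
  have h1 : (t.powersetCard d).card = d + 1 := by
    rw [Finset.card_powersetCard, h.card_eq t ht, Nat.choose_succ_self_right]
  rw [← h1]
  refine Finset.card_le_card_of_injOn (fun s => s ∩ t) ?_ ?_
  · intro s hs
    have hs := (Finset.mem_filter.1 (Finset.mem_coe.1 hs)).2
    rw [isNeighbour_comm, isNeighbour_iff] at hs
    exact Finset.mem_coe.2 (Finset.mem_powersetCard.2 ⟨Finset.inter_subset_right, hs⟩)
  · intro s₁ h₁ s₂ h₂ he
    have h₁ := Finset.mem_filter.1 (Finset.mem_coe.1 h₁)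
    have h₂ := Finset.mem_filter.1 (Finset.mem_coe.1 h₂)
    rw [isNeighbour_comm, isNeighbour_iff] at h₁
    exact h.eq_of_inter_eq hd ht h₁.1 h₂.1 h₁.2 he

theorem patch_eq (𝒯 : Finset (Finset (Sp d))) (s : Finset (Sp d)) :
    patch 𝒯 s = cell s ∪ ⋃ t ∈ neighbours 𝒯 s, cell t := by
  classical
  simp [patch, neighbours, Set.iUnion_and]

theorem cell_subset_patch (𝒯 : Finset (Finset (Sp d))) (s : Finset (Sp d)) :
    cell s ⊆ patch 𝒯 s := Set.subset_union_left

theorem cell_subset_patch_of_mem {𝒯 : Finset (Finset (Sp d))} {s t : Finset (Sp d)}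
    (ht : t ∈ neighbours 𝒯 s) : cell t ⊆ patch 𝒯 s := by
  rw [patch_eq]
  exact (Set.subset_biUnion_of_mem (u := fun t => cell t) (Finset.mem_coe.2 ht)).trans Set.subset_union_right

open Classical in
/-- The patch of an element of a refinement lies in the patch of the initial element that
contains it. -/
theorem IsRefinement.exists_patch_subset {Ω : Set (Sp d)} {𝒯₀ 𝒯 : Finset (Finset (Sp d))}
    (h₀ : IsTriangulation Ω 𝒯₀) (h : IsRefinement Ω 𝒯₀ 𝒯) {s : Finset (Sp d)} (hs : s ∈ 𝒯) :
    ∃ s₀ ∈ 𝒯₀, cell s ⊆ cell s₀ ∧ patch 𝒯 s ⊆ patch 𝒯₀ s₀ := by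
  obtain ⟨s₀, hs₀, hss⟩ := h.exists_cell_subset hs
  refine ⟨s₀, hs₀, hss, ?_⟩
  rw [patch_eq 𝒯]
  refine Set.union_subset (hss.trans (cell_subset_patch _ _)) (Set.iUnion₂_subset fun t ht => ?_)
  have ht' := Finset.mem_filter.1 ht
  obtain ⟨t₀, ht₀, htt⟩ := h.exists_cell_subset ht'.1
  refine htt.trans ?_
  by_cases hne : t₀ = s₀
  · rw [hne]; exact cell_subset_patch _ _
  · refine cell_subset_patch_of_mem (Finset.mem_filter.2 ⟨ht₀, ?_⟩)
    have hc := isNeighbour_iff.1 ht'.2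
    rw [isNeighbour_iff]
    have h1 : ((s ∩ t : Finset (Sp d)) : Set (Sp d)) ⊆ affineSpan ℝ ((s₀ ∩ t₀ : Finset (Sp d)) : Set (Sp d)) := by
      intro x hx
      refine convexHull_subset_affineSpan _ ?_
      rw [← h₀.cell_inter_cell hs₀ ht₀]
      rw [Finset.coe_inter] at hx
      exact ⟨hss (subset_convexHull ℝ _ hx.1), htt (subset_convexHull ℝ _ hx.2)⟩
    have h2 : AffineIndependent ℝ (fun x : (s ∩ t : Finset (Sp d)) => (x : Sp d)) :=
      (h.1.isSimplex hs).2.mono (by simp)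
    have h3 := h2.card_le_card_of_subset_affineSpan h1
    refine le_antisymm ?_ (hc.symm.le.trans h3)
    by_contra! hlt
    have c1 := h₀.card_eq _ hs₀
    have c2 := h₀.card_eq _ ht₀
    have i1 : s₀ ∩ t₀ = s₀ := Finset.eq_of_subset_of_card_le Finset.inter_subset_left (by omega)
    have i2 : s₀ ∩ t₀ = t₀ := Finset.eq_of_subset_of_card_le Finset.inter_subset_right (by omega)
    exact hne (i2.symm.trans i1)

/-! ### Null sets and overlap -/

theorem restrict_cell_eq (s : Finset (Sp d)) :
    (volume : Measure (Sp d)).restrict (cell s) = volume.restrict (interior (cell s)) :=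
  (Measure.restrict_congr_set
    (interior_ae_eq_of_null_frontier ((convex_cell s).addHaar_frontier volume))).symm

theorem IsTriangulation.restrict_cell_le {Ω : Set (Sp d)} {𝒯 : Finset (Finset (Sp d))}
    (h : IsTriangulation Ω 𝒯) {s : Finset (Sp d)} (hs : s ∈ 𝒯) :
    (volume : Measure (Sp d)).restrict (cell s) ≤ volume.restrict Ω := by
  rw [restrict_cell_eq]
  exact Measure.restrict_mono (h.interior_subset s hs) le_rfl

theorem IsTriangulation.restrict_iUnion_cell {Ω : Set (Sp d)} {𝒯 : Finset (Finset (Sp d))}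
    (h : IsTriangulation Ω 𝒯) :
    (volume : Measure (Sp d)).restrict (⋃ s ∈ 𝒯, cell s) = volume.restrict Ω := by
  refine le_antisymm ?_ (Measure.restrict_mono (h.cover ▸ subset_closure) le_rfl)
  have h1 : (⋃ s ∈ 𝒯, cell s : Set (Sp d)) ≤ᵐ[volume] Ω := by
    have h2 : ∀ s ∈ 𝒯, (cell s : Set (Sp d)) ≤ᵐ[volume] Ω := fun s hs =>
      (interior_ae_eq_of_null_frontier ((convex_cell s).addHaar_frontier volume)).symm.le.trans
        (h.interior_subset s hs).eventuallyLE
    have h3 : ∀ᵐ x ∂(volume : Measure (Sp d)), ∀ s ∈ 𝒯, x ∈ cell s → x ∈ Ω := by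
      rw [Filter.eventually_all_finset]
      exact h2
    filter_upwards [h3] with x hx hx'
    obtain ⟨s, hs, hxs⟩ := Set.mem_iUnion₂.1 hx'
    exact hx s hs hxs
  exact Measure.restrict_mono_ae h1

theorem IsTriangulation.restrict_patch_le {Ω : Set (Sp d)} {𝒯 : Finset (Finset (Sp d))}
    (h : IsTriangulation Ω 𝒯) {s : Finset (Sp d)} (hs : s ∈ 𝒯) :
    (volume : Measure (Sp d)).restrict (patch 𝒯 s) ≤ volume.restrict Ω := by
  classical
  rw [← h.restrict_iUnion_cell]
  refine Measure.restrict_mono ?_ le_rfl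
  rw [patch_eq]
  exact Set.union_subset (Set.subset_biUnion_of_mem (u := fun t => cell t) (Finset.mem_coe.2 hs))
    (Set.iUnion₂_subset fun t ht => Set.subset_biUnion_of_mem (u := fun t => cell t)
      (Finset.mem_coe.2 (Finset.mem_filter.1 ht).1))

open Classical in
theorem IsTriangulation.aedisjoint {Ω : Set (Sp d)} {𝒯 : Finset (Finset (Sp d))}
    (h : IsTriangulation Ω 𝒯) {s t : Finset (Sp d)} (hs : s ∈ 𝒯) (ht : t ∈ 𝒯) (hne : s ≠ t) :
    AEDisjoint volume (cell s) (cell t) := by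
  rw [AEDisjoint, h.cell_inter_cell hs ht]
  have S := h.isSimplex hs
  have T := h.isSimplex ht
  refine measure_mono_null (convexHull_subset_affineSpan _) (Measure.addHaar_affineSubspace _ _ ?_)
  intro htop
  have h1 : (s : Set (Sp d)) ⊆ affineSpan ℝ ((s ∩ t : Finset (Sp d)) : Set (Sp d)) := by
    rw [htop]; exact Set.subset_univ _
  have h2 := S.2.card_le_card_of_subset_affineSpan h1
  have c1 := S.1
  have c2 := T.1
  have i1 : s ∩ t = s := Finset.eq_of_subset_of_card_le Finset.inter_subset_left (by omega)
  have i2 : s ∩ t = t := Finset.eq_of_subset_of_card_le Finset.inter_subset_right (by omega)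
  exact hne (i1.symm.trans i2)

theorem IsTriangulation.sum_lintegral_cell {Ω : Set (Sp d)} {𝒯 : Finset (Finset (Sp d))}
    (h : IsTriangulation Ω 𝒯) (g : Sp d → ENNReal) :
    ∑ s ∈ 𝒯, ∫⁻ x in cell s, g x = ∫⁻ x in Ω, g x := by
  rw [← h.restrict_iUnion_cell, lintegral_biUnion_finset₀ _
    (fun s _ => (measurableSet_cell s).nullMeasurableSet)]
  exact fun s hs t ht hne => h.aedisjoint hs ht hne

theorem lintegral_biUnion_cell_le (I : Finset (Finset (Sp d))) (g : Sp d → ENNReal) :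
    ∫⁻ x in ⋃ t ∈ I, cell t, g x ≤ ∑ t ∈ I, ∫⁻ x in cell t, g x := by
  classical
  induction I using Finset.induction_on with
  | empty => simp
  | insert a I ha ih =>
    rw [Finset.set_biUnion_insert, Finset.sum_insert ha]
    exact (lintegral_union_le _ _ _).trans (by gcongr)

/-- Every element belongs to at most `d + 2` patches. -/
theorem IsTriangulation.sum_lintegral_patch_le {Ω : Set (Sp d)} {𝒯 : Finset (Finset (Sp d))}
    (h : IsTriangulation Ω 𝒯) (hd : d ≠ 0) (g : Sp d → ENNReal) :
    ∑ s ∈ 𝒯, ∫⁻ x in patch 𝒯 s, g x ≤ ((d + 2 : ℕ) : ENNReal) * ∫⁻ x in Ω, g x := by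
  classical
  have h1 : ∀ s ∈ 𝒯, ∫⁻ x in patch 𝒯 s, g x
      ≤ (∫⁻ x in cell s, g x) + ∑ t ∈ 𝒯, if IsNeighbour s t then ∫⁻ x in cell t, g x else 0 := by
    intro s _
    rw [patch_eq]
    refine (lintegral_union_le _ _ _).trans (add_le_add le_rfl ?_)
    rw [← Finset.sum_filter]
    exact lintegral_biUnion_cell_le _ _
  refine (Finset.sum_le_sum h1).trans ?_
  rw [Finset.sum_add_distrib, Finset.sum_comm, ← Finset.sum_add_distrib, ← h.sum_lintegral_cell,
    Finset.mul_sum]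
  refine Finset.sum_le_sum fun t ht => ?_
  rw [← Finset.sum_filter, Finset.sum_const, nsmul_eq_mul]
  have h2 : (𝒯.filter fun s => IsNeighbour s t).card ≤ d + 1 := by
    have : (𝒯.filter fun s => IsNeighbour s t) = neighbours 𝒯 t := by
      unfold neighbours
      exact Finset.filter_congr fun s _ => isNeighbour_comm
    rw [this]
    exact h.card_neighbours_le hd ht
  have h3 : ((𝒯.filter fun s => IsNeighbour s t).card : ENNReal) ≤ ((d + 1 : ℕ) : ENNReal) := by
    exact_mod_cast h2
  calc _ ≤ (∫⁻ x in cell t, g x) + ((d + 1 : ℕ) : ENNReal) * ∫⁻ x in cell t, g x := by gcongr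
    _ = _ := by push_cast; ring

/-! ### Weak gradients of finite element functions -/

theorem IsTestFunction.continuous_gradient {Ω : Set (Sp d)} {φ : Sp d → ℝ}
    (h : IsTestFunction Ω φ) : Continuous (gradient φ) :=
  (InnerProductSpace.toDual ℝ (Sp d)).symm.continuous.comp (h.1.continuous_fderiv (by simp))

theorem gradient_eq_zero_of_notMem_tsupport {φ : Sp d → ℝ} {x : Sp d} (hx : x ∉ tsupport φ) :
    gradient φ x = 0 := by
  have : fderiv ℝ φ x = 0 := image_eq_zero_of_notMem_tsupport
    fun h => hx (tsupport_fderiv_subset ℝ h)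
  rw [gradient, this, map_zero]

theorem IsTestFunction.hasCompactSupport_gradient {Ω : Set (Sp d)} {φ : Sp d → ℝ}
    (h : IsTestFunction Ω φ) : HasCompactSupport (gradient φ) :=
  HasCompactSupport.intro h.2.1 fun _ hx => gradient_eq_zero_of_notMem_tsupport hx

theorem integrable_smul_of_memLp_two {α F : Type*} [MeasurableSpace α] {μ : Measure α}
    [NormedAddCommGroup F] [NormedSpace ℝ F] {φ : α → ℝ} {f : α → F} (hφ : MemLp φ 2 μ)
    (hf : MemLp f 2 μ) : Integrable (fun x => φ x • f x) μ :=
  memLp_one_iff_integrable.1 (hf.smul hφ)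

theorem IsWeakGradient.sub {Ω : Set (Sp d)} {v w : Sp d → ℝ} {G H : Sp d → Sp d}
    (hv : MemLp v 2 (volume.restrict Ω)) (hw : MemLp w 2 (volume.restrict Ω))
    (hG : IsWeakGradient Ω v G) (hH : IsWeakGradient Ω w H) :
    IsWeakGradient Ω (v - w) (G - H) := by
  refine ⟨hG.1.sub hH.1, fun φ hφ => ?_⟩
  have i1 : ∀ u : Sp d → ℝ, MemLp u 2 (volume.restrict Ω) →
      IntegrableOn (fun x => u x • gradient φ x) Ω := fun u hu =>
    integrable_smul_of_memLp_two hu (hφ.continuous_gradient.memLp_of_hasCompactSupport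
      hφ.hasCompactSupport_gradient)
  have i2 : ∀ u : Sp d → Sp d, MemLp u 2 (volume.restrict Ω) →
      IntegrableOn (fun x => φ x • u x) Ω := fun u hu =>
    integrable_smul_of_memLp_two (hφ.1.continuous.memLp_of_hasCompactSupport hφ.2.1) hu
  simp only [Pi.sub_apply, sub_smul, smul_sub]
  rw [integral_sub (i1 v hv) (i1 w hw), integral_sub (i2 G hG.1) (i2 H hH.1), hG.2 φ hφ, hH.2 φ hφ]
  abel

theorem MemH1.sub {Ω : Set (Sp d)} {v w : Sp d → ℝ} (hv : MemH1 Ω v) (hw : MemH1 Ω w) :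
    MemH1 Ω (v - w) := by
  obtain ⟨hv, G, hG⟩ := hv
  obtain ⟨hw, H, hH⟩ := hw
  exact ⟨hv.sub hw, G - H, hG.sub hv hw hH⟩

theorem MemH1.isWeakGradient {Ω : Set (Sp d)} {v : Sp d → ℝ} (hv : MemH1 Ω v) :
    IsWeakGradient Ω v (weakGrad Ω v) := by
  rw [weakGrad, dif_pos hv.2]
  exact hv.2.choose_spec

theorem integral_polyFun_smul_gradient (p : MvPolynomial (Fin d) ℝ) {Ω : Set (Sp d)}
    {φ : Sp d → ℝ} (hφ : IsTestFunction Ω φ) :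
    ∫ x, polyFun p x • gradient φ x = - ∫ x, φ x • polyGrad p x := by
  have hφd : Differentiable ℝ φ := hφ.1.differentiable (by simp)
  have hp := (contDiff_polyFun p).continuous
  have i1 : Integrable fun x => polyFun p x • gradient φ x :=
    (hp.smul hφ.continuous_gradient).integrable_of_hasCompactSupport
      hφ.hasCompactSupport_gradient.smul_left
  have i2 : Integrable fun x => φ x • polyGrad p x :=
    (hφ.1.continuous.smul (continuous_polyGrad p)).integrable_of_hasCompactSupport
      hφ.2.1.smul_right
  have i3 : Integrable fun x => polyFun p x * φ x :=
    (hp.mul hφ.1.continuous).integrable_of_hasCompactSupport hφ.2.1.mul_left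
  refine ext_inner_left ℝ fun y => ?_
  rw [inner_neg_right, ← integral_inner i1, ← integral_inner i2]
  have e1 : ∀ x, inner ℝ y (polyFun p x • gradient φ x) = polyFun p x * fderiv ℝ φ x y := fun x => by
    rw [inner_smul_right, real_inner_comm, inner_gradient_left]
  have e2 : ∀ x, inner ℝ y (φ x • polyGrad p x) = fderiv ℝ (polyFun p) x y * φ x := fun x => by
    rw [inner_smul_right, real_inner_comm, polyGrad, inner_gradient_left, mul_comm]
  have j1 := i1.const_inner (𝕜 := ℝ) y
  have j2 := i2.const_inner (𝕜 := ℝ) y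
  simp only [e1, e2] at j1 j2 ⊢
  exact integral_mul_fderiv_eq_neg_fderiv_mul_of_integrable j2 j1 i3
    (fun x _ => polyFun_differentiable p x) fun x _ => hφd x

/-- On an element on which a function is given by a polynomial, the weak gradient is the gradient of
that polynomial. -/
theorem IsTriangulation.weakGrad_ae_eq {Ω : Set (Sp d)} {𝒯 : Finset (Finset (Sp d))}
    (h : IsTriangulation Ω 𝒯) {s : Finset (Sp d)} (hs : s ∈ 𝒯) {v : Sp d → ℝ} (hv : MemH1 Ω v)
    {p : MvPolynomial (Fin d) ℝ} (hp : v =ᵐ[volume.restrict (cell s)] polyFun p) :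
    weakGrad Ω v =ᵐ[volume.restrict (cell s)] polyGrad p := by
  set G := weakGrad Ω v
  have hG := hv.isWeakGradient
  set U := interior (cell s) with hU
  have hUΩ : U ⊆ Ω := h.interior_subset s hs
  rw [restrict_cell_eq] at hp ⊢
  have hGU : MemLp G 2 (volume.restrict (cell s)) := hG.1.mono_measure (h.restrict_cell_le hs)
  have hint : IntegrableOn (fun x => G x - polyGrad p x) (cell s) :=
    (hGU.integrable (by norm_num)).sub
      (((continuous_polyGrad p).memLp_cell s 2).integrable (by norm_num))
  have key := isOpen_interior.ae_eq_zero_of_integral_contDiff_smul_eq_zero (U := U)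
    (hint.mono_set _root_.interior_subset).locallyIntegrableOn (by
    intro φ hφ hφc hφU
    have hφt : IsTestFunction Ω φ := ⟨hφ, hφc, hφU.trans hUΩ⟩
    have hz : ∀ x ∉ U, φ x = 0 := fun x hx => image_eq_zero_of_notMem_tsupport fun h => hx (hφU h)
    have hz' : ∀ x ∉ U, gradient φ x = 0 := fun x hx =>
      gradient_eq_zero_of_notMem_tsupport fun h => hx (hφU h)
    have e1 : ∫ x, φ x • G x = ∫ x in Ω, φ x • G x :=
      (setIntegral_eq_integral_of_forall_compl_eq_zero fun x hx => by
        rw [hz x fun h => hx (hUΩ h), zero_smul]).symm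
    have e2 : ∫ x in Ω, v x • gradient φ x = ∫ x, v x • gradient φ x :=
      setIntegral_eq_integral_of_forall_compl_eq_zero fun x hx => by
        rw [hz' x fun h => hx (hUΩ h), smul_zero]
    have e3 : ∫ x, v x • gradient φ x = ∫ x in U, v x • gradient φ x :=
      (setIntegral_eq_integral_of_forall_compl_eq_zero fun x hx => by
        rw [hz' x hx, smul_zero]).symm
    have e4 : ∫ x in U, v x • gradient φ x = ∫ x in U, polyFun p x • gradient φ x :=
      integral_congr_ae (by filter_upwards [hp] with x hx; rw [hx])
    have e5 : ∫ x in U, polyFun p x • gradient φ x = ∫ x, polyFun p x • gradient φ x :=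
      setIntegral_eq_integral_of_forall_compl_eq_zero fun x hx => by
        rw [hz' x hx, smul_zero]
    have e6 := integral_polyFun_smul_gradient p hφt
    have e7 : ∫ x, φ x • G x = ∫ x, φ x • polyGrad p x := by
      have := hG.2 φ hφt
      rw [e2, e3, e4, e5, e6] at this
      rw [e1]
      exact (neg_injective this).symm
    have i1 : Integrable fun x => φ x • G x := by
      have : IntegrableOn (fun x => φ x • G x) (cell s) :=
        integrable_smul_of_memLp_two (hφ.continuous.memLp_of_hasCompactSupport hφc) hGU
      refine this.integrable_of_forall_notMem_eq_zero fun x hx => ?_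
      rw [hz x fun h => hx (_root_.interior_subset h), zero_smul]
    have i2 : Integrable fun x => φ x • polyGrad p x :=
      (hφ.continuous.smul (continuous_polyGrad p)).integrable_of_hasCompactSupport hφc.smul_right
    simp only [smul_sub]
    rw [integral_sub i1 i2, e7, sub_self])
  rw [Filter.EventuallyEq, ae_restrict_iff' isOpen_interior.measurableSet]
  filter_upwards [key] with x hx hxU
  exact sub_eq_zero.1 (hx hxU)

/-! ### The nonlinearity -/

/-- Carathéodory functions are superpositionally measurable. -/
theorem aemeasurable_caratheodory {α : Type*} [MeasurableSpace α] {μ : Measure α}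
    {b : α → ℝ → ℝ} (hb : ∀ ξ, AEMeasurable (fun x => b x ξ) μ) (hc : ∀ᵐ x ∂μ, Continuous (b x))
    {y : α → ℝ} (hy : AEMeasurable y μ) : AEMeasurable (fun x => b x (y x)) μ := by
  suffices H : ∀ y : α → ℝ, Measurable y → AEMeasurable (fun x => b x (y x)) μ by
    refine (H _ hy.measurable_mk).congr ?_
    filter_upwards [hy.ae_eq_mk] with x hx
    rw [hx]
  intro y hy
  -- The values of `y` are approximated by multiples of `1 / (m + 1)`.
  let F : ℕ → ℤ × α → ℝ := fun m q => (hb ((q.1 : ℝ) / (m + 1))).mk _ q.2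
  have hF : ∀ m, Measurable (F m) := fun m =>
    measurable_from_prod_countable_right fun j => (hb ((j : ℝ) / (m + 1))).measurable_mk
  have hall : ∀ᵐ x ∂μ, ∀ (m : ℕ) (j : ℤ), b x ((j : ℝ) / (m + 1)) = F m (j, x) := by
    rw [ae_all_iff]; intro m
    rw [ae_all_iff]; intro j
    exact (hb ((j : ℝ) / (m + 1))).ae_eq_mk
  refine aemeasurable_of_tendsto_metrizable_ae Filter.atTop
    (f := fun (m : ℕ) x => F m (⌊((m : ℝ) + 1) * y x⌋, x)) (fun m => ?_) ?_
  · exact ((hF m).comp ((Int.measurable_floor.comp (hy.const_mul _)).prodMk measurable_id)).aemeasurable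
  · filter_upwards [hall, hc] with x hx hcx
    simp only [← hx]
    refine (hcx.tendsto (y x)).comp ?_
    have h1 : Filter.Tendsto (fun m : ℕ => y x - 1 / ((m : ℝ) + 1)) Filter.atTop (nhds (y x)) := by
      simpa using (tendsto_const_nhds (x := y x)).sub (tendsto_one_div_add_atTop_nhds_zero_nat (𝕜 := ℝ))
    refine tendsto_of_tendsto_of_tendsto_of_le_of_le h1 tendsto_const_nhds (fun m => ?_) fun m => ?_
    · have hm : (0 : ℝ) < m + 1 := by positivity
      have := Int.lt_floor_add_one (((m : ℝ) + 1) * y x)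
      rw [sub_le_iff_le_add, ← add_div, le_div_iff₀ hm]
      nlinarith
    · have hm : (0 : ℝ) < m + 1 := by positivity
      rw [div_le_iff₀ hm, mul_comm]
      exact Int.floor_le _

theorem aemeasurable_deriv_comp {α : Type*} [MeasurableSpace α] {μ : Measure α}
    {b : α → ℝ → ℝ} (hb : ∀ ξ, AEMeasurable (fun x => b x ξ) μ)
    (hc : ∀ᵐ x ∂μ, Differentiable ℝ (b x))
    {y : α → ℝ} (hy : AEMeasurable y μ) : AEMeasurable (fun x => deriv (b x) (y x)) μ := by
  have hcont : ∀ᵐ x ∂μ, Continuous (b x) := hc.mono fun x hx => hx.continuous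
  refine aemeasurable_of_tendsto_metrizable_ae Filter.atTop
    (f := fun (m : ℕ) x => (1 / ((m : ℝ) + 1))⁻¹ * (b x (y x + 1 / ((m : ℝ) + 1)) - b x (y x)))
    (fun m => ?_) ?_
  · exact ((aemeasurable_caratheodory hb hcont (hy.add_const _)).sub
      (aemeasurable_caratheodory hb hcont hy)).const_mul _
  · filter_upwards [hc] with x hx
    have h1 := (hx (y x)).hasDerivAt.tendsto_slope_zero
    have h2 : Filter.Tendsto (fun m : ℕ => 1 / ((m : ℝ) + 1)) Filter.atTop
        (nhdsWithin 0 {0}ᶜ) := by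
      refine tendsto_nhdsWithin_iff.2 ⟨tendsto_one_div_add_atTop_nhds_zero_nat, ?_⟩
      exact Filter.Eventually.of_forall fun m => by
        have : (0 : ℝ) < 1 / ((m : ℝ) + 1) := by positivity
        exact this.ne'
    exact h1.comp h2

/-- A Lipschitz constant on an interval bounds the derivative there, end points included. -/
theorem abs_deriv_le_of_lipschitz {f : ℝ → ℝ} {m p y B : ℝ} (hf : DifferentiableAt ℝ f y)
    (hmp : m < p) (hy : y ∈ Set.Icc m p)
    (hB : ∀ s ∈ Set.Icc m p, ∀ t ∈ Set.Icc m p, |f s - f t| ≤ B * |s - t|) : |deriv f y| ≤ B := by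
  have hu := uniqueDiffWithinAt_iff_accPt.1 (uniqueDiffOn_Icc hmp y hy)
  have h1 := hasDerivWithinAt_iff_tendsto_slope.1 (hf.hasDerivAt.hasDerivWithinAt (s := Set.Icc m p))
  have : (nhdsWithin y (Set.Icc m p \ {y})).NeBot := by
    rw [accPt_principal_iff_nhdsWithin] at hu
    exact hu
  refine le_of_tendsto h1.abs ?_
  filter_upwards [self_mem_nhdsWithin] with z hz
  have hzy : 0 < |z - y| := abs_pos.2 (sub_ne_zero.2 hz.2)
  rw [slope_def_field, abs_div, div_le_iff₀ hzy]
  exact hB z hz.1 y hy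

theorem IsLipConst.abs_deriv_le {Ω : Set (Sp d)} (hΩ : MeasurableSet Ω) {b : Sp d → ℝ → ℝ}
    {um up y : Sp d → ℝ} {B : ℝ} (hB : IsLipConst Ω b um up B)
    (hb : ∀ x ∈ Ω, ContDiff ℝ ∞ (b x)) (hy : InInterval Ω um up y) :
    ∀ᵐ x ∂(volume.restrict Ω), |deriv (b x) (y x)| ≤ B := by
  filter_upwards [hB.2, hy, ae_restrict_mem hΩ] with x hx hyx hxΩ
  rcases (hyx.1.trans hyx.2).lt_or_eq with h | h
  · exact abs_deriv_le_of_lipschitz ((hb x hxΩ).differentiable (by simp) _) h hyx hx.1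
  · have : y x = um x := le_antisymm (hyx.2.trans h.symm.le) hyx.1
    rw [this]
    exact hx.2 h

/-! ### The coefficient -/

theorem ae_norm_le_lpNorm_top {F : Type*} [NormedAddCommGroup F] {D : Set (Sp d)} {f : Sp d → F}
    (hf : MemLp f ⊤ (volume.restrict D)) :
    ∀ᵐ x ∂(volume.restrict D), ‖f x‖ ≤ lpNorm ⊤ D f := by
  have h1 : ∀ᵐ x ∂(volume.restrict D), ‖f x‖ₑ ≤ eLpNorm f ⊤ (volume.restrict D) := by
    rw [eLpNorm_exponent_top]; exact ae_le_eLpNormEssSup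
  filter_upwards [h1] with x hx
  have := ENNReal.toReal_mono hf.2.ne hx
  rwa [toReal_enorm] at this

theorem IsTriangulation.isCompact_closure {Ω : Set (Sp d)} {𝒯 : Finset (Finset (Sp d))}
    (h : IsTriangulation Ω 𝒯) : IsCompact (closure Ω) := by
  rw [← h.cover]
  exact 𝒯.finite_toSet.isCompact_biUnion fun s _ => isCompact_cell s

theorem IsTriangulation.memLp_top_of_lipschitz {Ω : Set (Sp d)} {𝒯 : Finset (Finset (Sp d))}
    (h : IsTriangulation Ω 𝒯) (hΩ : IsOpen Ω) {F : Type*} [NormedAddCommGroup F]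
    {A : Sp d → F} {K : NNReal} (hA : LipschitzOnWith K A Ω) :
    MemLp A ⊤ (volume.restrict Ω) := by
  obtain ⟨R, hR⟩ : ∃ R, ∀ x ∈ Ω, ‖A x‖ ≤ R := by
    rcases Ω.eq_empty_or_nonempty with rfl | ⟨x₀, hx₀⟩
    · exact ⟨0, by simp⟩
    obtain ⟨C, hC⟩ := Metric.isBounded_iff.1 (h.isCompact_closure.isBounded.subset subset_closure)
    refine ⟨‖A x₀‖ + K * C, fun x hx => ?_⟩
    have h1 := hA.dist_le_mul x hx x₀ hx₀
    rw [dist_eq_norm] at h1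
    have h2 : (K : ℝ) * dist x x₀ ≤ K * C := by gcongr; exact hC hx hx₀
    linarith [norm_le_norm_add_norm_sub' (A x) (A x₀)]
  exact memLp_top_of_bound (hA.continuousOn.aestronglyMeasurable hΩ.measurableSet) R
    ((ae_restrict_iff' hΩ.measurableSet).2 (Filter.Eventually.of_forall fun x hx =>
      hR x hx))

/-- The essential supremum of a continuous coefficient over a set bounds its values at all points
of an element contained in the set, even on the null set where the element meets its neighbours. -/
theorem IsTriangulation.norm_le_lpNorm_top {Ω : Set (Sp d)} {𝒯 : Finset (Finset (Sp d))}
    (h : IsTriangulation Ω 𝒯) {F : Type*} [NormedAddCommGroup F]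
    {A : Sp d → F} (hA : ContinuousOn A Ω) {D : Set (Sp d)} (hD : MemLp A ⊤ (volume.restrict D))
    {t : Finset (Sp d)} (ht : t ∈ 𝒯) (htD : cell t ⊆ D) {x : Sp d} (hx : x ∈ cell t) (hxΩ : x ∈ Ω) :
    ‖A x‖ ≤ lpNorm ⊤ D A := by
  set M := lpNorm ⊤ D A
  have hU : interior (cell t) ⊆ Ω := h.interior_subset t ht
  have h1 : (fun x => max ‖A x‖ M) =ᵐ[volume.restrict (interior (cell t))] fun _ => M := by
    refine ae_restrict_of_ae_restrict_of_subset (_root_.interior_subset.trans htD) ?_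
    filter_upwards [ae_norm_le_lpNorm_top hD] with x hx
    exact max_eq_right hx
  have h2 := Measure.eqOn_open_of_ae_eq h1 isOpen_interior
    (((hA.mono hU).norm).sup continuousOn_const) continuousOn_const
  have hcl : x ∈ closure (interior (cell t)) :=
    cell_subset_closure_interior (h.isSimplex ht).interior_nonempty hx
  have : (nhdsWithin x (interior (cell t))).NeBot := mem_closure_iff_nhdsWithin_neBot.1 hcl
  refine le_of_tendsto ((hA x hxΩ).mono hU).norm ?_
  filter_upwards [self_mem_nhdsWithin] with z hz
  exact max_eq_right_iff.1 (h2 hz)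

theorem ae_differentiableAt_of_lipschitzOnWith {Ω : Set (Sp d)} (hΩ : IsOpen Ω)
    {F : Type*} [NormedAddCommGroup F] [NormedSpace ℝ F] [FiniteDimensional ℝ F]
    {A : Sp d → F} {K : NNReal} (hA : LipschitzOnWith K A Ω) :
    ∀ᵐ x ∂(volume.restrict Ω), DifferentiableAt ℝ A x := by
  rw [ae_restrict_iff' hΩ.measurableSet]
  filter_upwards [hA.ae_differentiableWithinAt_of_mem (μ := volume)] with x hx hxΩ
  exact (hx hxΩ).differentiableAt (hΩ.mem_nhds hxΩ)

theorem measurable_divMat (A : Sp d → (Sp d →L[ℝ] Sp d)) : Measurable (divMat A) := by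
  unfold divMat
  refine Finset.measurable_sum _ fun i _ => ?_
  exact (ContinuousLinearMap.apply ℝ (Sp d) (EuclideanSpace.single i (1 : ℝ))).measurable.comp
    (measurable_fderiv_apply_const ℝ A _)

theorem measurable_divVec (F : Sp d → Sp d) : Measurable (divVec F) := by
  unfold divVec
  refine Finset.measurable_sum _ fun i _ => ?_
  exact (EuclideanSpace.proj (𝕜 := ℝ) i).measurable.comp
    (measurable_fderiv_apply_const ℝ F _)

theorem memLp_top_divMat {Ω : Set (Sp d)} (hΩ : IsOpen Ω)
    {A : Sp d → (Sp d →L[ℝ] Sp d)} {K : NNReal} (hA : LipschitzOnWith K A Ω) :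
    MemLp (divMat A) ⊤ (volume.restrict Ω) := by
  refine memLp_top_of_bound (measurable_divMat A).aestronglyMeasurable (∑ _i : Fin d, (K : ℝ)) ?_
  rw [ae_restrict_iff' hΩ.measurableSet]
  refine Filter.Eventually.of_forall fun x hx => ?_
  refine norm_sum_le_of_le _ fun i _ => ?_
  have h1 := norm_fderiv_le_of_lipschitzOn ℝ (hΩ.mem_nhds hx) hA
  have h2 : ‖(EuclideanSpace.single i (1 : ℝ) : Sp d)‖ = 1 := by simp
  calc _ ≤ ‖fderiv ℝ A x‖ * ‖(EuclideanSpace.single i (1 : ℝ) : Sp d)‖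
          * ‖(EuclideanSpace.single i (1 : ℝ) : Sp d)‖ := ContinuousLinearMap.le_opNorm₂ _ _ _
    _ ≤ K := by rw [h2]; simpa using h1

/-- The product rule `∇·(A G) = (div A) · G + A : ∇G`, which uses the symmetry of `A`. -/
theorem divVec_apply {Ω : Set (Sp d)} (hΩ : IsOpen Ω) {A : Sp d → (Sp d →L[ℝ] Sp d)}
    (hsym : ∀ x ∈ Ω, ∀ ξ ζ : Sp d, inner ℝ (A x ξ) ζ = inner ℝ ξ (A x ζ)) {x : Sp d} (hx : x ∈ Ω)
    (hA : DifferentiableAt ℝ A x) {G : Sp d → Sp d} (hG : DifferentiableAt ℝ G x) :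
    divVec (fun z => A z (G z)) x = inner ℝ (G x) (divMat A x)
      + ∑ i : Fin d, (A x (fderiv ℝ G x (EuclideanSpace.single i 1))) i := by
  have hsym' : ∀ e ξ ζ : Sp d, inner ℝ (fderiv ℝ A x e ξ) ζ = inner ℝ ξ (fderiv ℝ A x e ζ) := by
    intro e ξ ζ
    have hev : ∀ η : Sp d, HasFDerivAt (fun z => A z η) ((fderiv ℝ A x).flip η) x := fun η => by
      simpa using hA.hasFDerivAt.clm_apply (hasFDerivAt_const η x)
    have h1 := (hev ξ).inner ℝ (hasFDerivAt_const ζ x)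
    have h2 := (hasFDerivAt_const ξ x).inner ℝ (hev ζ)
    have h3 : (fun z => (inner ℝ (A z ξ) ζ : ℝ)) =ᶠ[nhds x] fun z => inner ℝ ξ (A z ζ) :=
      Filter.eventuallyEq_of_mem (hΩ.mem_nhds hx) fun z hz => hsym z hz ξ ζ
    have h4 := congrArg (fun L => L e) ((h1.congr_of_eventuallyEq h3.symm).unique h2)
    simpa using h4
  have hAG := hA.hasFDerivAt.clm_apply hG.hasFDerivAt
  simp only [divVec, hAG.fderiv]
  rw [divMat, inner_sum, ← Finset.sum_add_distrib]
  refine Finset.sum_congr rfl fun i _ => ?_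
  have h5 : (fderiv ℝ A x (EuclideanSpace.single i 1) (G x)) i
      = inner ℝ (G x) (fderiv ℝ A x (EuclideanSpace.single i 1) (EuclideanSpace.single i 1)) := by
    rw [← hsym', EuclideanSpace.inner_single_right]
    simp
  rw [← h5]
  simp [add_comm]

theorem abs_divVec_le {Ω : Set (Sp d)} (hΩ : IsOpen Ω) {A : Sp d → (Sp d →L[ℝ] Sp d)}
    (hsym : ∀ x ∈ Ω, ∀ ξ ζ : Sp d, inner ℝ (A x ξ) ζ = inner ℝ ξ (A x ζ)) {x : Sp d} (hx : x ∈ Ω)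
    (hA : DifferentiableAt ℝ A x) {G : Sp d → Sp d} (hG : DifferentiableAt ℝ G x) :
    |divVec (fun z => A z (G z)) x| ≤ ‖divMat A x‖ * ‖G x‖ + d * (‖A x‖ * ‖fderiv ℝ G x‖) := by
  rw [divVec_apply hΩ hsym hx hA hG]
  refine (abs_add_le _ _).trans (add_le_add ?_ ?_)
  · rw [mul_comm]; exact abs_real_inner_le_norm _ _
  · refine (Finset.abs_sum_le_sum_abs _ _).trans ?_
    have : (d : ℝ) * (‖A x‖ * ‖fderiv ℝ G x‖) = ∑ _i : Fin d, ‖A x‖ * ‖fderiv ℝ G x‖ := by simp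
    rw [this]
    refine Finset.sum_le_sum fun i _ => ?_
    have h2 : ‖(EuclideanSpace.single i (1 : ℝ) : Sp d)‖ = 1 := by simp
    calc |(A x (fderiv ℝ G x (EuclideanSpace.single i 1))) i|
        ≤ ‖A x (fderiv ℝ G x (EuclideanSpace.single i 1))‖ := by
          rw [← Real.norm_eq_abs]; exact PiLp.norm_apply_le _ i
      _ ≤ ‖A x‖ * ‖fderiv ℝ G x (EuclideanSpace.single i 1)‖ := (A x).le_opNorm _
      _ ≤ ‖A x‖ * (‖fderiv ℝ G x‖ * ‖(EuclideanSpace.single i (1 : ℝ) : Sp d)‖) := by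
        gcongr; exact (fderiv ℝ G x).le_opNorm _
      _ = _ := by rw [h2, mul_one]

theorem divVec_sub {A : Sp d → (Sp d →L[ℝ] Sp d)} {x : Sp d} (hA : DifferentiableAt ℝ A x)
    {G H : Sp d → Sp d} (hG : DifferentiableAt ℝ G x) (hH : DifferentiableAt ℝ H x) :
    divVec (fun z => A z ((G - H) z)) x
      = divVec (fun z => A z (G z)) x - divVec (fun z => A z (H z)) x := by
  have h1 : (fun z => A z ((G - H) z)) = fun z => A z (G z) - A z (H z) := by
    funext z; simp
  rw [h1]
  simp only [divVec]
  rw [fderiv_fun_sub (hA.clm_apply hG) (hA.clm_apply hH), ← Finset.sum_sub_distrib]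
  simp

/-! ### `L_2` norms -/

section L2

variable {α F G : Type*} [MeasurableSpace α] {μ : Measure α} [NormedAddCommGroup F]
  [NormedAddCommGroup G]

theorem toReal_eLpNorm_add_le {f g : α → F} (hf : MemLp f 2 μ) (hg : MemLp g 2 μ) :
    (eLpNorm (f + g) 2 μ).toReal ≤ (eLpNorm f 2 μ).toReal + (eLpNorm g 2 μ).toReal := by
  rw [← ENNReal.toReal_add hf.2.ne hg.2.ne]
  exact ENNReal.toReal_mono (ENNReal.add_ne_top.2 ⟨hf.2.ne, hg.2.ne⟩)
    (eLpNorm_add_le hf.1 hg.1 (by norm_num))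

theorem abs_toReal_eLpNorm_sub_le {f g : α → F} (hf : MemLp f 2 μ) (hg : MemLp g 2 μ) :
    |(eLpNorm f 2 μ).toReal - (eLpNorm g 2 μ).toReal| ≤ (eLpNorm (f - g) 2 μ).toReal := by
  rw [← Lp.norm_toLp f hf, ← Lp.norm_toLp g hg, ← Lp.norm_toLp (f - g) (hf.sub hg), MemLp.toLp_sub]
  exact abs_norm_sub_norm_le _ _

theorem toReal_eLpNorm_le_mul {f : α → F} {g : α → G} {c : ℝ} (hc : 0 ≤ c) (hg : MemLp g 2 μ)
    (h : ∀ᵐ x ∂μ, ‖f x‖ ≤ c * ‖g x‖) :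
    (eLpNorm f 2 μ).toReal ≤ c * (eLpNorm g 2 μ).toReal := by
  have h1 := ENNReal.toReal_mono (ENNReal.mul_ne_top ENNReal.ofReal_ne_top hg.2.ne)
    (eLpNorm_le_mul_eLpNorm_of_ae_le_mul h 2)
  rwa [ENNReal.toReal_mul, ENNReal.toReal_ofReal hc] at h1

theorem toReal_eLpNorm_le_of_bound [IsFiniteMeasure μ] {f : α → F} {c : ℝ} (hc : 0 ≤ c)
    (h : ∀ᵐ x ∂μ, ‖f x‖ ≤ c) :
    (eLpNorm f 2 μ).toReal ≤ √(μ Set.univ).toReal * c := by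
  have h1 := ENNReal.toReal_mono (by finiteness) (eLpNorm_le_of_ae_bound (p := 2) h)
  rw [ENNReal.toReal_mul, ENNReal.toReal_ofReal hc, ← ENNReal.toReal_rpow] at h1
  rw [Real.sqrt_eq_rpow]
  simpa using h1

end L2

theorem l2Norm_nonneg {F : Type*} [NormedAddCommGroup F] (D : Set (Sp d)) (f : Sp d → F) :
    0 ≤ l2Norm D f := ENNReal.toReal_nonneg

theorem l2Norm_mono {F : Type*} [NormedAddCommGroup F] {D E : Set (Sp d)} {f : Sp d → F}
    (hDE : (volume : Measure (Sp d)).restrict D ≤ volume.restrict E)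
    (hf : MemLp f 2 (volume.restrict E)) : l2Norm D f ≤ l2Norm E f :=
  ENNReal.toReal_mono hf.2.ne (eLpNorm_mono_measure f hDE)

theorem l2Norm_congr {F : Type*} [NormedAddCommGroup F] {D : Set (Sp d)} {f g : Sp d → F}
    (h : f =ᵐ[volume.restrict D] g) : l2Norm D f = l2Norm D g := by
  rw [l2Norm, l2Norm, lpNorm, lpNorm, eLpNorm_congr_ae h]

theorem l2Norm_le_h1Norm (Ω D : Set (Sp d)) (v : Sp d → ℝ) : l2Norm D v ≤ h1Norm Ω D v :=
  Real.le_sqrt_of_sq_le (by nlinarith [sq_nonneg (l2Norm D (weakGrad Ω v))])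

theorem l2Norm_weakGrad_le_h1Norm (Ω D : Set (Sp d)) (v : Sp d → ℝ) :
    l2Norm D (weakGrad Ω v) ≤ h1Norm Ω D v :=
  Real.le_sqrt_of_sq_le (by nlinarith [sq_nonneg (l2Norm D v)])

theorem lpNorm_top_mono {F : Type*} [NormedAddCommGroup F] {D E : Set (Sp d)} {f : Sp d → F}
    (hDE : D ⊆ E) (hf : MemLp f ⊤ (volume.restrict E)) : lpNorm ⊤ D f ≤ lpNorm ⊤ E f :=
  ENNReal.toReal_mono hf.2.ne (eLpNorm_mono_measure f (Measure.restrict_mono hDE le_rfl))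

theorem intervalBound_nonneg (Ω : Set (Sp d)) (m p : Sp d → ℝ) : 0 ≤ intervalBound Ω m p :=
  le_max_of_le_left ENNReal.toReal_nonneg

theorem InInterval.abs_le {Ω : Set (Sp d)} {m p v : Sp d → ℝ} (hm : MemLp m ⊤ (volume.restrict Ω))
    (hp : MemLp p ⊤ (volume.restrict Ω)) (h : InInterval Ω m p v) :
    ∀ᵐ x ∂(volume.restrict Ω), |v x| ≤ intervalBound Ω m p := by
  filter_upwards [h, ae_norm_le_lpNorm_top hm, ae_norm_le_lpNorm_top hp] with x hx hmx hpx
  rw [Real.norm_eq_abs] at hmx hpx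
  refine _root_.abs_le.2 ⟨?_, ?_⟩
  · linarith [le_max_left (lpNorm ⊤ Ω m) (lpNorm ⊤ Ω p), neg_abs_le (m x), hx.1,
      show intervalBound Ω m p = max (lpNorm ⊤ Ω m) (lpNorm ⊤ Ω p) from rfl]
  · linarith [le_max_right (lpNorm ⊤ Ω m) (lpNorm ⊤ Ω p), le_abs_self (p x), hx.2,
      show intervalBound Ω m p = max (lpNorm ⊤ Ω m) (lpNorm ⊤ Ω p) from rfl]

theorem piece_spec {Ω : Set (Sp d)} {n : ℕ} {𝒯 : Finset (Finset (Sp d))} {v : Sp d → ℝ}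
    (hv : v ∈ feSpace Ω n 𝒯) {s : Finset (Sp d)} (hs : s ∈ 𝒯) : IsPiece n s v (piece n s v) := by
  rw [piece, dif_pos (hv.2 s hs)]
  exact (hv.2 s hs).choose_spec

/-! ### The element residual -/

/-- The difference of two finite element functions on the element `s`, as a polynomial. -/
noncomputable def diffPiece (n : ℕ) (s : Finset (Sp d)) (v w : Sp d → ℝ) : MvPolynomial (Fin d) ℝ :=
  piece n s v - piece n s w

theorem pieceGrad_sub (n : ℕ) (s : Finset (Sp d)) (v w : Sp d → ℝ) (x : Sp d) :
    pieceGrad n s v x - pieceGrad n s w x = polyGrad (diffPiece n s v w) x := by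
  rw [diffPiece, polyGrad_sub]; rfl

theorem totalDegree_diffPiece_le {Ω : Set (Sp d)} {n : ℕ} {𝒯 : Finset (Finset (Sp d))}
    {v w : Sp d → ℝ} (hv : v ∈ feSpace Ω n 𝒯) (hw : w ∈ feSpace Ω n 𝒯) {s : Finset (Sp d)}
    (hs : s ∈ 𝒯) : (diffPiece n s v w).totalDegree ≤ n :=
  (MvPolynomial.totalDegree_sub _ _).trans (max_le (piece_spec hv hs).1 (piece_spec hw hs).1)

theorem IsTriangulation.l2Norm_diffPiece_le {Ω : Set (Sp d)} {n : ℕ} {𝒯 : Finset (Finset (Sp d))}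
    (h : IsTriangulation Ω 𝒯) {v w : Sp d → ℝ} (hv : v ∈ feSpace Ω n 𝒯) (hw : w ∈ feSpace Ω n 𝒯)
    {s t : Finset (Sp d)} (hs : s ∈ 𝒯) (ht : t ∈ 𝒯) (hts : cell t ⊆ patch 𝒯 s) :
    l2Norm (cell t) (polyGrad (diffPiece n t v w)) ≤ h1Norm Ω (patch 𝒯 s) (v - w) := by
  have hvw : MemH1 Ω (v - w) := hv.1.1.sub hw.1.1
  have h1 : v - w =ᵐ[volume.restrict (cell t)] polyFun (diffPiece n t v w) := by
    filter_upwards [(piece_spec hv ht).2, (piece_spec hw ht).2] with x hx hx'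
    simp [polyFun, diffPiece, hx, hx']
  rw [← l2Norm_congr (h.weakGrad_ae_eq ht hvw h1)]
  exact (l2Norm_mono (Measure.restrict_mono hts le_rfl)
    (hvw.isWeakGradient.1.mono_measure (h.restrict_patch_le hs))).trans
    (l2Norm_weakGrad_le_h1Norm _ _ _)

theorem IsTriangulation.ae_mem_of_cell {Ω : Set (Sp d)} {𝒯 : Finset (Finset (Sp d))}
    (h : IsTriangulation Ω 𝒯) (hΩ : IsOpen Ω) {s : Finset (Sp d)} (hs : s ∈ 𝒯) :
    ∀ᵐ x ∂(volume.restrict (cell s)), x ∈ Ω :=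
  ae_mono (h.restrict_cell_le hs) (ae_restrict_mem hΩ.measurableSet)

theorem ProblemData.memLp_divVec {Ω : Set (Sp d)} {A : Sp d → (Sp d →L[ℝ] Sp d)}
    {b : Sp d → ℝ → ℝ} {f : Sp d → ℝ} (hD : ProblemData Ω A b f) (hΩ : IsOpen Ω)
    {𝒯 : Finset (Finset (Sp d))} (h : IsTriangulation Ω 𝒯) {s : Finset (Sp d)} (hs : s ∈ 𝒯)
    (p : MvPolynomial (Fin d) ℝ) :
    MemLp (divVec fun z => A z (polyGrad p z)) 2 (volume.restrict (cell s)) := by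
  obtain ⟨K, hK⟩ := hD.lipschitz
  have hle := h.restrict_cell_le hs
  have hdiv := ae_norm_le_lpNorm_top ((memLp_top_divMat hΩ hK).mono_measure hle)
  have hAm := ae_norm_le_lpNorm_top ((h.memLp_top_of_lipschitz hΩ hK).mono_measure hle)
  have hg : MemLp (fun x => lpNorm ⊤ (cell s) (divMat A) * ‖polyGrad p x‖
      + d * (lpNorm ⊤ (cell s) A * ‖fderiv ℝ (polyGrad p) x‖)) 2 (volume.restrict (cell s)) := by
    have h1 := continuous_polyGrad p
    have h2 := continuous_fderiv_polyGrad p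
    exact Continuous.memLp_cell (by fun_prop) s 2
  refine hg.of_le (measurable_divVec _).aestronglyMeasurable ?_
  filter_upwards [hdiv, hAm, h.ae_mem_of_cell hΩ hs,
    ae_mono hle (ae_differentiableAt_of_lipschitzOnWith hΩ hK)] with x h1 h2 h3 h4
  refine (abs_divVec_le hΩ hD.symmetric h3 h4 (polyGrad_differentiable p x)).trans ?_
  refine le_trans ?_ (le_abs_self _)
  gcongr

theorem ProblemData.aestronglyMeasurable_deriv {Ω : Set (Sp d)} {A : Sp d → (Sp d →L[ℝ] Sp d)}
    {b : Sp d → ℝ → ℝ} {f : Sp d → ℝ} (hD : ProblemData Ω A b f) (hΩ : IsOpen Ω)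
    {y : Sp d → ℝ} (hy : MemLp y 2 (volume.restrict Ω)) :
    AEStronglyMeasurable (fun x => deriv (b x) (y x)) (volume.restrict Ω) :=
  (aemeasurable_deriv_comp hD.measurable ((ae_restrict_iff' hΩ.measurableSet).2
    (Filter.Eventually.of_forall fun x hx => (hD.smooth x hx).differentiable (by simp)))
    hy.1.aemeasurable).aestronglyMeasurable

theorem ProblemData.memLp_dualResidual {Ω : Set (Sp d)} {A : Sp d → (Sp d →L[ℝ] Sp d)}
    {b : Sp d → ℝ → ℝ} {f : Sp d → ℝ} (hD : ProblemData Ω A b f) (hΩ : IsOpen Ω)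
    {𝒯 : Finset (Finset (Sp d))} (h : IsTriangulation Ω 𝒯) {s : Finset (Sp d)} (hs : s ∈ 𝒯)
    {g y v um up : Sp d → ℝ} {B : ℝ} (hg : MemLp g 2 (volume.restrict Ω))
    (hB : IsLipConst Ω b um up B) (hy : MemLp y 2 (volume.restrict Ω))
    (hyi : InInterval Ω um up y) (hv : MemLp v 2 (volume.restrict Ω)) (n : ℕ) :
    MemLp (dualResidual n A b g y s v) 2 (volume.restrict (cell s)) := by
  have hle := h.restrict_cell_le hs
  have h1 : MemLp (fun x => deriv (b x) (y x) * v x) 2 (volume.restrict Ω) := by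
    refine hv.of_le_mul (c := B) ((hD.aestronglyMeasurable_deriv hΩ hy).mul hv.1) ?_
    filter_upwards [hB.abs_deriv_le hΩ.measurableSet hD.smooth hyi] with x hx
    rw [norm_mul, Real.norm_eq_abs]
    gcongr
  exact (hg.mono_measure hle).sub
    (((hD.memLp_divVec hΩ h hs (piece n s v)).neg).add (h1.mono_measure hle))

/-- The difference of two element residuals. The constant `L` bounds the second derivatives of the
difference of the finite element functions. -/
theorem ProblemData.l2Norm_dualResidual_sub_le {Ω : Set (Sp d)} {A : Sp d → (Sp d →L[ℝ] Sp d)}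
    {b : Sp d → ℝ → ℝ} {f : Sp d → ℝ} (hD : ProblemData Ω A b f) (hΩ : IsOpen Ω)
    {𝒯 : Finset (Finset (Sp d))} (h : IsTriangulation Ω 𝒯) {s : Finset (Sp d)} (hs : s ∈ 𝒯)
    {g y₁ y₂ v w um up zm zp : Sp d → ℝ} {B Θ L : ℝ}
    (hB : IsLipConst Ω b um up B) (hΘ : IsDerivLipConst Ω b um up Θ)
    (hy₁ : MemLp y₁ 2 (volume.restrict Ω)) (hy₂ : MemLp y₂ 2 (volume.restrict Ω))
    (hyi₁ : InInterval Ω um up y₁) (hyi₂ : InInterval Ω um up y₂)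
    (hv : MemLp v 2 (volume.restrict Ω)) (hw : MemLp w 2 (volume.restrict Ω))
    (hzm : MemLp zm ⊤ (volume.restrict Ω)) (hzp : MemLp zp ⊤ (volume.restrict Ω))
    (hwi : InInterval Ω zm zp w) (n : ℕ) (hL0 : 0 ≤ L)
    (hL : ∀ x ∈ cell s, ‖fderiv ℝ (polyGrad (diffPiece n s v w)) x‖ ≤ L) :
    l2Norm (cell s) (dualResidual n A b g y₁ s v - dualResidual n A b g y₂ s w)
      ≤ lpNorm ⊤ (cell s) (divMat A) * l2Norm (cell s) (polyGrad (diffPiece n s v w))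
        + d * (lpNorm ⊤ (patch 𝒯 s) A * (√(volume (cell s)).toReal * L))
        + B * l2Norm (cell s) (v - w)
        + Θ * intervalBound Ω zm zp * l2Norm (cell s) (y₁ - y₂) := by
  obtain ⟨Kl, hKl⟩ := hD.lipschitz
  set q := diffPiece n s v w
  set K := intervalBound Ω zm zp
  set Dv := lpNorm ⊤ (cell s) (divMat A)
  set a := lpNorm ⊤ (patch 𝒯 s) A
  have hK0 : 0 ≤ K := intervalBound_nonneg _ _ _
  have hDv0 : 0 ≤ Dv := ENNReal.toReal_nonneg
  have ha0 : 0 ≤ a := ENNReal.toReal_nonneg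
  have hle := h.restrict_cell_le hs
  have hAp : MemLp A ⊤ (volume.restrict (patch 𝒯 s)) :=
    (h.memLp_top_of_lipschitz hΩ hKl).mono_measure (h.restrict_patch_le hs)
  have hdiv := ae_norm_le_lpNorm_top ((memLp_top_divMat hΩ hKl).mono_measure hle)
  set g₁ : Sp d → ℝ := fun x => Dv * ‖polyGrad q x‖
  set g₂ : Sp d → ℝ := fun _ => d * (a * L)
  set g₃ : Sp d → ℝ := fun x => B * ‖(v - w) x‖
  set g₄ : Sp d → ℝ := fun x => Θ * K * ‖(y₁ - y₂) x‖
  have m₁' : MemLp (polyGrad q) 2 (volume.restrict (cell s)) :=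
    (continuous_polyGrad q).memLp_cell s 2
  have m₃' : MemLp (v - w) 2 (volume.restrict (cell s)) := (hv.sub hw).mono_measure hle
  have m₄' : MemLp (y₁ - y₂) 2 (volume.restrict (cell s)) := (hy₁.sub hy₂).mono_measure hle
  have m₁ : MemLp g₁ 2 (volume.restrict (cell s)) := m₁'.norm.const_mul _
  have m₂ : MemLp g₂ 2 (volume.restrict (cell s)) := memLp_const _
  have m₃ : MemLp g₃ 2 (volume.restrict (cell s)) := m₃'.norm.const_mul _
  have m₄ : MemLp g₄ 2 (volume.restrict (cell s)) := m₄'.norm.const_mul _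
  have hpt : ∀ᵐ x ∂(volume.restrict (cell s)),
      ‖(dualResidual n A b g y₁ s v - dualResidual n A b g y₂ s w) x‖
        ≤ 1 * ‖(g₁ + g₂ + g₃ + g₄) x‖ := by
    filter_upwards [hdiv, h.ae_mem_of_cell hΩ hs, ae_restrict_mem (measurableSet_cell s),
      ae_mono hle (ae_differentiableAt_of_lipschitzOnWith hΩ hKl),
      ae_mono hle (hB.abs_deriv_le hΩ.measurableSet hD.smooth hyi₁),
      ae_mono hle hΘ.2, ae_mono hle hyi₁, ae_mono hle hyi₂, ae_mono hle (hwi.abs_le hzm hzp)]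
      with x hdx hxΩ hxs hAx hbx hΘx hy1x hy2x hwx
    have hax : ‖A x‖ ≤ a := h.norm_le_lpNorm_top hKl.continuousOn hAp hs
      (cell_subset_patch 𝒯 s) hxs hxΩ
    have e0 : (divVec fun z => A z (polyGrad q z)) x
        = divVec (fun z => A z (pieceGrad n s v z)) x - divVec (fun z => A z (pieceGrad n s w z)) x := by
      have := divVec_sub hAx (polyGrad_differentiable (piece n s v) x)
        (polyGrad_differentiable (piece n s w) x)
      rw [← polyGrad_sub] at this
      exact this
    have e1 : (dualResidual n A b g y₁ s v - dualResidual n A b g y₂ s w) x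
        = (divVec fun z => A z (polyGrad q z)) x + -(deriv (b x) (y₁ x) * (v - w) x)
          + -((deriv (b x) (y₁ x) - deriv (b x) (y₂ x)) * w x) := by
      rw [e0]
      simp only [dualResidual, Pi.sub_apply]
      ring
    have b1 : |(divVec fun z => A z (polyGrad q z)) x| ≤ g₁ x + g₂ x := by
      refine (abs_divVec_le hΩ hD.symmetric hxΩ hAx (polyGrad_differentiable q x)).trans ?_
      simp only [g₁, g₂]
      have := hL x hxs
      gcongr
    have b2 : |-(deriv (b x) (y₁ x) * (v - w) x)| ≤ g₃ x := by
      rw [abs_neg, abs_mul]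
      simp only [g₃, Real.norm_eq_abs]
      gcongr
    have b3 : |-((deriv (b x) (y₁ x) - deriv (b x) (y₂ x)) * w x)| ≤ g₄ x := by
      rw [abs_neg, abs_mul]
      simp only [g₄, Real.norm_eq_abs]
      calc _ ≤ (Θ * |y₁ x - y₂ x|) * K :=
            mul_le_mul (hΘx _ hy1x _ hy2x) hwx (abs_nonneg _)
              (mul_nonneg hΘ.1 (abs_nonneg _))
        _ = _ := by simp only [Pi.sub_apply]; ring
    rw [e1, one_mul, Real.norm_eq_abs]
    refine le_trans ?_ (le_abs_self _)
    refine (abs_add_three _ _ _).trans ?_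
    simp only [Pi.add_apply]
    linarith
  have t1 := toReal_eLpNorm_le_mul zero_le_one (((m₁.add m₂).add m₃).add m₄) hpt
  rw [one_mul] at t1
  refine t1.trans ?_
  refine (toReal_eLpNorm_add_le ((m₁.add m₂).add m₃) m₄).trans (add_le_add ?_ ?_)
  · refine (toReal_eLpNorm_add_le (m₁.add m₂) m₃).trans (add_le_add ?_ ?_)
    · refine (toReal_eLpNorm_add_le m₁ m₂).trans (add_le_add ?_ ?_)
      · exact toReal_eLpNorm_le_mul hDv0 m₁' (Filter.Eventually.of_forall fun x => by
          simp [g₁, abs_of_nonneg hDv0])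
      · have := toReal_eLpNorm_le_of_bound (μ := volume.restrict (cell s)) (f := g₂)
          (c := d * (a * L)) (by positivity) (Filter.Eventually.of_forall fun x => by
            simp only [g₂, Real.norm_eq_abs]; rw [abs_of_nonneg (by positivity)])
        rw [Measure.restrict_apply_univ] at this
        exact this.trans_eq (by ring)
    · exact toReal_eLpNorm_le_mul hB.1 m₃' (Filter.Eventually.of_forall fun x => by
        simp [g₃, abs_of_nonneg hB.1])
  · have hΘK : 0 ≤ Θ * K := mul_nonneg hΘ.1 hK0
    exact toReal_eLpNorm_le_mul hΘK m₄' (Filter.Eventually.of_forall fun x => by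
      simp only [g₄, norm_mul, Real.norm_eq_abs, abs_abs]
      rw [← abs_mul Θ K, abs_of_nonneg hΘK])

/-! ### The jump terms -/

theorem norm_outwardNormal_le (s t : Finset (Sp d)) : ‖outwardNormal s t‖ ≤ 1 := by
  unfold outwardNormal
  split_ifs with h
  · exact h.choose_spec.1.le
  · simp

theorem ProblemData.abs_jump_le {Ω : Set (Sp d)} {A : Sp d → (Sp d →L[ℝ] Sp d)}
    {b : Sp d → ℝ → ℝ} {f : Sp d → ℝ} (hD : ProblemData Ω A b f) (hΩ : IsOpen Ω)
    {𝒯 : Finset (Finset (Sp d))} (h : IsTriangulation Ω 𝒯) {s t : Finset (Sp d)} (hs : s ∈ 𝒯)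
    (n : ℕ) (v w : Sp d → ℝ) {x : Sp d} (hx : x ∈ cell s) (hxΩ : x ∈ Ω) :
    |jump n A s t v x - jump n A s t w x| ≤ lpNorm ⊤ (patch 𝒯 s) A *
      (‖polyGrad (diffPiece n t v w) x‖ + ‖polyGrad (diffPiece n s v w) x‖) := by
  obtain ⟨Kl, hKl⟩ := hD.lipschitz
  have hAp : MemLp A ⊤ (volume.restrict (patch 𝒯 s)) :=
    (h.memLp_top_of_lipschitz hΩ hKl).mono_measure (h.restrict_patch_le hs)
  have hax : ‖A x‖ ≤ lpNorm ⊤ (patch 𝒯 s) A := h.norm_le_lpNorm_top hKl.continuousOn hAp hs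
    (cell_subset_patch 𝒯 s) hx hxΩ
  have e : jump n A s t v x - jump n A s t w x
      = inner ℝ (A x (polyGrad (diffPiece n t v w) x - polyGrad (diffPiece n s v w) x))
        (outwardNormal s t) := by
    rw [← pieceGrad_sub, ← pieceGrad_sub]
    simp only [jump, map_sub, inner_sub_left]
    ring
  rw [e]
  calc _ ≤ ‖A x (polyGrad (diffPiece n t v w) x - polyGrad (diffPiece n s v w) x)‖
          * ‖outwardNormal s t‖ := abs_real_inner_le_norm _ _
    _ ≤ ‖A x (polyGrad (diffPiece n t v w) x - polyGrad (diffPiece n s v w) x)‖ * 1 := by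
      gcongr; exact norm_outwardNormal_le s t
    _ ≤ ‖A x‖ * ‖polyGrad (diffPiece n t v w) x - polyGrad (diffPiece n s v w) x‖ := by
      rw [mul_one]; exact (A x).le_opNorm _
    _ ≤ _ := mul_le_mul hax (norm_sub_le _ _) (norm_nonneg _) ENNReal.toReal_nonneg

theorem ProblemData.memLp_jump {Ω : Set (Sp d)} {A : Sp d → (Sp d →L[ℝ] Sp d)}
    {b : Sp d → ℝ → ℝ} {f : Sp d → ℝ} (hD : ProblemData Ω A b f) (hΩ : IsOpen Ω)
    {𝒯 : Finset (Finset (Sp d))} (h : IsTriangulation Ω 𝒯) {s t : Finset (Sp d)} (hs : s ∈ 𝒯)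
    (n : ℕ) (v : Sp d → ℝ) {μ : Measure (Sp d)} (hμ : μ (cell s ∩ cell t) < ⊤) :
    MemLp (jump n A s t v) 2 (μ.restrict (cell s ∩ cell t ∩ Ω)) := by
  obtain ⟨Kl, hKl⟩ := hD.lipschitz
  have hAp : MemLp A ⊤ (volume.restrict (patch 𝒯 s)) :=
    (h.memLp_top_of_lipschitz hΩ hKl).mono_measure (h.restrict_patch_le hs)
  have hmeas : MeasurableSet (cell s ∩ cell t ∩ Ω) :=
    ((measurableSet_cell s).inter (measurableSet_cell t)).inter hΩ.measurableSet
  have hfin : IsFiniteMeasure (μ.restrict (cell s ∩ cell t ∩ Ω)) :=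
    ⟨by simpa using (measure_mono Set.inter_subset_left).trans_lt hμ⟩
  have hcs : Continuous (pieceGrad n s v) := continuous_polyGrad _
  have hct : Continuous (pieceGrad n t v) := continuous_polyGrad _
  have hc : ContinuousOn (jump n A s t v) Ω := by
    unfold jump
    exact ((hKl.continuousOn.clm_apply hct.continuousOn).inner continuousOn_const).sub
      ((hKl.continuousOn.clm_apply hcs.continuousOn).inner continuousOn_const)
  obtain ⟨R, hR⟩ := (isCompact_cell s).exists_bound_of_continuousOn
    ((hct.norm.add hcs.norm).continuousOn)
  refine MemLp.of_bound ((hc.mono Set.inter_subset_right).aestronglyMeasurable hmeas)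
    (lpNorm ⊤ (patch 𝒯 s) A * R) ?_
  rw [ae_restrict_iff' hmeas]
  refine Filter.Eventually.of_forall fun x hx => ?_
  have hax : ‖A x‖ ≤ lpNorm ⊤ (patch 𝒯 s) A := h.norm_le_lpNorm_top hKl.continuousOn hAp hs
    (cell_subset_patch 𝒯 s) hx.1.1 hx.2
  have e : jump n A s t v x
      = inner ℝ (A x (pieceGrad n t v x - pieceGrad n s v x)) (outwardNormal s t) := by
    simp only [jump, map_sub, inner_sub_left]
  rw [e, Real.norm_eq_abs]
  calc _ ≤ ‖A x (pieceGrad n t v x - pieceGrad n s v x)‖ * ‖outwardNormal s t‖ :=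
        abs_real_inner_le_norm _ _
    _ ≤ ‖A x (pieceGrad n t v x - pieceGrad n s v x)‖ * 1 := by
      gcongr; exact norm_outwardNormal_le s t
    _ ≤ ‖A x‖ * ‖pieceGrad n t v x - pieceGrad n s v x‖ := by
      rw [mul_one]; exact (A x).le_opNorm _
    _ ≤ _ := mul_le_mul hax ((norm_sub_le _ _).trans ((le_abs_self _).trans (hR x hx.1.1)))
      (norm_nonneg _) ENNReal.toReal_nonneg

/-! ### Stability of the dual indicator -/

theorem abs_sqrt_add_sq_sub_le (p q p' q' : ℝ) :
    |√(p ^ 2 + q ^ 2) - √(p' ^ 2 + q' ^ 2)| ≤ |p - p'| + |q - q'| := by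
  have e : ∀ p q : ℝ, √(p ^ 2 + q ^ 2) = ‖(⟨p, q⟩ : ℂ)‖ := fun p q => by
    rw [Complex.norm_def, Complex.normSq_mk]; ring_nf
  rw [e, e]
  refine (abs_norm_sub_norm_le _ _).trans ((Complex.norm_le_abs_re_add_abs_im _).trans ?_)
  simp

theorem abs_sqrt_add_sum_sq_sub_le {ι : Type*} (I : Finset ι) (p p' : ℝ) (β β' : ι → ℝ) :
    |√(p ^ 2 + ∑ i ∈ I, β i ^ 2) - √(p' ^ 2 + ∑ i ∈ I, β' i ^ 2)|
      ≤ |p - p'| + ∑ i ∈ I, |β i - β' i| := by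
  classical
  induction I using Finset.induction_on with
  | empty =>
    simp only [Finset.sum_empty, add_zero, Real.sqrt_sq_eq_abs]
    exact abs_abs_sub_abs_le p p'
  | insert a I ha ih =>
    have e : ∀ (p : ℝ) (β : ι → ℝ), √(p ^ 2 + ∑ i ∈ insert a I, β i ^ 2)
        = √(√(p ^ 2 + ∑ i ∈ I, β i ^ 2) ^ 2 + β a ^ 2) := fun p β => by
      rw [Real.sq_sqrt (by positivity), Finset.sum_insert ha]; ring_nf
    rw [e, e, Finset.sum_insert ha]
    refine (abs_sqrt_add_sq_sub_le _ _ _ _).trans ?_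
    linarith

/-- The scaled difference of two jump terms: the trace estimate on the common hyperface in the form
of an inverse estimate for the polynomials on both sides. -/
theorem ProblemData.sqrt_mul_abs_jump_sub_le {Ω : Set (Sp d)} {A : Sp d → (Sp d →L[ℝ] Sp d)}
    {b : Sp d → ℝ → ℝ} {f : Sp d → ℝ} (hD : ProblemData Ω A b f) (hΩ : IsOpen Ω)
    {𝒯 : Finset (Finset (Sp d))} (h : IsTriangulation Ω 𝒯) {s t : Finset (Sp d)} (hs : s ∈ 𝒯)
    (ht : t ∈ 𝒯) (n : ℕ) (v w : Sp d → ℝ) {μ : Measure (Sp d)} (hμ : μ (cell s ∩ cell t) < ⊤)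
    {C C' E : ℝ} (hC' : 0 ≤ C') (hE : 0 ≤ E) (hC : 0 ≤ C)
    (hμs : meshSize s * (μ (cell s ∩ cell t)).toReal ≤ C' * (volume (cell s)).toReal)
    (hμt : meshSize s * (μ (cell s ∩ cell t)).toReal ≤ C' * (volume (cell t)).toReal)
    (hqs : ∀ x ∈ cell s,
      √(volume (cell s)).toReal * ‖polyGrad (diffPiece n s v w) x‖ ≤ C * E)
    (hqt : ∀ x ∈ cell t,
      √(volume (cell t)).toReal * ‖polyGrad (diffPiece n t v w) x‖ ≤ C * E) :
    √(meshSize s) * |(eLpNorm (jump n A s t v) 2 (μ.restrict (cell s ∩ cell t ∩ Ω))).toReal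
        - (eLpNorm (jump n A s t w) 2 (μ.restrict (cell s ∩ cell t ∩ Ω))).toReal|
      ≤ 2 * C * √C' * (lpNorm ⊤ (patch 𝒯 s) A * E) := by
  set a := lpNorm ⊤ (patch 𝒯 s) A
  have ha0 : 0 ≤ a := ENNReal.toReal_nonneg
  set H := (μ (cell s ∩ cell t)).toReal
  have hH0 : 0 ≤ H := ENNReal.toReal_nonneg
  have hh0 : 0 ≤ meshSize s := meshSize_nonneg s
  have hVs := Real.sqrt_pos.2 (h.isSimplex hs).volume_pos
  have hVt := Real.sqrt_pos.2 (h.isSimplex ht).volume_pos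
  set Vs := (volume (cell s)).toReal
  set Vt := (volume (cell t)).toReal
  have hmeas : MeasurableSet (cell s ∩ cell t ∩ Ω) :=
    ((measurableSet_cell s).inter (measurableSet_cell t)).inter hΩ.measurableSet
  have hfin : IsFiniteMeasure (μ.restrict (cell s ∩ cell t ∩ Ω)) :=
    ⟨by simpa using (measure_mono Set.inter_subset_left).trans_lt hμ⟩
  set c := a * (C * E / √Vt + C * E / √Vs)
  have hc0 : 0 ≤ c := by positivity
  have hb : ∀ᵐ x ∂(μ.restrict (cell s ∩ cell t ∩ Ω)),
      ‖(jump n A s t v - jump n A s t w) x‖ ≤ c := by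
    rw [ae_restrict_iff' hmeas]
    refine Filter.Eventually.of_forall fun x hx => ?_
    refine (hD.abs_jump_le hΩ h hs n v w hx.1.1 hx.2).trans ?_
    have h1 := hqs x hx.1.1
    have h2 := hqt x hx.1.2
    rw [mul_comm, ← le_div_iff₀ hVs] at h1
    rw [mul_comm, ← le_div_iff₀ hVt] at h2
    simp only [c]
    gcongr
  have h1 := abs_toReal_eLpNorm_sub_le (hD.memLp_jump hΩ h hs n v hμ) (hD.memLp_jump hΩ h hs n w hμ)
  have h2 := h1.trans (toReal_eLpNorm_le_of_bound hc0 hb)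
  have h3 : √((μ.restrict (cell s ∩ cell t ∩ Ω)) Set.univ).toReal ≤ √H := by
    rw [Measure.restrict_apply_univ]
    exact Real.sqrt_le_sqrt (ENNReal.toReal_mono hμ.ne (measure_mono Set.inter_subset_left))
  have k : ∀ V : ℝ, 0 < √V → meshSize s * H ≤ C' * V →
      √(meshSize s) * √H * (C * E / √V) ≤ √C' * (C * E) := by
    intro V hV hV'
    have : √(meshSize s) * √H ≤ √C' * √V := by
      rw [← Real.sqrt_mul hh0, ← Real.sqrt_mul hC']
      exact Real.sqrt_le_sqrt hV'
    calc _ ≤ √C' * √V * (C * E / √V) := by gcongr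
      _ = _ := by field_simp
  calc _ ≤ √(meshSize s) * (√H * c) := by
        gcongr
        exact h2.trans (by gcongr)
    _ = a * (√(meshSize s) * √H * (C * E / √Vt) + √(meshSize s) * √H * (C * E / √Vs)) := by
        simp only [c]; ring
    _ ≤ a * (√C' * (C * E) + √C' * (C * E)) := by
        exact mul_le_mul_of_nonneg_left (add_le_add (k Vt hVt hμt) (k Vs hVs hμs)) ha0
    _ = _ := by ring

theorem dataEstimator_eq {s : Finset (Sp d)} (hs : IsSimplex s) (𝒯 : Finset (Finset (Sp d)))
    (A : Sp d → (Sp d →L[ℝ] Sp d)) (B : ℝ) :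
    dataEstimator 𝒯 A B s = √((meshSize s * lpNorm ⊤ (cell s) (divMat A)) ^ 2
      + lpNorm ⊤ (patch 𝒯 s) A ^ 2 + (meshSize s * B) ^ 2) := by
  have := hs.meshSize_pos
  unfold dataEstimator
  congr 1
  field_simp

theorem dataEstimator_nonneg (𝒯 : Finset (Finset (Sp d))) (A : Sp d → (Sp d →L[ℝ] Sp d)) (B : ℝ)
    (s : Finset (Sp d)) : 0 ≤ dataEstimator 𝒯 A B s := Real.sqrt_nonneg _

/-- The dual indicator is stable with respect to the linearization point and the finite element
function. -/
theorem exists_dualIndicator_stability (hd : 2 ≤ d) (n : ℕ) {Ω : Set (Sp d)} (hΩ : IsOpen Ω)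
    (𝒯₀ : Finset (Finset (Sp d))) :
    ∃ Λ : ℝ, 0 < Λ ∧
      ∀ (A : Sp d → (Sp d →L[ℝ] Sp d)) (b : Sp d → ℝ → ℝ) (f g : Sp d → ℝ),
      ProblemData Ω A b f → MemLp g 2 (volume.restrict Ω) →
      ∀ (um up : Sp d → ℝ) (B Θ : ℝ), IsLipConst Ω b um up B → IsDerivLipConst Ω b um up Θ →
      ∀ zm zp : Sp d → ℝ, MemLp zm ⊤ (volume.restrict Ω) → MemLp zp ⊤ (volume.restrict Ω) →
      ∀ 𝒯 : Finset (Finset (Sp d)), IsRefinement Ω 𝒯₀ 𝒯 →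
      ∀ y₁ y₂ : Sp d → ℝ, MemLp y₁ 2 (volume.restrict Ω) → MemLp y₂ 2 (volume.restrict Ω) →
      InInterval Ω um up y₁ → InInterval Ω um up y₂ →
      ∀ v ∈ feSpace Ω n 𝒯, ∀ w ∈ feSpace Ω n 𝒯, InInterval Ω zm zp w → ∀ T ∈ 𝒯,
      |dualIndicator Ω n 𝒯 A b g y₁ v T - dualIndicator Ω n 𝒯 A b g y₂ w T|
        ≤ Λ * dataEstimator 𝒯 A B T * h1Norm Ω (patch 𝒯 T) (v - w)
          + Θ * intervalBound Ω zm zp * meshSize T * l2Norm (cell T) (y₁ - y₂) := by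
  classical
  have hd0 : d ≠ 0 := by omega
  obtain ⟨C, hC, hinv⟩ := exists_inverse_estimate hd0 n 𝒯₀
  obtain ⟨C', hC', hface⟩ := exists_face_estimate hd 𝒯₀
  refine ⟨2 + d * C + (d + 1) * (2 * C * √C'), by positivity, ?_⟩
  intro A b f g hD hg um up B Θ hB hΘ zm zp hzm hzp 𝒯 h𝒯 y₁ y₂ hy₁ hy₂ hyi₁ hyi₂ v hv w hw hwi s hs
  have h := h𝒯.1
  have hv2 : MemLp v 2 (volume.restrict Ω) := hv.1.1.1
  have hw2 : MemLp w 2 (volume.restrict Ω) := hw.1.1.1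
  set E := h1Norm Ω (patch 𝒯 s) (v - w) with hE
  have hE0 : 0 ≤ E := Real.sqrt_nonneg _
  set η := dataEstimator 𝒯 A B s with hη
  have hh := (h.isSimplex hs).meshSize_pos
  set hs' := meshSize s
  set a := lpNorm ⊤ (patch 𝒯 s) A
  set Dv := lpNorm ⊤ (cell s) (divMat A)
  have ha0 : 0 ≤ a := ENNReal.toReal_nonneg
  have hDv0 : 0 ≤ Dv := ENNReal.toReal_nonneg
  have hη' := dataEstimator_eq (h.isSimplex hs) 𝒯 A B
  have hη0 : 0 ≤ η := Real.sqrt_nonneg _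
  have hη1 : hs' * Dv ≤ η := by
    rw [hη, hη']
    exact Real.le_sqrt_of_sq_le (by nlinarith [sq_nonneg a, sq_nonneg (hs' * B)])
  have hη2 : a ≤ η := by
    rw [hη, hη']
    exact Real.le_sqrt_of_sq_le (by nlinarith [sq_nonneg (hs' * Dv), sq_nonneg (hs' * B)])
  have hη3 : hs' * B ≤ η := by
    rw [hη, hη']
    exact Real.le_sqrt_of_sq_le (by nlinarith [sq_nonneg (hs' * Dv), sq_nonneg a])
  have hVs := Real.sqrt_pos.2 (h.isSimplex hs).volume_pos
  have hEs := h.l2Norm_diffPiece_le hv hw hs hs (cell_subset_patch 𝒯 s)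
  rw [← hE] at hEs
  have hinv_s := hinv Ω 𝒯 h𝒯 s hs _ (totalDegree_diffPiece_le hv hw hs)
  set Vs := (volume (cell s)).toReal
  -- The residual part.
  have hres : |hs' * l2Norm (cell s) (dualResidual n A b g y₁ s v)
      - hs' * l2Norm (cell s) (dualResidual n A b g y₂ s w)|
      ≤ (2 + d * C) * η * E
        + Θ * intervalBound Ω zm zp * hs' * l2Norm (cell s) (y₁ - y₂) := by
    set L := C * E / (√Vs * hs') with hLdef
    have hL : ∀ x ∈ cell s, ‖fderiv ℝ (polyGrad (diffPiece n s v w)) x‖ ≤ L := by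
      intro x hx
      rw [hLdef, le_div_iff₀ (by positivity)]
      have := (hinv_s x hx).2
      calc _ = √Vs * (hs' * ‖fderiv ℝ (polyGrad (diffPiece n s v w)) x‖) := by ring
        _ ≤ _ := this.trans (by gcongr)
    have h1 := abs_toReal_eLpNorm_sub_le
      (hD.memLp_dualResidual hΩ h hs hg hB hy₁ hyi₁ hv2 n)
      (hD.memLp_dualResidual hΩ h hs hg hB hy₂ hyi₂ hw2 n)
    have h2 := hD.l2Norm_dualResidual_sub_le hΩ h hs (g := g) hB hΘ hy₁ hy₂ hyi₁ hyi₂ hv2 hw2 hzm hzp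
      hwi n (by positivity) hL
    have h3 : l2Norm (cell s) (v - w) ≤ E :=
      (l2Norm_mono (Measure.restrict_mono (cell_subset_patch 𝒯 s) le_rfl)
        ((hv2.sub hw2).mono_measure (h.restrict_patch_le hs))).trans (l2Norm_le_h1Norm _ _ _)
    rw [← mul_sub, abs_mul, abs_of_pos hh]
    have hBE : hs' * (B * l2Norm (cell s) (v - w)) ≤ η * E := by
      rw [← mul_assoc]
      exact mul_le_mul hη3 h3 (l2Norm_nonneg _ _) hη0
    have hDE : hs' * (Dv * l2Norm (cell s) (polyGrad (diffPiece n s v w))) ≤ η * E := by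
      rw [← mul_assoc]
      exact mul_le_mul hη1 hEs (l2Norm_nonneg _ _) hη0
    have hLE : hs' * (d * (a * (√Vs * L))) ≤ d * C * (η * E) := by
      have : hs' * (d * (a * (√Vs * L))) = d * C * (a * E) := by
        rw [hLdef]; field_simp
      rw [this]
      gcongr
    calc _ ≤ hs' * (Dv * l2Norm (cell s) (polyGrad (diffPiece n s v w))
        + d * (a * (√Vs * L)) + B * l2Norm (cell s) (v - w)
        + Θ * intervalBound Ω zm zp * l2Norm (cell s) (y₁ - y₂)) :=
          mul_le_mul_of_nonneg_left (h1.trans h2) hh.le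
      _ = hs' * (Dv * l2Norm (cell s) (polyGrad (diffPiece n s v w)))
        + hs' * (d * (a * (√Vs * L))) + hs' * (B * l2Norm (cell s) (v - w))
        + Θ * intervalBound Ω zm zp * hs' * l2Norm (cell s) (y₁ - y₂) := by ring
      _ ≤ η * E + d * C * (η * E) + η * E
        + Θ * intervalBound Ω zm zp * hs' * l2Norm (cell s) (y₁ - y₂) := by gcongr
      _ = _ := by ring
  -- The jump part.
  set N : (Sp d → ℝ) → Finset (Sp d) → ℝ := fun v t => (eLpNorm (jump n A s t v) 2
      ((Measure.euclideanHausdorffMeasure (d - 1)).restrict (cell s ∩ cell t ∩ Ω))).toReal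
  have hjump : ∀ t ∈ neighbours 𝒯 s, |√hs' * N v t - √hs' * N w t|
      ≤ 2 * C * √C' * (η * E) := by
    intro t ht
    obtain ⟨ht, hst⟩ := Finset.mem_filter.1 ht
    have hts := cell_subset_patch_of_mem (𝒯 := 𝒯) (s := s) (Finset.mem_filter.2 ⟨ht, hst⟩)
    obtain ⟨hfin, hf1, hf2⟩ := hface Ω 𝒯 h𝒯 s hs t ht hst
    have hEt := h.l2Norm_diffPiece_le hv hw hs ht hts
    rw [← mul_sub, abs_mul, abs_of_nonneg (Real.sqrt_nonneg _)]
    refine (hD.sqrt_mul_abs_jump_sub_le hΩ h hs ht n v w hfin hC'.le hE0 hC.le hf1 hf2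
      (fun x hx => ((hinv_s x hx).1).trans (by gcongr))
      (fun x hx => ((hinv Ω 𝒯 h𝒯 t ht _ (totalDegree_diffPiece_le hv hw ht) x hx).1).trans
        (by gcongr))).trans ?_
    gcongr
  have hform : ∀ (y v : Sp d → ℝ), dualIndicator Ω n 𝒯 A b g y v s
      = √((hs' * l2Norm (cell s) (dualResidual n A b g y s v)) ^ 2
        + ∑ t ∈ neighbours 𝒯 s, (√hs' * N v t) ^ 2) := by
    intro y v
    unfold dualIndicator jumpNormSq
    congr 1
    rw [mul_pow, Finset.mul_sum]
    congr 1
    refine Finset.sum_congr rfl fun t _ => ?_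
    rw [mul_pow, Real.sq_sqrt hh.le]
  rw [hform, hform]
  refine (abs_sqrt_add_sum_sq_sub_le _ _ _ _ _).trans ?_
  have hsum : ∑ t ∈ neighbours 𝒯 s, |√hs' * N v t - √hs' * N w t|
      ≤ (d + 1) * (2 * C * √C' * (η * E)) := by
    refine (Finset.sum_le_sum hjump).trans ?_
    rw [Finset.sum_const, nsmul_eq_mul]
    have : ((neighbours 𝒯 s).card : ℝ) ≤ d + 1 := by
      exact_mod_cast h.card_neighbours_le hd0 hs
    gcongr
  calc _ ≤ ((2 + d * C) * η * E + Θ * intervalBound Ω zm zp * hs' * l2Norm (cell s) (y₁ - y₂))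
        + (d + 1) * (2 * C * √C' * (η * E)) := add_le_add hres hsum
    _ = _ := by ring

/-! ### From indicators to estimators -/

/-- The norms over the patches add up to at most `d + 2` times the norm over the domain. -/
theorem IsTriangulation.sum_l2Norm_patch_sq_le {Ω : Set (Sp d)} {𝒯 : Finset (Finset (Sp d))}
    (h : IsTriangulation Ω 𝒯) (hd : d ≠ 0) {F : Type*} [NormedAddCommGroup F] {f : Sp d → F}
    (hf : MemLp f 2 (volume.restrict Ω)) :
    ∑ s ∈ 𝒯, l2Norm (patch 𝒯 s) f ^ 2 ≤ (d + 2) * l2Norm Ω f ^ 2 := by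
  set g : Sp d → ENNReal := fun x => ‖f x‖ₑ ^ ((2 : NNReal) : ℝ)
  have e : ∀ D : Set (Sp d), l2Norm D f ^ 2 = (∫⁻ x in D, g x).toReal := fun D => by
    have := eLpNorm_nnreal_pow_eq_lintegral (f := f) (μ := volume.restrict D) (p := 2) (by norm_num)
    rw [← this, ← ENNReal.toReal_rpow]
    simp [l2Norm, lpNorm]
  have hfin : ∫⁻ x in Ω, g x ≠ ⊤ := by
    have := eLpNorm_nnreal_pow_eq_lintegral (f := f) (μ := volume.restrict Ω) (p := 2) (by norm_num)
    rw [← this]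
    exact ENNReal.rpow_ne_top_of_nonneg (by positivity) hf.2.ne
  have h1 := h.sum_lintegral_patch_le hd g
  have hfin' : ∀ s ∈ 𝒯, ∫⁻ x in patch 𝒯 s, g x ≠ ⊤ := fun s hs =>
    ne_top_of_le_ne_top hfin (lintegral_mono' (h.restrict_patch_le hs) le_rfl)
  simp only [e]
  rw [← ENNReal.toReal_sum hfin']
  have h2 := ENNReal.toReal_mono (ENNReal.mul_ne_top (ENNReal.natCast_ne_top _) hfin) h1
  rw [ENNReal.toReal_mul, ENNReal.toReal_natCast] at h2
  exact_mod_cast h2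

theorem IsTriangulation.sum_l2Norm_cell_sq {Ω : Set (Sp d)} {𝒯 : Finset (Finset (Sp d))}
    (h : IsTriangulation Ω 𝒯) {F : Type*} [NormedAddCommGroup F] {f : Sp d → F}
    (hf : MemLp f 2 (volume.restrict Ω)) :
    ∑ s ∈ 𝒯, l2Norm (cell s) f ^ 2 = l2Norm Ω f ^ 2 := by
  set g : Sp d → ENNReal := fun x => ‖f x‖ₑ ^ ((2 : NNReal) : ℝ)
  have e : ∀ D : Set (Sp d), l2Norm D f ^ 2 = (∫⁻ x in D, g x).toReal := fun D => by
    have := eLpNorm_nnreal_pow_eq_lintegral (f := f) (μ := volume.restrict D) (p := 2) (by norm_num)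
    rw [← this, ← ENNReal.toReal_rpow]
    simp [l2Norm, lpNorm]
  have hfin : ∫⁻ x in Ω, g x ≠ ⊤ := by
    have := eLpNorm_nnreal_pow_eq_lintegral (f := f) (μ := volume.restrict Ω) (p := 2) (by norm_num)
    rw [← this]
    exact ENNReal.rpow_ne_top_of_nonneg (by positivity) hf.2.ne
  simp only [e]
  rw [← h.sum_lintegral_cell, ENNReal.toReal_sum]
  exact fun s hs => ne_top_of_le_ne_top hfin (lintegral_mono' (h.restrict_cell_le hs) le_rfl)

theorem h1Norm_sq (Ω D : Set (Sp d)) (v : Sp d → ℝ) :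
    h1Norm Ω D v ^ 2 = l2Norm D v ^ 2 + l2Norm D (weakGrad Ω v) ^ 2 :=
  Real.sq_sqrt (by positivity)

theorem IsTriangulation.sum_h1Norm_patch_sq_le {Ω : Set (Sp d)} {𝒯 : Finset (Finset (Sp d))}
    (h : IsTriangulation Ω 𝒯) (hd : d ≠ 0) {v : Sp d → ℝ} (hv : MemH1 Ω v) :
    ∑ s ∈ 𝒯, h1Norm Ω (patch 𝒯 s) v ^ 2 ≤ (d + 2) * h1Norm Ω Ω v ^ 2 := by
  simp only [h1Norm_sq]
  rw [Finset.sum_add_distrib, mul_add]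
  exact add_le_add (h.sum_l2Norm_patch_sq_le hd hv.1)
    (h.sum_l2Norm_patch_sq_le hd hv.isWeakGradient.1)

theorem IsRefinement.meshSize_le {Ω : Set (Sp d)} {𝒯₀ 𝒯 : Finset (Finset (Sp d))}
    (h : IsRefinement Ω 𝒯₀ 𝒯) {s : Finset (Sp d)} (hs : s ∈ 𝒯) :
    meshSize s ≤ maxMeshSize 𝒯₀ := by
  obtain ⟨s₀, hs₀, hsub⟩ := h.exists_cell_subset hs
  have h1 : meshSize s ≤ meshSize s₀ :=
    Real.rpow_le_rpow ENNReal.toReal_nonneg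
      (ENNReal.toReal_mono (volume_cell_lt_top s₀).ne (measure_mono hsub)) (by positivity)
  exact h1.trans (le_ciSup (f := fun s : 𝒯₀ => meshSize (s : Finset (Sp d)))
    (Set.finite_range _).bddAbove ⟨s₀, hs₀⟩)

/-- The data estimator does not increase under refinement, since `h_T` and `ω_T` do not. -/
theorem IsRefinement.dataEstimator_le {Ω : Set (Sp d)} (hΩ : IsOpen Ω)
    {𝒯₀ 𝒯 : Finset (Finset (Sp d))} (h₀ : IsTriangulation Ω 𝒯₀) (h : IsRefinement Ω 𝒯₀ 𝒯)
    {A : Sp d → (Sp d →L[ℝ] Sp d)} {K : NNReal} (hA : LipschitzOnWith K A Ω) {B : ℝ} (hB : 0 ≤ B)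
    {s : Finset (Sp d)} (hs : s ∈ 𝒯) :
    dataEstimator 𝒯 A B s ≤ maxDataEstimator 𝒯₀ A B := by
  obtain ⟨s₀, hs₀, hsub, hpatch⟩ := h.exists_patch_subset h₀ hs
  have hm : meshSize s ≤ meshSize s₀ :=
    Real.rpow_le_rpow ENNReal.toReal_nonneg
      (ENNReal.toReal_mono (volume_cell_lt_top s₀).ne (measure_mono hsub)) (by positivity)
  have hm0 := meshSize_nonneg s
  have hm0' := meshSize_nonneg s₀
  have hD := lpNorm_top_mono hsub ((memLp_top_divMat hΩ hA).mono_measure (h₀.restrict_cell_le hs₀))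
  have ha := lpNorm_top_mono hpatch
    ((h₀.memLp_top_of_lipschitz hΩ hA).mono_measure (h₀.restrict_patch_le hs₀))
  have hD0 : 0 ≤ lpNorm ⊤ (cell s) (divMat A) := ENNReal.toReal_nonneg
  have ha0 : 0 ≤ lpNorm ⊤ (patch 𝒯 s) A := ENNReal.toReal_nonneg
  have h1 : dataEstimator 𝒯 A B s ≤ dataEstimator 𝒯₀ A B s₀ := by
    rw [dataEstimator_eq (h.1.isSimplex hs), dataEstimator_eq (h₀.isSimplex hs₀)]
    gcongr
  exact h1.trans (le_ciSup (f := fun s : 𝒯₀ => dataEstimator 𝒯₀ A B (s : Finset (Sp d)))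
    (Set.finite_range _).bddAbove ⟨s₀, hs₀⟩)

/-- Young's inequality, applied twice. -/
theorem sq_ge_of_le_add_add {p a X Y δ ε : ℝ} (hp : 0 ≤ p)
    (hδ : 0 < δ) (hε : 0 < ε) (h : p ≤ a + X + Y) :
    (1 + δ)⁻¹ * (1 + ε)⁻¹ * p ^ 2 - (1 + δ)⁻¹ * ε⁻¹ * Y ^ 2 - δ⁻¹ * X ^ 2 ≤ a ^ 2 := by
  have young : ∀ {x y ε : ℝ}, 0 < ε → (x + y) ^ 2 ≤ (1 + ε) * x ^ 2 + (1 + ε) * ε⁻¹ * y ^ 2 := by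
    intro x y ε hε
    have h1 : (1 + ε) * x ^ 2 + (1 + ε) * ε⁻¹ * y ^ 2 - (x + y) ^ 2 = ε⁻¹ * (ε * x - y) ^ 2 := by
      field_simp; ring
    have h2 : 0 ≤ ε⁻¹ * (ε * x - y) ^ 2 := by positivity
    linarith
  have h1 : p ^ 2 ≤ (a + X + Y) ^ 2 := by gcongr
  have h2 := h1.trans (young (x := a + X) (y := Y) hε)
  have h3 := young (x := a) (y := X) hδ
  have h4 : (1 + δ)⁻¹ * (1 + ε)⁻¹ * p ^ 2
      ≤ (1 + δ)⁻¹ * (1 + ε)⁻¹ * ((1 + ε) * ((1 + δ) * a ^ 2 + (1 + δ) * δ⁻¹ * X ^ 2)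
        + (1 + ε) * ε⁻¹ * Y ^ 2) := by
    gcongr
    exact h2.trans (by gcongr)
  have h5 : (1 + δ)⁻¹ * (1 + ε)⁻¹ * ((1 + ε) * ((1 + δ) * a ^ 2 + (1 + δ) * δ⁻¹ * X ^ 2)
        + (1 + ε) * ε⁻¹ * Y ^ 2) = a ^ 2 + δ⁻¹ * X ^ 2 + (1 + δ)⁻¹ * ε⁻¹ * Y ^ 2 := by
    field_simp
  linarith

/-- An estimate for the indicators on the elements turns into one for the estimators. The bound is
stated for two arbitrary linearization points and holds with their roles exchanged. -/
theorem dualEstimatorSq_ge {Ω : Set (Sp d)} (hΩ : IsOpen Ω) (hd : d ≠ 0) {n : ℕ}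
    {𝒯₀ 𝒯 : Finset (Finset (Sp d))} (h₀ : IsTriangulation Ω 𝒯₀) (h𝒯 : IsRefinement Ω 𝒯₀ 𝒯)
    {A : Sp d → (Sp d →L[ℝ] Sp d)} {b : Sp d → ℝ → ℝ} {g y₁ y₂ v₁ v₂ u v w : Sp d → ℝ} {K : NNReal}
    (hA : LipschitzOnWith K A Ω) {B Θ κ Λ δ ε : ℝ} (hB : 0 ≤ B) (hΘ : 0 ≤ Θ) (hκ : 0 ≤ κ)
    (hΛ : 0 ≤ Λ) (hδ : 0 < δ) (hε : 0 < ε) (hvw : MemH1 Ω (v - w))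
    (hu : MemLp u 2 (volume.restrict Ω))
    (hst : ∀ T ∈ 𝒯, |dualIndicator Ω n 𝒯 A b g y₂ v₂ T - dualIndicator Ω n 𝒯 A b g y₁ v₁ T|
      ≤ Λ * dataEstimator 𝒯 A B T * h1Norm Ω (patch 𝒯 T) (v - w)
        + Θ * κ * meshSize T * l2Norm (cell T) u)
    {ℳ : Finset (Finset (Sp d))} (hℳ : ℳ ⊆ 𝒯) :
    dualEstimatorSq Ω n 𝒯 A b g y₁ v₁ ℳ
      ≥ (1 + δ)⁻¹ * (1 + ε)⁻¹ * dualEstimatorSq Ω n 𝒯 A b g y₂ v₂ ℳ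
        - (1 + δ)⁻¹ * ε⁻¹ * Θ ^ 2 * κ ^ 2 * maxMeshSize 𝒯₀ ^ 2 * l2Norm Ω u ^ 2
        - (d + 2) * δ⁻¹ * Λ ^ 2 * maxDataEstimator 𝒯₀ A B ^ 2 * h1Norm Ω Ω (v - w) ^ 2 := by
  set H := maxMeshSize 𝒯₀
  set η := maxDataEstimator 𝒯₀ A B
  have hloc : ∀ s ∈ 𝒯, (1 + δ)⁻¹ * (1 + ε)⁻¹ * dualIndicator Ω n 𝒯 A b g y₂ v₂ s ^ 2
      - (1 + δ)⁻¹ * ε⁻¹ * (Θ * κ * H) ^ 2 * l2Norm (cell s) u ^ 2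
      - δ⁻¹ * (Λ * η) ^ 2 * h1Norm Ω (patch 𝒯 s) (v - w) ^ 2
      ≤ dualIndicator Ω n 𝒯 A b g y₁ v₁ s ^ 2 := by
    intro s hs
    have h1 := (le_abs_self _).trans (hst s hs)
    have hm := h𝒯.meshSize_le hs
    have hη := h𝒯.dataEstimator_le hΩ h₀ hA hB hs
    have hm0 := meshSize_nonneg s
    have hη0 := dataEstimator_nonneg 𝒯 A B s
    have hE0 : 0 ≤ h1Norm Ω (patch 𝒯 s) (v - w) := Real.sqrt_nonneg _
    have hl0 := l2Norm_nonneg (cell s) u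
    have hH0 : 0 ≤ H := hm0.trans hm
    have hη0' : 0 ≤ η := hη0.trans hη
    have h2 : dualIndicator Ω n 𝒯 A b g y₂ v₂ s ≤ dualIndicator Ω n 𝒯 A b g y₁ v₁ s
        + Λ * η * h1Norm Ω (patch 𝒯 s) (v - w) + Θ * κ * H * l2Norm (cell s) u := by
      have h3 : Λ * dataEstimator 𝒯 A B s * h1Norm Ω (patch 𝒯 s) (v - w)
          ≤ Λ * η * h1Norm Ω (patch 𝒯 s) (v - w) := by gcongr
      have h4 : Θ * κ * meshSize s * l2Norm (cell s) u ≤ Θ * κ * H * l2Norm (cell s) u := by gcongr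
      linarith
    have h5 := sq_ge_of_le_add_add (Real.sqrt_nonneg _) hδ hε h2
    refine le_trans (le_of_eq ?_) h5
    unfold dualIndicator
    ring
  have hsum := Finset.sum_le_sum fun s hs => hloc s (hℳ hs)
  rw [Finset.sum_sub_distrib, Finset.sum_sub_distrib, ← Finset.mul_sum, ← Finset.mul_sum,
    ← Finset.mul_sum] at hsum
  have h1 : ∑ s ∈ ℳ, l2Norm (cell s) u ^ 2 ≤ l2Norm Ω u ^ 2 := by
    rw [← h𝒯.1.sum_l2Norm_cell_sq hu]
    exact Finset.sum_le_sum_of_subset_of_nonneg hℳ fun _ _ _ => by positivity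
  have h2 : ∑ s ∈ ℳ, h1Norm Ω (patch 𝒯 s) (v - w) ^ 2 ≤ (d + 2) * h1Norm Ω Ω (v - w) ^ 2 :=
    (Finset.sum_le_sum_of_subset_of_nonneg hℳ fun _ _ _ => by positivity).trans
      (h𝒯.1.sum_h1Norm_patch_sq_le hd hvw)
  have h3 : (1 + δ)⁻¹ * ε⁻¹ * (Θ * κ * H) ^ 2 * ∑ s ∈ ℳ, l2Norm (cell s) u ^ 2
      ≤ (1 + δ)⁻¹ * ε⁻¹ * (Θ * κ * H) ^ 2 * l2Norm Ω u ^ 2 := by gcongr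
  have h4 : δ⁻¹ * (Λ * η) ^ 2 * ∑ s ∈ ℳ, h1Norm Ω (patch 𝒯 s) (v - w) ^ 2
      ≤ δ⁻¹ * (Λ * η) ^ 2 * ((d + 2) * h1Norm Ω Ω (v - w) ^ 2) := by gcongr
  unfold dualEstimatorSq
  refine le_trans (le_trans (le_of_eq ?_) (sub_le_sub (sub_le_sub le_rfl h3) h4)) hsum
  ring

theorem l2Norm_sub_comm (D : Set (Sp d)) (f g : Sp d → ℝ) :
    l2Norm D (f - g) = l2Norm D (g - f) := by
  rw [l2Norm, lpNorm, eLpNorm_sub_comm]; rfl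

end GOAFEM


theorem corollary5p4 (d : ℕ) (hd : d = 2 ∨ d = 3) (n : ℕ)
    (Ω : Set (Sp d)) (hΩ : IsOpen Ω) (hΩc : IsConnected Ω)
    (𝒯₀ : Finset (Finset (Sp d))) (h𝒯₀ : IsTriangulation Ω 𝒯₀) :
    ∃ Λ : ℝ, 0 < Λ ∧
      ∀ (A : Sp d → (Sp d →L[ℝ] Sp d)) (b : Sp d → ℝ → ℝ) (f g : Sp d → ℝ),
      ProblemData Ω A b f → MemLp g 2 (volume.restrict Ω) →
      ∀ u : Sp d → ℝ, IsPrimalSolution Ω A b f u →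
      ∀ um up : Sp d → ℝ, MemLp um ⊤ (volume.restrict Ω) → MemLp up ⊤ (volume.restrict Ω) →
      InInterval Ω um up u →
      ∀ B Θ : ℝ, IsLipConst Ω b um up B → IsDerivLipConst Ω b um up Θ →
      ∀ zm zp : Sp d → ℝ, MemLp zm ⊤ (volume.restrict Ω) → MemLp zp ⊤ (volume.restrict Ω) →
      -- switching between two approximate dual indicators
      (∀ 𝒯 𝒯j 𝒯k : Finset (Finset (Sp d)),
        IsRefinement Ω 𝒯₀ 𝒯 → IsRefinement Ω 𝒯₀ 𝒯j → IsRefinement Ω 𝒯₀ 𝒯k →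
        ∀ uj uk : Sp d → ℝ,
        IsGalerkinSolution Ω n 𝒯j A b f uj → IsGalerkinSolution Ω n 𝒯k A b f uk →
        InInterval Ω um up uj → InInterval Ω um up uk →
        ∀ v ∈ feSpace Ω n 𝒯, ∀ w ∈ feSpace Ω n 𝒯,
        InInterval Ω zm zp v → InInterval Ω zm zp w →
        ∀ T ∈ 𝒯,
          |dualIndicator Ω n 𝒯 A b g uj v T - dualIndicator Ω n 𝒯 A b g uk w T|
            ≤ Λ * dataEstimator 𝒯 A B T * h1Norm Ω (patch 𝒯 T) (v - w)
              + Θ * intervalBound Ω zm zp * meshSize T * l2Norm (cell T) (uj - uk)) ∧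
      -- switching between the approximate and the limiting dual indicator and estimator
      (∀ 𝒯₁ : Finset (Finset (Sp d)), IsRefinement Ω 𝒯₀ 𝒯₁ →
        ∀ u₁ : Sp d → ℝ, IsGalerkinSolution Ω n 𝒯₁ A b f u₁ → InInterval Ω um up u₁ →
        ∀ v ∈ feSpace Ω n 𝒯₁, ∀ w ∈ feSpace Ω n 𝒯₁,
        InInterval Ω zm zp v → InInterval Ω zm zp w →
        (∀ T ∈ 𝒯₁,
          |dualIndicator Ω n 𝒯₁ A b g u₁ v T - dualIndicator Ω n 𝒯₁ A b g u w T|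
            ≤ Λ * dataEstimator 𝒯₁ A B T * h1Norm Ω (patch 𝒯₁ T) (v - w)
              + Θ * intervalBound Ω zm zp * meshSize T * l2Norm (cell T) (u - u₁)) ∧
        ∀ ℳ₁ ℳ₂ : Finset (Finset (Sp d)), ℳ₁ ⊆ 𝒯₁ → ℳ₂ ⊆ 𝒯₁ →
        ∀ δ₁ δ₂ δA δB : ℝ, 0 < δ₁ → 0 < δ₂ → 0 < δA → 0 < δB →
          dualEstimatorSq Ω n 𝒯₁ A b g u v ℳ₁
            ≥ (1 + δ₁)⁻¹ * (1 + δA)⁻¹ * dualEstimatorSq Ω n 𝒯₁ A b g u₁ w ℳ₁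
              - (1 + δ₁)⁻¹ * δA⁻¹ * Θ ^ 2 * intervalBound Ω zm zp ^ 2 * maxMeshSize 𝒯₀ ^ 2
                  * l2Norm Ω (u - u₁) ^ 2
              - (d + 2) * δ₁⁻¹ * Λ ^ 2 * maxDataEstimator 𝒯₀ A B ^ 2 * h1Norm Ω Ω (v - w) ^ 2 ∧
          dualEstimatorSq Ω n 𝒯₁ A b g u₁ w ℳ₂
            ≥ (1 + δ₂)⁻¹ * (1 + δB)⁻¹ * dualEstimatorSq Ω n 𝒯₁ A b g u v ℳ₂
              - (1 + δ₂)⁻¹ * δB⁻¹ * Θ ^ 2 * intervalBound Ω zm zp ^ 2 * maxMeshSize 𝒯₀ ^ 2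
                  * l2Norm Ω (u - u₁) ^ 2
              - (d + 2) * δ₂⁻¹ * Λ ^ 2 * maxDataEstimator 𝒯₀ A B ^ 2
                  * h1Norm Ω Ω (v - w) ^ 2) := by
  have hd2 : 2 ≤ d := by omega
  have hd0 : d ≠ 0 := by omega
  obtain ⟨Λ, hΛ, hst⟩ := exists_dualIndicator_stability hd2 n hΩ 𝒯₀
  refine ⟨Λ, hΛ, ?_⟩
  intro A b f g hD hg u hu um up hum hup hui B Θ hB hΘ zm zp hzm hzp
  have hst := hst A b f g hD hg um up B Θ hB hΘ zm zp hzm hzp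
  obtain ⟨K, hK⟩ := hD.lipschitz
  have hu2 : MemLp u 2 (volume.restrict Ω) := hu.1.1.1
  refine ⟨?_, ?_⟩
  · intro 𝒯 𝒯j 𝒯k h𝒯 _ _ uj uk huj huk huji huki v hv w hw _ hwi T hT
    exact hst 𝒯 h𝒯 uj uk huj.1.1.1.1 huk.1.1.1.1 huji huki v hv w hw hwi T hT
  · intro 𝒯₁ h𝒯 u₁ hu₁ hu₁i v hv w hw hvi hwi
    have hu₁2 : MemLp u₁ 2 (volume.restrict Ω) := hu₁.1.1.1.1
    refine ⟨fun T hT => ?_, ?_⟩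
    · rw [l2Norm_sub_comm]
      exact hst 𝒯₁ h𝒯 u₁ u hu₁2 hu2 hu₁i hui v hv w hw hwi T hT
    · intro ℳ₁ ℳ₂ hℳ₁ hℳ₂ δ₁ δ₂ δA δB hδ₁ hδ₂ hδA hδB
      have hvw : MemH1 Ω (v - w) := hv.1.1.sub hw.1.1
      have key : ∀ T ∈ 𝒯₁,
          |dualIndicator Ω n 𝒯₁ A b g u v T - dualIndicator Ω n 𝒯₁ A b g u₁ w T|
            ≤ Λ * dataEstimator 𝒯₁ A B T * h1Norm Ω (patch 𝒯₁ T) (v - w)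
              + Θ * intervalBound Ω zm zp * meshSize T * l2Norm (cell T) (u - u₁) := fun T hT =>
        hst 𝒯₁ h𝒯 u u₁ hu2 hu₁2 hui hu₁i v hv w hw hwi T hT
      have key' := key
      simp only [abs_sub_comm (dualIndicator Ω n 𝒯₁ A b g u v _)] at key'
      have hκ := intervalBound_nonneg Ω zm zp
      exact ⟨dualEstimatorSq_ge hΩ hd0 h𝒯₀ h𝒯 hK hB.1 hΘ.1 hκ hΛ.le hδ₁ hδA hvw (hu2.sub hu₁2) key' hℳ₁,
        dualEstimatorSq_ge hΩ hd0 h𝒯₀ h𝒯 hK hB.1 hΘ.1 hκ hΛ.le hδ₂ hδB hvw (hu2.sub hu₁2) key hℳ₂⟩
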